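/- A partial field $\mathbb{P}=(P,+,\cdot,0,1)$ is a set $P$ with distinguished elements $0,1$, a commutative binary operation $\cdot$ with $0p=0$ for all $p$, and a partially defined binary operation $+$, such that: $(P\setminus\{0\},\cdot,1)$ is an abelian group; $p+0=p$ for all $p$; every $p$ has a unique $-p$ with $p+(-p)=0$; if $p+q$ is defined then so is $q+p$, and $p+q=q+p$; if $q+r$ is defined then so is $pq+pr$, and $p(q+r)=pq+pr$; and the associative law holds: if some bracketing of a finite multiset $S$ of elements has all its intermediate sums and its total defined, with total $r$, then for every other bracketing of $S$ (in any order) all of whose intermediate sums other than the last one are defined, the last sum is defined as well and the total is $r$. We write $p+q\doteq r$ if $p+q$ is defined and equal to $r$. A sum $p_1+\cdots+p_n$ is defined, with value $r$, if there is a finite multiset $Z=\{z_1,-z_1,\dots,z_k,-z_k\}$ such that some bracketing of the multiset $\{p_1,\dots,p_n\}\cup Z$ has all its sums defined and total $r$. A matrix over $\mathbb{P}$ is a $\mathbb{P}$-matrix if the determinant $\sum_\sigma \operatorname{sgn}(\sigma)\prod_i a_{i\sigma(i)}$ of each of its square submatrices is defined; its rank is the largest size of a square submatrix with nonzero determinant.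 A (finite) matroid $M$ on $E$ is $\mathbb{P}$-representable if for some $r$ there is an $r\times E$ $\mathbb{P}$-matrix $A$ of rank $r$ such that the bases of $M$ are exactly the sets $B\subseteq E$ with $|B|=r$ and $\det A[r,B]\neq 0$, where $A[r,B]$ consists of the columns of $A$ in $B$. The set of fundamental elements of $\mathbb{P}$ is $\mathcal{F}(\mathbb{P})=\{p\in \mathbb{P} : 1-p \text{ is defined}\}$. A homomorphism $\phi:\hat{\mathbb{P}}\to\mathbb{P}$ of partial fields is a map such that $\phi(pq)=\phi(p)\phi(q)$ for all $p,q$, and $\phi(p)+\phi(q)\doteq\phi(p+q)$ whenever $p+q$ is defined. A lifting function for $\phi$ is a function ${}^\uparrow:\mathcal{F}(\mathbb{P})\to\hat{\mathbb{P}}$ such that for all $p,q\in\mathcal{F}(\mathbb{P})$: $\phi(p^\uparrow)=p$; if $p+q\doteq 1$ then $p^\uparrow+q^\uparrow\doteq 1$; if $pq=1$ then $p^\uparrow q^\uparrow=1$. Corollary. Let $\mathbb{P}$, $\hat{\mathbb{P}}$ be partial fields, let $\phi:\hat{\mathbb{P}}\to\mathbb{P}$ be a homomorphism, and let ${}^\uparrow:\mathcal{F}(\mathbb{P})\to\hat{\mathbb{P}}$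 be a lifting function for $\phi$. Suppose that 1. if $1+1\doteq 0$ in $\mathbb{P}$, then $1+1\doteq 0$ in $\hat{\mathbb{P}}$; 2. if $1+1$ is defined and nonzero in $\mathbb{P}$, then $1+1$ is defined and nonzero in $\hat{\mathbb{P}}$; 3. for all $p,q,r\in\mathcal{F}(\mathbb{P})$ with $pqr=1$, we have $p^\uparrow q^\uparrow r^\uparrow=1$. Then a matroid is $\mathbb{P}$-representable if and only if it is $\hat{\mathbb{P}}$-representable. -/

import Mathlib

/-- `Association add S r`: there is a binary tree whose leaves are labelled with the elements of the
multiset `S` (one leaf for each element), in which every inner node is labelled with the sum of the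
labels of its two children (all these sums being defined for the partial operation `add`), and whose
root has label `r`. -/
inductive Association {P : Type*} (add : P → P → Option P) : Multiset P → P → Prop
  | leaf (p : P) : Association add {p} p
  | node {S T : Multiset P} {u w r : P} : Association add S u → Association add T w →
      add u w = some r → Association add (S + T) r

/-- A partial field: a set with a multiplication that makes the nonzero elements an abelian group
(and `0 * p = 0`), and a partially defined addition `padd` (`padd p q = some r` says that `p + q` is
defined and equal to `r`).

In `padd_mul`, for `p ≠ 0`, the converse (if `p * q + p * r` is defined then so is `q + r`) follows
by multiplying with `p⁻¹`; for `p = 0` the converse is not meant, as it would make every sum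
defined. -/
class PartialField (P : Type*) extends CommGroupWithZero P, Neg P where
  /-- the partial addition -/
  padd : P → P → Option P
  padd_zero : ∀ p : P, padd p 0 = some p
  padd_neg : ∀ p : P, padd p (-p) = some 0
  neg_unique : ∀ p q : P, padd p q = some 0 → q = -p
  padd_comm : ∀ p q s : P, padd p q = some s → padd q p = some s
  padd_mul : ∀ p q r s : P, padd q r = some s → padd (p * q) (p * r) = some (p * s)
  /-- The associative law: if `S` has an association with root label `r`, then for every other
  tree on `S`, with labels `u` and `w` at the two children of its root, `u + w` is defined and
  equal to `r`. -/
  padd_assoc : ∀ (S : Multiset P) (r : P), Association padd S r →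
    ∀ (S₁ S₂ : Multiset P) (u w : P), S₁ + S₂ = S →
      Association padd S₁ u → Association padd S₂ w → padd u w = some r

namespace PartialField

/-- The sum of the multiset `S` is defined and equal to `r`: for some finite multiset
`{z₁, -z₁, …, zₖ, -zₖ}`, its union with `S` has an association with root label `r`. -/
def SumsTo {P : Type*} [PartialField P] (S : Multiset P) (r : P) : Prop :=
  ∃ Z : Multiset P, Association (padd (P := P)) (S + (Z + Z.map (fun z => -z))) r

/-- The multiset of the `n!` terms `sign(σ) a_{1σ(1)} ⋯ a_{nσ(n)}` of the determinant. -/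
def detTerms {P : Type*} [PartialField P] {n : ℕ} (A : Matrix (Fin n) (Fin n) P) : Multiset P :=
  (Finset.univ : Finset (Equiv.Perm (Fin n))).val.map
    (fun σ => if Equiv.Perm.sign σ = 1 then ∏ i, A i (σ i) else -(∏ i, A i (σ i)))

/-- `det A` is defined and equal to `d`. -/
def HasDet {P : Type*} [PartialField P] {n : ℕ} (A : Matrix (Fin n) (Fin n) P) (d : P) : Prop :=
  SumsTo (detTerms A) d

/-- `A` is a `P`-matrix: the determinant of every square submatrix is defined. A square submatrix
is given by choosing, in some order, `k` distinct rows and `k` distinct columns. -/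
def IsPMatrix {P : Type*} [PartialField P] {X Y : Type*} (A : Matrix X Y P) : Prop :=
  ∀ (k : ℕ) (f : Fin k ↪ X) (g : Fin k ↪ Y), ∃ d : P, HasDet (A.submatrix f g) d

/-- `r` is the rank of `A`, that is, the largest size of a square submatrix with nonzero
determinant. -/
def HasRank {P : Type*} [PartialField P] {X Y : Type*} (A : Matrix X Y P) (r : ℕ) : Prop :=
  IsGreatest {k : ℕ | ∃ (f : Fin k ↪ X) (g : Fin k ↪ Y) (d : P),
    HasDet (A.submatrix f g) d ∧ d ≠ 0} r

/-- The family of the `r`-element sets `B` of columns with `det A[r, B] ≠ 0`, for an `r × E`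
matrix `A` (the order `g` in which the columns are listed affects only the sign). -/
def columnBases {P : Type*} [PartialField P] {r : ℕ} {E : Type*} (A : Matrix (Fin r) E P) :
    Set (Set E) :=
  {B | ∃ g : Fin r ↪ E, Set.range g = B ∧ ∃ d : P, HasDet (A.submatrix id g) d ∧ d ≠ 0}

/-- The matroid `M` is `P`-representable: for some `r` there is an `r × E` `P`-matrix `A` of rank
`r`, where `E` is the ground set of `M`, such that `M = M[A]`, that is, the bases of `M` are the
members of `columnBases A`. -/
def IsRepresentable (P : Type*) [PartialField P] {α : Type*} (M : Matroid α) : Prop :=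
  ∃ (r : ℕ) (A : Matrix (Fin r) M.E P), IsPMatrix A ∧ HasRank A r ∧
    ∀ B : Set M.E, M.IsBase (Subtype.val '' B) ↔ B ∈ columnBases A

/-- The set of fundamental elements: those `p` for which `1 - p` is defined. -/
def fundamentals (P : Type*) [PartialField P] : Set P :=
  {p | ∃ q : P, padd 1 (-p) = some q}

/-- Homomorphisms of partial fields. -/
structure Hom (P : Type*) (Q : Type*) [PartialField P] [PartialField Q] where
  /-- the underlying function -/
  toFun : P → Q
  map_mul : ∀ p q : P, toFun (p * q) = toFun p * toFun q
  map_padd : ∀ p q s : P, padd p q = some s → padd (toFun p) (toFun q) = some (toFun s)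

/-- `up` is a lifting function for the homomorphism `φ : Q → P`. -/
structure IsLiftingFunction {P : Type*} {Q : Type*} [PartialField P] [PartialField Q]
    (φ : Hom Q P) (up : fundamentals P → Q) : Prop where
  section_eq : ∀ p : fundamentals P, φ.toFun (up p) = p
  map_add_one : ∀ p q : fundamentals P, padd (p : P) (q : P) = some 1 →
    padd (up p) (up q) = some 1
  map_mul_one : ∀ p q : fundamentals P, (p : P) * (q : P) = 1 → up p * up q = 1

end PartialField

/-! A partial field embeds in a commutative ring without loss. In the quotient `UnivRing P` of ℤ[P]
by the relations [p] + [q] - [p + q], the map `iota` is injective, and a sum is defined with value r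
exactly when the images add up to the image of r (`sumsTo_iff`, `padd_iff`). Determinants over P
thus become ring determinants (`hasDet_iff`), and a P-matrix is a matrix all of whose minors lie in
the image of `iota`.

A homomorphism respects determinants and their vanishing, which settles the passage from Q to P. For
the other direction, the fundamental elements are what occurs as cross ratios of 2 × 2 submatrices,
and the lifting function, written u, lifts these. Inside `UnivRing P × UnivRing Q`, call the pairs
(p, u p) with p fundamental admissible. The hypotheses make them closed under h ↦ 1 - h and
inversion, and under products and signs whenever the first coordinate stays fundamental
(`isLiftSystem`); signs come from (1 - p)(1 + p) = 1 - p² (`IsCrossLift.map_neg`). A matrix is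
`Good` if every sequence of pivots leaves its entries zero or in the unit group and its cross ratios
admissible. By the lift theorem `IsLiftSystem.liftable`, every good matrix over `UnivRing P` is the
first coordinate of a good matrix over the product. Minors of that lift are zero or pairs of nonzero
elements, so its second coordinate is a Q-matrix with the same nonzero maximal minors.

The lift theorem is an induction on the number of nonzero rows and columns. Delete columns x and y
separately and lift both results. Lifts are unique up to scaling (`IsLiftSystem.exists_scale`), so
the two can be made to agree on the common columns and glued (`IsLiftSystem.liftable_of_dropCol`).
The glued matrix is good if, after any pivots outside x and y, two rows that are nonzero in both
columns are always linked by the other columns: pivots shorten a walk between them to length at most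
two, and then the cross ratio is assembled from known ones (`TwoCol.cross_of_linked`). Pivots in x
or y themselves are handled by basis exchange (`IsLiftSystem.good_of_dropCol`).

Suitable columns, or rows after transposing, come from a connected set of vertices with three
neighbours in the bipartite graph of the matrix (`exists_core`). It exists when the graph is
connected and has a vertex of degree three. Otherwise the matrix is disconnected, has a single
nonzero line, is essentially 2 × 2, or acquires such a vertex by one pivot (`exists_two_by_two`). -/

namespace PartialField

/-! ### The universal ring of a partial field. -/

section Ring

variable {P : Type*} [PartialField P]

theorem neg_eq_mul_neg_one (p : P) : -p = p * (-1) := by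
  have h := padd_mul p 1 (-1) 0 (padd_neg 1)
  rw [mul_one, mul_zero] at h
  exact (neg_unique _ _ h).symm

theorem mul_neg_eq (p q : P) : p * (-q) = -(p * q) := by
  rw [neg_eq_mul_neg_one q, neg_eq_mul_neg_one (p * q), mul_assoc]

theorem neg_neg_eq (p : P) : -(-p) = p := by
  have h := padd_comm _ _ _ (padd_neg p)
  exact (neg_unique _ _ h).symm

theorem zero_padd (p : P) : padd 0 p = some p := padd_comm _ _ _ (padd_zero p)

/-- The multiset `{z₁, …, zₖ, -z₁, …, -zₖ}`. -/
def cancelling (Z : Multiset P) : Multiset P := Z + Z.map (fun z => -z)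

theorem cancelling_add (Z W : Multiset P) :
    cancelling (Z + W) = cancelling Z + cancelling W := by
  simp only [cancelling, Multiset.map_add]
  abel

theorem cancelling_cons (z : P) (Z : Multiset P) :
    cancelling (z ::ₘ Z) = ({z} + {-z}) + cancelling Z := by
  rw [← Multiset.singleton_add, cancelling_add]
  simp [cancelling]

/-- Each pair z, -z forms a subtree with root 0, and hanging it on the root leaves the total
unchanged. -/
theorem Association.add_cancelling {S : Multiset P} {r : P} (h : Association padd S r)
    (Z : Multiset P) : Association padd (S + cancelling Z) r := by
  induction Z using Multiset.induction_on generalizing S with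
  | empty => simpa [cancelling] using h
  | cons z Z ih =>
    rw [cancelling_cons, ← add_assoc]
    exact ih (Association.node h (Association.node (.leaf z) (.leaf (-z)) (padd_neg z))
      (padd_zero r))

theorem sumsTo_def {S : Multiset P} {r : P} :
    SumsTo S r ↔ ∃ Z : Multiset P, Association padd (S + cancelling Z) r := Iff.rfl

theorem sumsTo_of_add_cancelling {S W : Multiset P} {r : P} (h : SumsTo (S + cancelling W) r) :
    SumsTo S r := by
  obtain ⟨Z, hZ⟩ := h
  refine ⟨W + Z, ?_⟩
  have := cancelling_add W Z
  unfold cancelling at this hZ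
  rw [this, ← add_assoc]
  exact hZ

theorem SumsTo.add_cancelling {S : Multiset P} {r : P} (h : SumsTo S r) (W : Multiset P) :
    SumsTo (S + cancelling W) r := by
  obtain ⟨Z, hZ⟩ := h
  refine ⟨Z, ?_⟩
  have := Association.add_cancelling hZ W
  rwa [add_right_comm] at this

theorem SumsTo.add {S T : Multiset P} {u w r : P} (hS : SumsTo S u) (hT : SumsTo T w)
    (h : padd u w = some r) : SumsTo (S + T) r := by
  obtain ⟨Z, hZ⟩ := hS
  obtain ⟨W, hW⟩ := hT
  refine ⟨Z + W, ?_⟩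
  have key := Association.node hZ hW h
  have e := cancelling_add Z W
  unfold cancelling at e
  rw [e]
  convert key using 1
  abel

theorem sumsTo_singleton (p : P) : SumsTo {p} p := ⟨0, by simpa using Association.leaf p⟩

theorem sumsTo_zero_zero : SumsTo (0 : Multiset P) 0 :=
  ⟨{0}, by simpa using Association.node (.leaf (0 : P)) (.leaf (-0)) (padd_neg 0)⟩

theorem Association.mul_left (a : P) {S : Multiset P} {r : P} (h : Association padd S r) :
    Association padd (S.map (a * ·)) (a * r) := by
  induction h with
  | leaf p => simpa using Association.leaf (a * p)
  | node _ _ h ih1 ih2 =>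
    rw [Multiset.map_add]
    exact Association.node ih1 ih2 (padd_mul _ _ _ _ h)

theorem SumsTo.mul_left (a : P) {S : Multiset P} {r : P} (h : SumsTo S r) :
    SumsTo (S.map (a * ·)) (a * r) := by
  obtain ⟨Z, hZ⟩ := h
  refine ⟨Z.map (a * ·), ?_⟩
  have := Association.mul_left a hZ
  simpa [Multiset.map_add, mul_neg_eq, Function.comp_def] using this

/-- The formal sum of a multiset. -/
noncomputable def formalSum : Multiset P →+ MonoidAlgebra ℤ P where
  toFun S := (S.map (fun p => MonoidAlgebra.of ℤ P p)).sum
  map_zero' := by simp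
  map_add' := by simp

theorem formalSum_singleton (p : P) : formalSum {p} = MonoidAlgebra.of ℤ P p := by
  simp [formalSum]

theorem formalSum_apply [DecidableEq P] (S : Multiset P) (p : P) :
    (formalSum S : MonoidAlgebra ℤ P).coeff p = S.count p := by
  induction S using Multiset.induction_on with
  | empty => simp
  | cons a S ih =>
    rw [← Multiset.singleton_add, map_add, formalSum_singleton, Multiset.count_add]
    simp [ih, Finsupp.single_apply, Multiset.count_singleton, eq_comm]

theorem formalSum_injective : Function.Injective (formalSum : Multiset P → MonoidAlgebra ℤ P) := by
  classical
  intro S T h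
  ext p
  have := congrArg (fun f : MonoidAlgebra ℤ P => f.coeff p) h
  simpa [formalSum_apply] using this

variable (P) in
/-- The ideal generated by the relations `[p] + [q] - [p + q]`. -/
noncomputable def relIdeal : Ideal (MonoidAlgebra ℤ P) :=
  Ideal.span {x | ∃ p q r : P, padd p q = some r ∧
    x = MonoidAlgebra.of ℤ P p + MonoidAlgebra.of ℤ P q - MonoidAlgebra.of ℤ P r}

/-- `x` is a difference of two formal sums whose difference is a defined sum equal to `0`. -/
def IsNull (x : MonoidAlgebra ℤ P) : Prop :=
  ∃ S T : Multiset P, x = formalSum S - formalSum T ∧ SumsTo (S + T.map (fun t => -t)) 0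

theorem IsNull.add {x y : MonoidAlgebra ℤ P} (hx : IsNull x) (hy : IsNull y) :
    IsNull (x + y) := by
  obtain ⟨S, T, rfl, h⟩ := hx
  obtain ⟨S', T', rfl, h'⟩ := hy
  refine ⟨S + S', T + T', ?_, ?_⟩
  · simp only [map_add]; abel
  · have := h.add h' (padd_zero 0)
    rw [Multiset.map_add]
    convert this using 1
    abel

theorem IsNull.neg {x : MonoidAlgebra ℤ P} (hx : IsNull x) : IsNull (-x) := by
  obtain ⟨S, T, rfl, h⟩ := hx
  refine ⟨T, S, by abel, ?_⟩
  have := h.mul_left (-1)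
  rw [mul_zero, Multiset.map_add, Multiset.map_map] at this
  convert this using 1
  rw [add_comm]
  congr 1
  · refine Multiset.map_congr rfl fun x _ => ?_
    rw [neg_eq_mul_neg_one, mul_comm]
  · conv_lhs => rw [← Multiset.map_id T]
    refine Multiset.map_congr rfl fun x _ => ?_
    simp only [Function.comp]
    rw [mul_comm, ← neg_eq_mul_neg_one, neg_neg_eq, id]

theorem of_mul_formalSum (a : P) (S : Multiset P) :
    MonoidAlgebra.of ℤ P a * formalSum S = formalSum (S.map (a * ·)) := by
  induction S using Multiset.induction_on with
  | empty => simp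
  | cons b S ih =>
    rw [← Multiset.singleton_add, map_add, mul_add, ih, Multiset.map_add, map_add,
      formalSum_singleton, Multiset.map_singleton, formalSum_singleton, map_mul]

theorem IsNull.of_mul {x : MonoidAlgebra ℤ P} (a : P) (hx : IsNull x) :
    IsNull (MonoidAlgebra.of ℤ P a * x) := by
  obtain ⟨S, T, rfl, h⟩ := hx
  refine ⟨S.map (a * ·), T.map (a * ·), by rw [mul_sub, of_mul_formalSum, of_mul_formalSum], ?_⟩
  have := h.mul_left a
  simpa [Multiset.map_add, mul_neg_eq, Function.comp_def] using this

theorem isNull_zero : IsNull (0 : MonoidAlgebra ℤ P) :=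
  ⟨0, 0, by simp, by simpa using sumsTo_zero_zero⟩

theorem IsNull.nsmul {x : MonoidAlgebra ℤ P} (hx : IsNull x) (n : ℕ) : IsNull (n • x) := by
  induction n with
  | zero => simpa using isNull_zero
  | succ n ih => rw [succ_nsmul]; exact ih.add hx

theorem IsNull.zsmul {x : MonoidAlgebra ℤ P} (hx : IsNull x) (n : ℤ) : IsNull (n • x) := by
  obtain ⟨m, rfl | rfl⟩ := n.eq_nat_or_neg
  · simpa using hx.nsmul m
  · simpa using (hx.nsmul m).neg

/-- Multiplication by an element of P preserves defined sums, and such elements span the monoid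
algebra over ℤ. With `IsNull.add` this makes the null elements an ideal. -/
theorem IsNull.mul_left {x : MonoidAlgebra ℤ P} (hx : IsNull x) (y : MonoidAlgebra ℤ P) :
    IsNull (y * x) := by
  induction y using MonoidAlgebra.induction_on with
  | of a => exact hx.of_mul a
  | add f g hf hg => rw [add_mul]; exact hf.add hg
  | smul r f hf => rw [smul_mul_assoc]; exact hf.zsmul r

theorem isNull_of_mem_relIdeal {x : MonoidAlgebra ℤ P} (hx : x ∈ relIdeal P) : IsNull x := by
  refine Submodule.span_induction ?_ isNull_zero (fun _ _ _ _ => IsNull.add)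
    (fun y _ _ h => h.mul_left y) hx
  rintro _ ⟨p, q, r, h, rfl⟩
  refine ⟨{p} + {q}, {r}, by rw [map_add]; simp only [formalSum_singleton], ?_⟩
  rw [Multiset.map_singleton]
  exact ((sumsTo_singleton p).add (sumsTo_singleton q) h).add (sumsTo_singleton (-r)) (padd_neg r)

theorem sumsTo_of_formalSum_sub_mem {S T : Multiset P}
    (h : (formalSum S - formalSum T : MonoidAlgebra ℤ P) ∈ relIdeal P) :
    SumsTo (S + T.map (fun t => -t)) 0 := by
  obtain ⟨A, B, hAB, hs⟩ := isNull_of_mem_relIdeal h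
  -- A null element has many presentations as a difference of formal sums. Injectivity of
  -- `formalSum` makes two of them differ by cancelling terms only, and those may be added or
  -- removed freely.
  have e : S + B = A + T := formalSum_injective (by
    rw [map_add, map_add]
    linear_combination (exp := 1) hAB)
  apply sumsTo_of_add_cancelling (W := B)
  have := hs.add_cancelling T
  convert this using 1
  simp only [cancelling]
  calc S + T.map (fun t => -t) + (B + B.map (fun z => -z))
      = (S + B) + (T.map (fun t => -t) + B.map (fun z => -z)) := by abel
    _ = _ := by rw [e]; abel

variable (P) in
/-- The universal ring of a partial field. -/
abbrev UnivRing : Type _ := MonoidAlgebra ℤ P ⧸ relIdeal P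

theorem mk_of_add {p q r : P} (h : padd p q = some r) :
    Ideal.Quotient.mk (relIdeal P) (MonoidAlgebra.of ℤ P p) +
      Ideal.Quotient.mk (relIdeal P) (MonoidAlgebra.of ℤ P q) =
      Ideal.Quotient.mk (relIdeal P) (MonoidAlgebra.of ℤ P r) := by
  rw [← map_add, Ideal.Quotient.eq]
  exact Ideal.subset_span ⟨p, q, r, h, rfl⟩

/-- The embedding of a partial field into its universal ring. -/
noncomputable def iota : P →*₀ UnivRing P where
  toFun p := Ideal.Quotient.mk (relIdeal P) (MonoidAlgebra.of ℤ P p)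
  map_zero' := by simpa using mk_of_add (padd_zero (0 : P))
  map_one' := by rw [map_one, map_one]
  map_mul' p q := by rw [map_mul, map_mul]

theorem iota_add {p q r : P} (h : padd p q = some r) : iota p + iota q = iota r := mk_of_add h

theorem iota_neg (p : P) : iota (-p) = -iota p := by
  have := iota_add (padd_neg p)
  rw [map_zero] at this
  exact (neg_eq_of_add_eq_zero_right this).symm

theorem mk_formalSum (S : Multiset P) :
    Ideal.Quotient.mk (relIdeal P) (formalSum S) = (S.map iota).sum := by
  simp [formalSum, map_multiset_sum, iota]

theorem sum_iota_cancelling (Z : Multiset P) : ((cancelling Z).map iota).sum = 0 := by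
  simp [cancelling, Multiset.map_map, iota_neg]

theorem Association.sum_iota {S : Multiset P} {r : P} (h : Association padd S r) :
    (S.map iota).sum = iota r := by
  induction h with
  | leaf p => simp
  | node _ _ h ih1 ih2 => rw [Multiset.map_add, Multiset.sum_add, ih1, ih2, iota_add h]

/-- For the converse, the difference of the two sides lies in `relIdeal`, so S together with -r sums
to 0. Adding r back leaves a cancelling pair, which `SumsTo` ignores. -/
theorem sumsTo_iff {S : Multiset P} {r : P} : SumsTo S r ↔ (S.map iota).sum = iota r := by
  constructor
  · rintro ⟨Z, hZ⟩
    have := Association.sum_iota hZ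
    rw [Multiset.map_add, Multiset.sum_add] at this
    have h2 := sum_iota_cancelling Z
    unfold cancelling at h2
    rwa [h2, add_zero] at this
  · intro h
    have h0 : SumsTo (S + ({r} : Multiset P).map (fun t => -t)) 0 := by
      apply sumsTo_of_formalSum_sub_mem
      rw [← Ideal.Quotient.eq, mk_formalSum, mk_formalSum, h]
      simp
    have h1 := h0.add (sumsTo_singleton r) (zero_padd r)
    apply sumsTo_of_add_cancelling (W := {r})
    convert h1 using 1
    simp only [cancelling]
    abel

theorem padd_iff {p q r : P} : padd p q = some r ↔ iota p + iota q = iota r := by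
  refine ⟨iota_add, fun h => ?_⟩
  have h1 : SumsTo ({p} + {q}) r := sumsTo_iff.2 (by simpa using h)
  obtain ⟨Z, hZ⟩ := sumsTo_def.1 h1
  -- The associative law applies to the tree with children p and q, where q is the root of a tree
  -- that absorbs all the cancelling pairs.
  exact padd_assoc _ r hZ {p} ({q} + cancelling Z) p q (by rw [add_assoc]) (.leaf p)
    (Association.add_cancelling (.leaf q) Z)

theorem iota_injective : Function.Injective (iota : P → UnivRing P) := by
  intro p q h
  have : padd p 0 = some q := padd_iff.2 (by rw [map_zero, add_zero, h])
  rw [padd_zero] at this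
  exact Option.some.inj this

instance : Nontrivial (UnivRing P) :=
  ⟨iota 0, iota 1, fun h => zero_ne_one (iota_injective h)⟩

theorem hasDet_iff {n : ℕ} {A : Matrix (Fin n) (Fin n) P} {d : P} :
    HasDet A d ↔ (A.map iota).det = iota d := by
  unfold HasDet
  rw [sumsTo_iff]
  have : ((detTerms A).map iota).sum = (A.map iota).det := by
    -- The terms of `detTerms` use the entries (i, σ i), those of `Matrix.det_apply` the entries (σ
    -- i, i).
    rw [← Matrix.det_transpose, Matrix.det_apply]
    unfold detTerms
    rw [Multiset.map_map]
    refine congrArg Multiset.sum (Multiset.map_congr rfl fun σ _ => ?_)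
    rcases Int.units_eq_one_or (Equiv.Perm.sign σ) with h | h
    · simp [h]
    · simp [h, iota_neg]
  rw [this]

end Ring

end PartialField

/-! ### Pivots, scalings and good matrices. -/

namespace MatrixLift

open Matrix

/-- A group `G` of units of a ring, together with a set `H` of admissible cross ratios. -/
structure CrossSystem (R : Type*) [CommRing R] where
  /-- the group of units -/
  G : Subgroup Rˣ
  /-- the set of admissible cross ratios -/
  H : Set R
  neg_one_mem : -1 ∈ G

section Basic

variable {R : Type*} [CommRing R] {X Y : Type*} (D : CrossSystem R)

/-- The elements of `G` together with `0`. -/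
def CrossSystem.elems : Set R := {x | x = 0 ∨ ∃ g ∈ D.G, (g : R) = x}

variable {D}

theorem zero_mem_elems : (0 : R) ∈ D.elems := Or.inl rfl

theorem unit_mem_elems {g : Rˣ} (hg : g ∈ D.G) : (g : R) ∈ D.elems := Or.inr ⟨g, hg, rfl⟩

theorem one_mem_elems : (1 : R) ∈ D.elems := unit_mem_elems (g := 1) D.G.one_mem

theorem exists_unit {a : R} (ha : a ∈ D.elems) (h : a ≠ 0) : ∃ g ∈ D.G, (g : R) = a :=
  ha.resolve_left h

theorem mul_mem_elems {a b : R} (ha : a ∈ D.elems) (hb : b ∈ D.elems) : a * b ∈ D.elems := by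
  rcases ha with rfl | ⟨g, hg, rfl⟩
  · exact Or.inl (zero_mul _)
  rcases hb with rfl | ⟨g', hg', rfl⟩
  · exact Or.inl (mul_zero _)
  · exact Or.inr ⟨g * g', D.G.mul_mem hg hg', by simp⟩

theorem neg_mem_elems {a : R} (ha : a ∈ D.elems) : -a ∈ D.elems := by
  have := mul_mem_elems (unit_mem_elems (D := D) D.neg_one_mem) ha
  simpa using this

theorem inverse_mem_elems {a : R} (ha : a ∈ D.elems) : Ring.inverse a ∈ D.elems := by
  rcases ha with rfl | ⟨g, hg, rfl⟩
  · exact Or.inl (Ring.inverse_zero _)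
  · exact Or.inr ⟨g⁻¹, D.G.inv_mem hg, by simp⟩

theorem mul_inverse {a : R} (ha : a ∈ D.elems) (h : a ≠ 0) : a * Ring.inverse a = 1 := by
  obtain ⟨g, -, rfl⟩ := exists_unit ha h
  simp

/-- The ring need not be a domain (a product of rings will be used), but nonzero members of `elems`
are units. -/
theorem cancel {a x y : R} (ha : a ∈ D.elems) (h : a ≠ 0) (hxy : a * x = a * y) : x = y := by
  obtain ⟨g, -, rfl⟩ := exists_unit ha h
  simpa using hxy

theorem mul_ne {a b : R} (ha : a ∈ D.elems) (h : a ≠ 0) (hb : b ≠ 0) : a * b ≠ 0 := fun h0 =>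
  hb (cancel ha h (h0.trans (mul_zero a).symm))

theorem inverse_ne {a : R} (ha : a ∈ D.elems) (h : a ≠ 0) : Ring.inverse a ≠ 0 := fun h0 => by
  have := mul_inverse ha h
  rw [h0, mul_zero] at this
  exact h (by rw [← mul_one a, ← this, mul_zero])

theorem eq_inverse {a b : R} (hab : a * b = 1) : b = Ring.inverse a := by
  have : a = ((Units.mkOfMulEqOne a b hab : Rˣ) : R) := rfl
  rw [this, Ring.inverse_unit]
  rfl

variable (D) in
/-- All entries are zero or in `G`, and all cross ratios of `2 × 2` submatrices are in `H`. -/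
def Good2 (A : Matrix X Y R) : Prop :=
  (∀ i j, A i j ∈ D.elems) ∧ ∀ i j u v, A i v ≠ 0 → A j u ≠ 0 →
    ∃ h ∈ D.H, A i u * A j v = h * (A i v * A j u)

/-- Multiply rows and columns by units. -/
def scale (r : X → Rˣ) (c : Y → Rˣ) (A : Matrix X Y R) : Matrix X Y R :=
  fun i j => r i * A i j * c j

theorem scale_ne_zero {r : X → Rˣ} {c : Y → Rˣ} {A : Matrix X Y R} {i : X} {j : Y} :
    scale r c A i j ≠ 0 ↔ A i j ≠ 0 := by
  simp [scale]

theorem scale_scale (r r' : X → Rˣ) (c c' : Y → Rˣ) (A : Matrix X Y R) :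
    scale r c (scale r' c' A) = scale (r * r') (c * c') A := by
  ext i j
  simp only [scale, Pi.mul_apply, Units.val_mul]
  ring

theorem scale_one (A : Matrix X Y R) : scale 1 1 A = A := by
  ext i j
  simp [scale]

theorem Good2.scale {A : Matrix X Y R} (h : Good2 D A) {r : X → Rˣ} {c : Y → Rˣ}
    (hr : ∀ i, r i ∈ D.G) (hc : ∀ j, c j ∈ D.G) : Good2 D (scale r c A) := by
  refine ⟨fun i j => mul_mem_elems (mul_mem_elems (unit_mem_elems (hr i)) (h.1 i j))
    (unit_mem_elems (hc j)), fun i j u v hiv hju => ?_⟩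
  obtain ⟨t, ht, e⟩ := h.2 i j u v (scale_ne_zero.1 hiv) (scale_ne_zero.1 hju)
  refine ⟨t, ht, ?_⟩
  simp only [MatrixLift.scale]
  linear_combination (r i * c u * r j * c v : R) * e

theorem Good2.submatrix {X' Y' : Type*} {A : Matrix X Y R} (h : Good2 D A) (f : X' → X)
    (g : Y' → Y) : Good2 D (A.submatrix f g) :=
  ⟨fun _ _ => h.1 _ _, fun i j u v => h.2 (f i) (f j) (g u) (g v)⟩

theorem Good2.transpose {A : Matrix X Y R} (h : Good2 D A) : Good2 D Aᵀ := by
  refine ⟨fun _ _ => h.1 _ _, fun i j u v hiv hju => ?_⟩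
  obtain ⟨t, ht, e⟩ := h.2 u v i j hju hiv
  exact ⟨t, ht, by simpa [mul_comm] using e⟩

/-- Replace a column by zeros. -/
def dropCol [DecidableEq Y] (A : Matrix X Y R) (x : Y) : Matrix X Y R :=
  fun i j => if j = x then 0 else A i j

@[simp] theorem dropCol_same [DecidableEq Y] (A : Matrix X Y R) (x : Y) (i : X) :
    dropCol A x i x = 0 := by
  simp [dropCol]

theorem dropCol_of_ne [DecidableEq Y] (A : Matrix X Y R) {x j : Y} (h : j ≠ x) (i : X) :
    dropCol A x i j = A i j := by
  simp [dropCol, h]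

theorem Good2.dropCol [DecidableEq Y] {A : Matrix X Y R} (h : Good2 D A) (x : Y) :
    Good2 D (dropCol A x) := by
  refine ⟨fun i j => ?_, fun i j u v hiv hju => ?_⟩
  · by_cases hj : j = x
    · subst hj; rw [dropCol_same]; exact zero_mem_elems
    · rw [dropCol_of_ne _ hj]; exact h.1 i j
  · have hv : v ≠ x := fun e => hiv (by rw [e, dropCol_same])
    have hu : u ≠ x := fun e => hju (by rw [e, dropCol_same])
    simp only [dropCol_of_ne _ hv, dropCol_of_ne _ hu] at *
    exact h.2 i j u v hiv hju

variable [DecidableEq X] [DecidableEq Y]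

/-- Pivoting on the entry in row `k` and column `l`. -/
noncomputable def pivot (A : Matrix X Y R) (k : X) (l : Y) : Matrix X Y R := fun i j =>
  if i = k then (if j = l then Ring.inverse (A k l) else Ring.inverse (A k l) * A k j)
  else if j = l then -(A i l * Ring.inverse (A k l))
    else A i j - A i l * Ring.inverse (A k l) * A k j

theorem pivot_same (A : Matrix X Y R) (k : X) (l : Y) :
    pivot A k l k l = Ring.inverse (A k l) := by simp [pivot]

theorem pivot_row (A : Matrix X Y R) (k : X) {l j : Y} (h : j ≠ l) :
    pivot A k l k j = Ring.inverse (A k l) * A k j := by simp [pivot, h]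

theorem pivot_col (A : Matrix X Y R) {k i : X} (l : Y) (h : i ≠ k) :
    pivot A k l i l = -(A i l * Ring.inverse (A k l)) := by simp [pivot, h]

theorem pivot_other (A : Matrix X Y R) {k i : X} {l j : Y} (hi : i ≠ k) (hj : j ≠ l) :
    pivot A k l i j = A i j - A i l * Ring.inverse (A k l) * A k j := by simp [pivot, hi, hj]

theorem pivot_row_of_zero (A : Matrix X Y R) {k i : X} {l : Y} (hi : i ≠ k) (h0 : A i l = 0)
    (j : Y) : pivot A k l i j = A i j := by
  by_cases hj : j = l
  · subst hj; rw [pivot_col _ _ hi, h0]; simp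
  · rw [pivot_other _ hi hj, h0]; simp

theorem pivot_col_of_zero (A : Matrix X Y R) {k : X} {l j : Y} (hj : j ≠ l) (h0 : A k j = 0)
    (i : X) : pivot A k l i j = A i j := by
  by_cases hi : i = k
  · subst hi; rw [pivot_row _ _ hj, h0]; simp
  · rw [pivot_other _ hi hj, h0]; simp

theorem pivot_pivot (A : Matrix X Y R) {k : X} {l : Y} (h : A k l * Ring.inverse (A k l) = 1) :
    pivot (pivot A k l) k l = A := by
  have h2 : Ring.inverse (Ring.inverse (A k l)) = A k l :=
    (eq_inverse (by rw [mul_comm]; exact h)).symm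
  ext i j
  by_cases hi : i = k
  · subst hi
    by_cases hj : j = l
    · subst hj; rw [pivot_same, pivot_same, h2]
    · rw [pivot_row _ _ hj, pivot_same, h2, pivot_row _ _ hj]
      linear_combination A i j * h
  · by_cases hj : j = l
    · subst hj
      rw [pivot_col _ _ hi, pivot_same, h2, pivot_col _ _ hi]
      linear_combination A i j * h
    · rw [pivot_other _ hi hj, pivot_same, h2, pivot_col _ _ hi, pivot_row _ _ hj,
        pivot_other _ hi hj]
      linear_combination A i l * Ring.inverse (A k l) * A k j * h

/-- A pivot exchanges the roles of row k and column l, so their scaling factors change places and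
are inverted. -/
theorem pivot_scale (A : Matrix X Y R) (r : X → Rˣ) (c : Y → Rˣ) (k : X) (l : Y) :
    pivot (scale r c A) k l =
      scale (Function.update r k (c l)⁻¹) (Function.update c l (r k)⁻¹) (pivot A k l) := by
  have hinv : Ring.inverse (scale r c A k l) =
      ((c l)⁻¹ : Rˣ) * Ring.inverse (A k l) * ((r k)⁻¹ : Rˣ) := by
    by_cases hA : IsUnit (A k l)
    · obtain ⟨u, hu⟩ := hA
      symm
      apply eq_inverse
      simp only [scale, ← hu, Ring.inverse_unit]
      have e1 := (c l).mul_inv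
      have e2 := u.mul_inv
      have e3 := (r k).mul_inv
      linear_combination (u * ((u⁻¹ : Rˣ) : R) * (r k) * ((r k)⁻¹ : Rˣ) : R) * e1 +
        ((r k) * ((r k)⁻¹ : Rˣ) : R) * e2 + e3
    · rw [Ring.inverse_non_unit _ hA, Ring.inverse_non_unit _ (by simpa [scale] using hA)]
      simp
  have e1 : ((c l : Rˣ) : R) * ((c l)⁻¹ : Rˣ) = 1 := (c l).mul_inv
  have e3 : ((r k : Rˣ) : R) * ((r k)⁻¹ : Rˣ) = 1 := (r k).mul_inv
  ext i j
  by_cases hi : i = k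
  · subst hi
    by_cases hj : j = l
    · subst hj; rw [pivot_same, hinv]; simp [scale, pivot_same]
    · rw [pivot_row _ _ hj, hinv]
      simp only [scale, pivot_row _ _ hj, Function.update_self, Function.update_of_ne hj]
      linear_combination (((c l)⁻¹ : Rˣ) * Ring.inverse (A i l) * A i j * c j : R) * e3
  · by_cases hj : j = l
    · subst hj
      rw [pivot_col _ _ hi, hinv]
      simp only [scale, pivot_col _ _ hi, Function.update_self, Function.update_of_ne hi]
      linear_combination (-((r k)⁻¹ : Rˣ) * Ring.inverse (A k j) * A i j * r i : R) * e1
    · rw [pivot_other _ hi hj, hinv]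
      simp only [scale, pivot_other _ hi hj, Function.update_of_ne hi, Function.update_of_ne hj]
      linear_combination -(Ring.inverse (A k l) * A i l * r i * c j * A k j : R) *
        (e1 * (r k * ((r k)⁻¹ : Rˣ)) + e3)

theorem pivot_transpose (A : Matrix X Y R) (k : X) (l : Y) :
    pivot Aᵀ l k = scale (Function.update 1 l (-1)) (Function.update 1 k (-1))
      (pivot A k l)ᵀ := by
  ext j i
  by_cases hi : i = k
  · subst hi
    by_cases hj : j = l
    · subst hj; simp [scale, pivot_same]
    · rw [pivot_col _ _ hj]
      simp [scale, pivot_row _ _ hj, Function.update_of_ne hj, mul_comm]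
  · by_cases hj : j = l
    · subst hj
      rw [pivot_row _ _ hi]
      simp [scale, pivot_col _ _ hi, Function.update_of_ne hi, mul_comm]
    · rw [pivot_other _ hj hi]
      simp only [scale, transpose_apply, pivot_other _ hi hj, Function.update_of_ne hi,
        Function.update_of_ne hj, Pi.one_apply, Units.val_one]
      ring

theorem pivot_dropCol (A : Matrix X Y R) {x l : Y} (h : l ≠ x) (k : X) :
    pivot (dropCol A x) k l = dropCol (pivot A k l) x := by
  ext i j
  by_cases hj : j = x
  · subst hj
    rw [dropCol_same, pivot_col_of_zero _ h.symm (dropCol_same _ _ _), dropCol_same]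
  · simp only [dropCol_of_ne _ hj, pivot, dropCol_of_ne _ h]

variable (D) in
/-- All matrices obtained from `A` by pivoting satisfy `Good2`. -/
def Good (A : Matrix X Y R) : Prop :=
  ∃ S : Set (Matrix X Y R), A ∈ S ∧ (∀ B ∈ S, Good2 D B) ∧
    ∀ B ∈ S, ∀ k l, B k l ≠ 0 → pivot B k l ∈ S

theorem Good.good2 {A : Matrix X Y R} (h : Good D A) : Good2 D A := by
  obtain ⟨S, hA, h2, -⟩ := h
  exact h2 A hA

theorem Good.mem {A : Matrix X Y R} (h : Good D A) (i : X) (j : Y) : A i j ∈ D.elems :=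
  h.good2.1 i j

theorem Good.pivot {A : Matrix X Y R} (h : Good D A) {k : X} {l : Y} (hkl : A k l ≠ 0) :
    Good D (pivot A k l) := by
  obtain ⟨S, hA, h2, hp⟩ := h
  exact ⟨S, hp A hA k l hkl, h2, hp⟩

/-- Closure under pivots up to scaling suffices: `Good2` is invariant under scaling, and by
`pivot_scale` a pivot of a scaled matrix is a scaled pivot. -/
theorem good_of_closed_scale {S : Set (Matrix X Y R)} (h2 : ∀ B ∈ S, Good2 D B)
    (hp : ∀ B ∈ S, ∀ k l, B k l ≠ 0 → ∃ B' ∈ S, ∃ (r : X → Rˣ) (c : Y → Rˣ),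
      (∀ i, r i ∈ D.G) ∧ (∀ j, c j ∈ D.G) ∧ MatrixLift.pivot B k l = scale r c B')
    {A : Matrix X Y R} (hA : A ∈ S) : Good D A := by
  refine ⟨{C | ∃ B ∈ S, ∃ (r : X → Rˣ) (c : Y → Rˣ), (∀ i, r i ∈ D.G) ∧ (∀ j, c j ∈ D.G) ∧
    C = scale r c B}, ⟨A, hA, 1, 1, fun _ => D.G.one_mem, fun _ => D.G.one_mem,
      (scale_one A).symm⟩, ?_, ?_⟩
  · rintro _ ⟨B, hB, r, c, hr, hc, rfl⟩
    exact (h2 B hB).scale hr hc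
  · rintro _ ⟨B, hB, r, c, hr, hc, rfl⟩ k l hkl
    obtain ⟨B', hB', r', c', hr', hc', e⟩ := hp B hB k l (scale_ne_zero.1 hkl)
    refine ⟨B', hB', Function.update r k (c l)⁻¹ * r', Function.update c l (r k)⁻¹ * c',
      fun i => ?_, fun j => ?_, ?_⟩
    · refine D.G.mul_mem ?_ (hr' i)
      by_cases hi : i = k
      · subst hi; simpa using D.G.inv_mem (hc l)
      · simpa [Function.update_of_ne hi] using hr i
    · refine D.G.mul_mem ?_ (hc' j)
      by_cases hj : j = l
      · subst hj; simpa using D.G.inv_mem (hr k)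
      · simpa [Function.update_of_ne hj] using hc j
    · rw [pivot_scale, e, scale_scale]

theorem Good.scale {A : Matrix X Y R} (h : Good D A) {r : X → Rˣ} {c : Y → Rˣ}
    (hr : ∀ i, r i ∈ D.G) (hc : ∀ j, c j ∈ D.G) : Good D (scale r c A) := by
  obtain ⟨S, hA, h2, hp⟩ := h
  refine good_of_closed_scale (S := {C | ∃ B ∈ S, ∃ (r : X → Rˣ) (c : Y → Rˣ),
    (∀ i, r i ∈ D.G) ∧ (∀ j, c j ∈ D.G) ∧ C = MatrixLift.scale r c B}) ?_ ?_
    ⟨A, hA, r, c, hr, hc, rfl⟩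
  · rintro _ ⟨B, hB, r, c, hr, hc, rfl⟩
    exact (h2 B hB).scale hr hc
  · rintro _ ⟨B, hB, r, c, hr, hc, rfl⟩ k l hkl
    refine ⟨_, ⟨_, hp B hB k l (scale_ne_zero.1 hkl), 1, 1, fun _ => D.G.one_mem,
      fun _ => D.G.one_mem, (scale_one _).symm⟩, Function.update r k (c l)⁻¹,
      Function.update c l (r k)⁻¹, fun i => ?_, fun j => ?_, pivot_scale _ _ _ _ _⟩
    · by_cases hi : i = k
      · subst hi; simpa using D.G.inv_mem (hc l)
      · simpa [Function.update_of_ne hi] using hr i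
    · by_cases hj : j = l
      · subst hj; simpa using D.G.inv_mem (hr k)
      · simpa [Function.update_of_ne hj] using hc j

theorem Good.transpose {A : Matrix X Y R} (h : Good D A) : Good D Aᵀ := by
  obtain ⟨S, hA, h2, hp⟩ := h
  refine good_of_closed_scale (S := {C | Cᵀ ∈ S}) (fun B hB => by simpa using (h2 _ hB).transpose)
    (fun B hB l k hkl => ⟨(MatrixLift.pivot Bᵀ k l)ᵀ, by simpa using hp _ hB k l hkl,
      Function.update 1 l (-1), Function.update 1 k (-1), fun i => ?_, fun j => ?_, ?_⟩)
    (by simpa using hA)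
  · by_cases hi : i = l
    · subst hi; simp [D.neg_one_mem]
    · simp [Function.update_of_ne hi, D.G.one_mem]
  · by_cases hj : j = k
    · subst hj; simp [D.neg_one_mem]
    · simp [Function.update_of_ne hj, D.G.one_mem]
  · have := pivot_transpose Bᵀ k l
    rwa [transpose_transpose] at this

/-- A zero column is never a pivot column and stays zero, so zeroing it commutes with all pivots
that can occur. Keeping the column as zeros avoids a change of index type. -/
theorem Good.dropCol {A : Matrix X Y R} (h : Good D A) (x : Y) :
    Good D (dropCol A x) := by
  obtain ⟨S, hA, h2, hp⟩ := h
  refine ⟨{C | ∃ B ∈ S, C = MatrixLift.dropCol B x}, ⟨A, hA, rfl⟩, ?_, ?_⟩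
  · rintro _ ⟨B, hB, rfl⟩
    exact (h2 B hB).dropCol x
  · rintro _ ⟨B, hB, rfl⟩ k l hkl
    have hl : l ≠ x := fun e => hkl (by rw [e, dropCol_same])
    rw [dropCol_of_ne _ hl] at hkl
    exact ⟨_, hp B hB k l hkl, pivot_dropCol _ hl _⟩

end Basic

end MatrixLift

/-! ### Lift systems, and cross ratios after a row pivot. -/

namespace MatrixLift

open Matrix

/-- Data for lifting matrices along `π`: the admissible cross ratios upstairs lift those downstairs,
and products of admissible cross ratios are admissible as soon as their images are. -/
structure IsLiftSystem {R R₁ : Type*} [CommRing R] [CommRing R₁] (D : CrossSystem R)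
    (D₁ : CrossSystem R₁) (π : R →+* R₁) : Prop where
  nontrivial : (1 : R₁) ≠ 0
  map_G : ∀ g ∈ D.G, Units.map (π : R →* R₁) g ∈ D₁.G
  surj_G : ∀ g₁ ∈ D₁.G, ∃ g ∈ D.G, Units.map (π : R →* R₁) g = g₁
  H_subset : D.H ⊆ D.elems
  map_H : ∀ h ∈ D.H, π h ∈ D₁.H
  zero_mem : (0 : R) ∈ D.H
  one_mem : (1 : R) ∈ D.H
  one_sub_mem : ∀ h ∈ D.H, 1 - h ∈ D.H
  inverse_mem : ∀ h ∈ D.H, h ≠ 0 → Ring.inverse h ∈ D.H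
  mul_mem : ∀ h ∈ D.H, ∀ h' ∈ D.H, π (h * h') ∈ D₁.H → h * h' ∈ D.H
  neg_mem : ∀ h ∈ D.H, π (-h) ∈ D₁.H → -h ∈ D.H
  inj : ∀ h ∈ D.H, ∀ h' ∈ D.H, π h = π h' → h = h'
  surj_H : ∀ p ∈ D₁.H, ∃ h ∈ D.H, π h = p

section

variable {R R₁ : Type*} [CommRing R] [CommRing R₁] {X Y : Type*} {D : CrossSystem R}
  {D₁ : CrossSystem R₁} {π : R →+* R₁}

theorem IsLiftSystem.map_mem (L : IsLiftSystem D D₁ π) {a : R} (ha : a ∈ D.elems) :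
    π a ∈ D₁.elems := by
  rcases ha with rfl | ⟨g, hg, rfl⟩
  · rw [map_zero]; exact zero_mem_elems
  · exact Or.inr ⟨_, L.map_G g hg, rfl⟩

theorem IsLiftSystem.map_ne_zero (L : IsLiftSystem D D₁ π) {a : R} (ha : a ∈ D.elems)
    (h : a ≠ 0) : π a ≠ 0 := fun h0 => L.nontrivial (by
  rw [← map_one π, ← mul_inverse ha h, map_mul, h0, zero_mul])

theorem IsLiftSystem.map_eq_zero (L : IsLiftSystem D D₁ π) {a : R} (ha : a ∈ D.elems) :
    π a = 0 ↔ a = 0 :=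
  ⟨fun h => by_contra fun h0 => L.map_ne_zero ha h0 h, fun h => by rw [h, map_zero]⟩

theorem IsLiftSystem.map_inverse (_L : IsLiftSystem D D₁ π) {a : R} (ha : a ∈ D.elems) :
    π (Ring.inverse a) = Ring.inverse (π a) := by
  by_cases h : a = 0
  · subst h; simp
  · exact eq_inverse (by rw [← map_mul, mul_inverse ha h, map_one])

theorem IsLiftSystem.exists_lift (L : IsLiftSystem D D₁ π) {a : R₁} (ha : a ∈ D₁.elems) :
    ∃ b ∈ D.elems, π b = a := by
  rcases ha with rfl | ⟨g, hg, rfl⟩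
  · exact ⟨0, zero_mem_elems, map_zero _⟩
  · obtain ⟨g', hg', rfl⟩ := L.surj_G g hg
    exact ⟨g', unit_mem_elems hg', rfl⟩

/-- The pattern of all later arguments: upstairs a cross ratio is a product of two admissible ones,
and goodness downstairs shows that its image is admissible, which is the side condition of
`mul_mem`. -/
theorem IsLiftSystem.mul_cross (L : IsLiftSystem D D₁ π) {h h' a b : R} (hh : h ∈ D.H)
    (hh' : h' ∈ D.H) (hb : b ∈ D.elems) (hb0 : b ≠ 0) (e : a = h * h' * b)
    (hp : ∃ p ∈ D₁.H, π a = p * π b) : ∃ t ∈ D.H, a = t * b := by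
  obtain ⟨p, hp, ep⟩ := hp
  refine ⟨h * h', L.mul_mem h hh h' hh' ?_, e⟩
  rw [e, map_mul, mul_comm, mul_comm p] at ep
  rwa [cancel (L.map_mem hb) (L.map_ne_zero hb hb0) ep]

theorem IsLiftSystem.neg_cross (L : IsLiftSystem D D₁ π) {h a b : R} (hh : h ∈ D.H)
    (hb : b ∈ D.elems) (hb0 : b ≠ 0) (e : a = -h * b)
    (hp : ∃ p ∈ D₁.H, π a = p * π b) : ∃ t ∈ D.H, a = t * b := by
  obtain ⟨p, hp, ep⟩ := hp
  refine ⟨-h, L.neg_mem h hh ?_, e⟩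
  rw [e, map_mul, mul_comm, mul_comm p] at ep
  rwa [cancel (L.map_mem hb) (L.map_ne_zero hb hb0) ep]

theorem IsLiftSystem.inv_cross (L : IsLiftSystem D D₁ π) {a b : R} (ha : a ≠ 0)
    (h : ∃ t ∈ D.H, a = t * b) : ∃ t ∈ D.H, b = t * a := by
  obtain ⟨t, ht, e⟩ := h
  have ht0 : t ≠ 0 := fun h0 => ha (by rw [e, h0, zero_mul])
  refine ⟨_, L.inverse_mem t ht ht0, ?_⟩
  have := mul_inverse (L.H_subset ht) ht0
  rw [e]
  linear_combination -b * this

variable (D) in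
/-- The cross ratio of rows `i`, `j` and columns `u`, `v` is admissible. -/
def Cross (A : Matrix X Y R) (i j : X) (u v : Y) : Prop :=
  ∃ h ∈ D.H, A i u * A j v = h * (A i v * A j u)

theorem Cross.symm {A : Matrix X Y R} {i j : X} {u v : Y} (h : Cross D A i j u v) :
    Cross D A j i v u := by
  obtain ⟨t, ht, e⟩ := h
  exact ⟨t, ht, by linear_combination e⟩

theorem Good2.cross {A : Matrix X Y R} (h : Good2 D A) {i j : X} {u v : Y} (hiv : A i v ≠ 0)
    (hju : A j u ≠ 0) : Cross D A i j u v := h.2 i j u v hiv hju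

theorem IsLiftSystem.cross_of_mul_eq_zero (L : IsLiftSystem D D₁ π) {A : Matrix X Y R} {i j : X}
    {u v : Y} (h : A i u * A j v = 0) : Cross D A i j u v :=
  ⟨0, L.zero_mem, by rw [h, zero_mul]⟩

theorem IsLiftSystem.cross_swap (L : IsLiftSystem D D₁ π) {A : Matrix X Y R} {i j : X} {u v : Y}
    (hA : ∀ i j, A i j ∈ D.elems) (hiu : A i u ≠ 0) (hjv : A j v ≠ 0) (h : Cross D A i j u v) :
    Cross D A j i u v := by
  obtain ⟨t, ht, e⟩ := L.inv_cross (mul_ne (hA _ _) hiu hjv) h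
  exact ⟨t, ht, by linear_combination e⟩

/-- The cross ratio of rows i, j is the product of those of i, k and of k, j. -/
theorem IsLiftSystem.cross_trans_row (L : IsLiftSystem D D₁ π) {A : Matrix X Y R} {i k j : X}
    {u v : Y} (hA : ∀ i j, A i j ∈ D.elems) (hp : Good2 D₁ (A.map π)) (hku : A k u ≠ 0)
    (hkv : A k v ≠ 0) (hiv : A i v ≠ 0) (hju : A j u ≠ 0) (h₁ : Cross D A i k u v)
    (h₂ : Cross D A k j u v) : Cross D A i j u v := by
  obtain ⟨t, ht, e⟩ := h₁
  obtain ⟨s, hs, e'⟩ := h₂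
  refine L.mul_cross ht hs (mul_mem_elems (hA i v) (hA j u)) (mul_ne (hA _ _) hiv hju) ?_ ?_
  · apply cancel (hA k u) hku
    apply cancel (hA k v) hkv
    linear_combination A k u * A j v * e + t * (A i v * A k u) * e'
  · simpa using hp.2 i j u v (L.map_ne_zero (hA _ _) hiv) (L.map_ne_zero (hA _ _) hju)

theorem IsLiftSystem.cross_trans_col (L : IsLiftSystem D D₁ π) {A : Matrix X Y R} {i j : X}
    {u w v : Y} (hA : ∀ i j, A i j ∈ D.elems) (hp : Good2 D₁ (A.map π)) (hiw : A i w ≠ 0)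
    (hjw : A j w ≠ 0) (hiv : A i v ≠ 0) (hju : A j u ≠ 0) (h₁ : Cross D A i j u w)
    (h₂ : Cross D A i j w v) : Cross D A i j u v := by
  obtain ⟨t, ht, e⟩ := h₁
  obtain ⟨s, hs, e'⟩ := h₂
  refine L.mul_cross ht hs (mul_mem_elems (hA i v) (hA j u)) (mul_ne (hA _ _) hiv hju) ?_ ?_
  · apply cancel (hA i w) hiw
    apply cancel (hA j w) hjw
    linear_combination A i w * A j v * e + t * (A i w * A j u) * e'
  · simpa using hp.2 i j u v (L.map_ne_zero (hA _ _) hiv) (L.map_ne_zero (hA _ _) hju)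

/-- If `a e = p b` with an admissible `p`, then `a - b e⁻¹` is zero or in `G`, being a multiple
of `p - 1`. -/
theorem IsLiftSystem.sub_mem_elems (L : IsLiftSystem D D₁ π) {a b p : R} (hb : b ∈ D.elems)
    (hp : p ∈ D.H) (e : a = p * b) : a - b ∈ D.elems := by
  have : a - b = -((1 - p) * b) := by rw [e]; ring
  rw [this]
  exact neg_mem_elems (mul_mem_elems (L.H_subset (L.one_sub_mem p hp)) hb)

variable [DecidableEq X]

/-- Row operations that turn column `l` into the unit vector of row `k`. -/
noncomputable def rowPivot (M : Matrix X Y R) (k : X) (l : Y) : Matrix X Y R := fun i j =>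
  if i = k then Ring.inverse (M k l) * M k j else M i j - M i l * Ring.inverse (M k l) * M k j

theorem rowPivot_row (M : Matrix X Y R) (k : X) (l j : Y) :
    rowPivot M k l k j = Ring.inverse (M k l) * M k j := by simp [rowPivot]

theorem rowPivot_other (M : Matrix X Y R) {k i : X} (hi : i ≠ k) (l j : Y) :
    rowPivot M k l i j = M i j - M i l * Ring.inverse (M k l) * M k j := by simp [rowPivot, hi]

theorem IsLiftSystem.rowPivot_mem (L : IsLiftSystem D D₁ π) {M : Matrix X Y R} (hM : Good2 D M)
    {k : X} {l : Y} (hkl : M k l ≠ 0) (i : X) (j : Y) : rowPivot M k l i j ∈ D.elems := by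
  have hinv := inverse_mem_elems (hM.1 k l)
  have he := mul_inverse (hM.1 k l) hkl
  by_cases hi : i = k
  · subst hi; rw [rowPivot_row]; exact mul_mem_elems hinv (hM.1 _ _)
  rw [rowPivot_other _ hi]
  by_cases hil : M i l = 0
  · simpa [hil] using hM.1 i j
  by_cases hkj : M k j = 0
  · simpa [hkj] using hM.1 i j
  obtain ⟨p, hp, e⟩ := hM.cross (i := i) (j := k) (u := j) (v := l) hil hkj
  refine L.sub_mem_elems (mul_mem_elems (mul_mem_elems (hM.1 _ _) hinv) (hM.1 _ _)) hp ?_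
  linear_combination Ring.inverse (M k l) * e - M i j * he

/-- Cross ratios with the pivot row. -/
theorem IsLiftSystem.rowPivot_cross_row (L : IsLiftSystem D D₁ π) {M : Matrix X Y R}
    (hM : Good2 D M) {k : X} {l : Y} (hkl : M k l ≠ 0) (hp : Good2 D₁ ((rowPivot M k l).map π))
    {i : X} {u v : Y} (hiv : rowPivot M k l i v ≠ 0) (hku : rowPivot M k l k u ≠ 0) :
    Cross D (rowPivot M k l) i k u v := by
  have hmem := L.rowPivot_mem hM hkl
  have hinv := inverse_mem_elems (hM.1 k l)
  have he := mul_inverse (hM.1 k l) hkl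
  by_cases hik : i = k
  · subst hik; exact ⟨1, L.one_mem, by ring⟩
  have hku' : M k u ≠ 0 := fun h => hku (by rw [rowPivot_row, h, mul_zero])
  by_cases hkv : M k v = 0
  · exact L.cross_of_mul_eq_zero (by rw [rowPivot_row, hkv, mul_zero, mul_zero])
  by_cases hil : M i l = 0
  · have e1 : ∀ j, rowPivot M k l i j = M i j := fun j => by rw [rowPivot_other _ hik, hil]; ring
    rw [e1] at hiv
    obtain ⟨t, ht, e⟩ := hM.cross hiv hku'
    refine ⟨t, ht, ?_⟩
    rw [e1, e1, rowPivot_row, rowPivot_row]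
    linear_combination Ring.inverse (M k l) * e
  -- With p and q the cross ratios of the pivot column against u and v, the new entries of row i are
  -- multiples of 1 - p and 1 - q, and the wanted ratio is (1 - p) / (1 - q).
  obtain ⟨p, hp', ep⟩ := hM.cross (i := i) (j := k) (u := u) (v := l) hil hku'
  obtain ⟨q, hq', eq⟩ := hM.cross (i := i) (j := k) (u := v) (v := l) hil hkv
  have eu : rowPivot M k l i u = -((1 - p) * (M i l * M k u * Ring.inverse (M k l))) := by
    rw [rowPivot_other _ hik]
    linear_combination Ring.inverse (M k l) * ep - M i u * he
  have ev : rowPivot M k l i v = -((1 - q) * (M i l * M k v * Ring.inverse (M k l))) := by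
    rw [rowPivot_other _ hik]
    linear_combination Ring.inverse (M k l) * eq - M i v * he
  have hq0 : 1 - q ≠ 0 := fun h => hiv (by rw [ev, h]; ring)
  have hq1 := L.one_sub_mem q hq'
  have e3 := mul_inverse (L.H_subset hq1) hq0
  refine L.mul_cross (L.one_sub_mem p hp') (L.inverse_mem _ hq1 hq0)
    (mul_mem_elems (hmem i v) (hmem k u)) (mul_ne (hmem i v) hiv hku) ?_ ?_
  · rw [eu, ev, rowPivot_row, rowPivot_row]
    linear_combination (1 - p) * (M i l * M k u * Ring.inverse (M k l) ^ 2 * M k v) * e3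
  · simpa using hp.2 i k u v (L.map_ne_zero (hmem _ _) hiv) (L.map_ne_zero (hmem _ _) hku)

/-- If the pivot row is nonzero in both columns, the cross ratio factors through that row. -/
theorem IsLiftSystem.rowPivot_cross_of_ne (L : IsLiftSystem D D₁ π) {M : Matrix X Y R}
    (hM : Good2 D M) {k : X} {l : Y} (hkl : M k l ≠ 0) (hp : Good2 D₁ ((rowPivot M k l).map π))
    {i j : X} {u v : Y} (hiv : rowPivot M k l i v ≠ 0) (hju : rowPivot M k l j u ≠ 0)
    (hku : M k u ≠ 0) (hkv : M k v ≠ 0) : Cross D (rowPivot M k l) i j u v := by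
  have hinv := inverse_mem_elems (hM.1 k l)
  have hinv0 := inverse_ne (hM.1 k l) hkl
  have hku' : rowPivot M k l k u ≠ 0 := by rw [rowPivot_row]; exact mul_ne hinv hinv0 hku
  have hkv' : rowPivot M k l k v ≠ 0 := by rw [rowPivot_row]; exact mul_ne hinv hinv0 hkv
  exact L.cross_trans_row (L.rowPivot_mem hM hkl) hp hku' hkv' hiv hju
    (L.rowPivot_cross_row hM hkl hp hiv hku') (L.rowPivot_cross_row hM hkl hp hju hkv').symm

/-- The hexagon condition for the pivot entry `(k, l)`. -/
def Hexagon (D : CrossSystem R) (M : Matrix X Y R) (k : X) (l : Y) : Prop :=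
  ∀ i j u v, M k u = 0 → M i l = 0 → M j v = 0 → M i u ≠ 0 → M j l ≠ 0 → M k v ≠ 0 →
    M i v ≠ 0 → M j u ≠ 0 → ∃ h ∈ D.H, -(M i u * M j l * M k v) = h * (M i v * M j u * M k l)

/-- The case that needs the hexagon condition. If M j v ≠ 0, the new entry there is (1 - p) times
the old one and the ratio is a product. If M j v = 0, the new entry is pure fill-in, and the ratio
is that of the two nonzero triple products of a 3 × 3 submatrix. -/
theorem IsLiftSystem.rowPivot_cross_zero_nonzero (L : IsLiftSystem D D₁ π) {M : Matrix X Y R}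
    (hM : Good2 D M) {k : X} {l : Y} (hkl : M k l ≠ 0) (hp : Good2 D₁ ((rowPivot M k l).map π))
    (hex : Hexagon D M k l) {i j : X} {u v : Y} (hiv : rowPivot M k l i v ≠ 0)
    (hju : rowPivot M k l j u ≠ 0) (hku : M k u = 0) (hkv : M k v ≠ 0) (hik : i ≠ k) (hjk : j ≠ k)
    (hil : M i l = 0) (hjl : M j l ≠ 0) : Cross D (rowPivot M k l) i j u v := by
  have hmem := L.rowPivot_mem hM hkl
  have he := mul_inverse (hM.1 k l) hkl
  have e1 : ∀ j, rowPivot M k l i j = M i j := fun j => by rw [rowPivot_other _ hik, hil]; ring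
  have e2 : rowPivot M k l j u = M j u := by rw [rowPivot_other _ hjk, hku]; ring
  have hiv' := hiv
  have hju' := hju
  rw [e1] at hiv'
  rw [e2] at hju'
  by_cases hiu : M i u = 0
  · exact L.cross_of_mul_eq_zero (by rw [e1, hiu, zero_mul])
  by_cases hjv : M j v = 0
  · obtain ⟨t, ht, e⟩ := hex i j u v hku hil hjv hiu hjl hkv hiv' hju'
    refine ⟨t, ht, ?_⟩
    rw [e1, e1, e2, rowPivot_other _ hjk, hjv]
    linear_combination Ring.inverse (M k l) * e + t * M i v * M j u * he
  · obtain ⟨p, hp', ep⟩ := hM.cross (i := k) (j := j) (u := v) (v := l) hkl hjv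
    obtain ⟨s, hs', es⟩ := hM.cross (i := i) (j := j) (u := u) (v := v) hiv' hju'
    refine L.mul_cross hs' (L.one_sub_mem p hp') (mul_mem_elems (hmem i v) (hmem j u))
      (mul_ne (hmem i v) hiv hju) ?_ ?_
    · rw [e1, e1, e2, rowPivot_other _ hjk]
      linear_combination (1 - p) * es - M i u * Ring.inverse (M k l) * ep -
        M i u * p * M j v * he
    · simpa using hp.2 i j u v (L.map_ne_zero (hmem _ _) hiv) (L.map_ne_zero (hmem _ _) hju)

/-- The column l₀, supported on the pivot row, becomes outside that row a multiple of the old column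
l. It thus preserves the information that the pivot removes from column l. -/
theorem IsLiftSystem.rowPivot_cross_zero_left (L : IsLiftSystem D D₁ π) {M : Matrix X Y R}
    (hM : Good2 D M) {k : X} {l : Y} (hkl : M k l ≠ 0) (hp : Good2 D₁ ((rowPivot M k l).map π))
    (hex : Hexagon D M k l) {l₀ : Y} (hl₀ : M k l₀ ≠ 0) (hl₀' : ∀ i ≠ k, M i l₀ = 0)
    {i j : X} {u v : Y} (hiv : rowPivot M k l i v ≠ 0)
    (hju : rowPivot M k l j u ≠ 0) (hku : M k u = 0) (hkv : M k v ≠ 0) (hik : i ≠ k)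
    (hjk : j ≠ k) : Cross D (rowPivot M k l) i j u v := by
  have hmem := L.rowPivot_mem hM hkl
  have he := mul_inverse (hM.1 k l) hkl
  have hinv := inverse_mem_elems (hM.1 k l)
  have hinv0 := inverse_ne (hM.1 k l) hkl
  have e2 : ∀ j ≠ k, rowPivot M k l j u = M j u := fun j hj => by
    rw [rowPivot_other _ hj, hku]; ring
  by_cases hil : M i l = 0
  · by_cases hjl : M j l = 0
    · have e1 : ∀ w, rowPivot M k l i w = M i w := fun w => by
        rw [rowPivot_other _ hik, hil]; ring
      have e3 : ∀ w, rowPivot M k l j w = M j w := fun w => by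
        rw [rowPivot_other _ hjk, hjl]; ring
      rw [e1] at hiv
      rw [e3] at hju
      obtain ⟨t, ht, e⟩ := hM.cross hiv hju
      exact ⟨t, ht, by rw [e1, e1, e3, e3, e]⟩
    · exact L.rowPivot_cross_zero_nonzero hM hkl hp hex hiv hju hku hkv hik hjk hil hjl
  · by_cases hjl : M j l = 0
    · by_cases hiu : M i u = 0
      · exact L.cross_of_mul_eq_zero (by rw [e2 i hik, hiu, zero_mul])
      by_cases hjv : M j v = 0
      · exact L.cross_of_mul_eq_zero (by rw [rowPivot_other _ hjk, hjl, hjv]; ring)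
      have hiu' : rowPivot M k l i u ≠ 0 := by rwa [e2 i hik]
      have hjv' : rowPivot M k l j v ≠ 0 := by
        rw [rowPivot_other _ hjk, hjl]
        simpa using hjv
      exact L.cross_swap hmem hju hiv
        (L.rowPivot_cross_zero_nonzero hM hkl hp hex hjv' hiu' hku hkv hjk hik hjl hil)
    · have hc : ∀ i ≠ k, rowPivot M k l i l₀ = -(M i l * (Ring.inverse (M k l) * M k l₀)) :=
        fun i hi => by rw [rowPivot_other _ hi, hl₀' i hi]; ring
      have hc0 : ∀ i ≠ k, M i l ≠ 0 → rowPivot M k l i l₀ ≠ 0 := fun i hi h => by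
        rw [hc i hi, neg_ne_zero]
        exact mul_ne (hM.1 _ _) h (mul_ne hinv hinv0 hl₀)
      -- The ratio of u, v is factored through l₀: that of u, l₀ is an old ratio of u, l, and that
      -- of l₀, v has both columns nonzero in the pivot row.
      refine L.cross_trans_col hmem hp (hc0 i hik hil) (hc0 j hjk hjl) hiv hju ?_
        (L.rowPivot_cross_of_ne hM hkl hp hiv (hc0 j hjk hjl) hl₀ hkv)
      rw [e2 j hjk] at hju
      obtain ⟨t, ht, e⟩ := hM.cross (i := i) (j := j) (u := u) (v := l) hil hju
      refine ⟨t, ht, ?_⟩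
      rw [hc i hik, hc j hjk, e2 i hik, e2 j hjk]
      linear_combination -(Ring.inverse (M k l) * M k l₀) * e

/-- Pivoting preserves `Good2` if the hexagon condition holds. -/
theorem IsLiftSystem.good2_rowPivot (L : IsLiftSystem D D₁ π) {M : Matrix X Y R}
    (hM : Good2 D M) {k : X} {l : Y} (hkl : M k l ≠ 0) (hp : Good2 D₁ ((rowPivot M k l).map π))
    (hex : Hexagon D M k l) {l₀ : Y} (hl₀ : M k l₀ ≠ 0) (hl₀' : ∀ i ≠ k, M i l₀ = 0) :
    Good2 D (rowPivot M k l) := by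
  refine ⟨L.rowPivot_mem hM hkl, fun i j u v hiv hju => ?_⟩
  change Cross D _ i j u v
  by_cases hik : i = k
  · subst hik; exact (L.rowPivot_cross_row hM hkl hp hju hiv).symm
  by_cases hjk : j = k
  · subst hjk; exact L.rowPivot_cross_row hM hkl hp hiv hju
  by_cases hku : M k u = 0
  · by_cases hkv : M k v = 0
    · have e1 : ∀ i ≠ k, rowPivot M k l i u = M i u := fun i hi => by
        rw [rowPivot_other _ hi, hku]; ring
      have e2 : ∀ i ≠ k, rowPivot M k l i v = M i v := fun i hi => by
        rw [rowPivot_other _ hi, hkv]; ring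
      rw [e2 i hik] at hiv
      rw [e1 j hjk] at hju
      obtain ⟨t, ht, e⟩ := hM.cross hiv hju
      exact ⟨t, ht, by rw [e1 i hik, e2 i hik, e1 j hjk, e2 j hjk, e]⟩
    · exact L.rowPivot_cross_zero_left hM hkl hp hex hl₀ hl₀' hiv hju hku hkv hik hjk
  · by_cases hkv : M k v = 0
    · exact (L.rowPivot_cross_zero_left hM hkl hp hex hl₀ hl₀' hju hiv hkv hku hjk hik).symm
    · exact L.rowPivot_cross_of_ne hM hkl hp hiv hju hku hkv

/-- The hexagon condition follows if pivoting on one of the other entries `(i, u)` or `(i, v)` is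
possible. -/
theorem hexagon_of_good2_rowPivot {M : Matrix X Y R} (hM : Good2 D M) {k : X} {l : Y}
    (hkl : M k l ≠ 0) {W : Set Y}
    (hW : ∀ u v, u ≠ v → u ≠ l → v ≠ l → u ∈ W ∨ v ∈ W)
    (h : ∀ i, ∀ w ∈ W, M i w ≠ 0 → Good2 D (rowPivot M i w)) : Hexagon D M k l := by
  intro i j u v hku hil hjv hiu hjl hkv hiv hju
  have huv : u ≠ v := by rintro rfl; exact hkv hku
  have hul : u ≠ l := by rintro rfl; exact hkl hku
  have hvl : v ≠ l := by rintro rfl; exact hjl hjv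
  have hik : i ≠ k := by rintro rfl; exact hkl hil
  have hij : i ≠ j := by rintro rfl; exact hiv hjv
  -- The nonzero entries of the 3 × 3 pattern form a six-cycle. A pivot on (i, u) fills (j, v), one
  -- on (i, v) fills (k, u), and in either case the hexagon ratio becomes an ordinary cross ratio.
  rcases hW u v huv hul hvl with hu | hv
  · have hg := h i u hu hiu
    have he := mul_inverse (hM.1 i u) hiu
    have hinv := inverse_mem_elems (hM.1 i u)
    have hinv0 := inverse_ne (hM.1 i u) hiu
    have ek : ∀ w, rowPivot M i u k w = M k w := fun w => by
      rw [rowPivot_other _ hik.symm, hku]; ring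
    have ejl : rowPivot M i u j l = M j l := by rw [rowPivot_other _ hij.symm, hil]; ring
    have ejv : rowPivot M i u j v = -(M j u * Ring.inverse (M i u) * M i v) := by
      rw [rowPivot_other _ hij.symm, hjv]; ring
    obtain ⟨t, ht, e⟩ := hg.cross (i := j) (j := k) (u := l) (v := v)
      (by rw [ejv, neg_ne_zero]; exact mul_ne (mul_mem_elems (hM.1 _ _) hinv)
            (mul_ne (hM.1 _ _) hju hinv0) hiv) (by rwa [ek])
    rw [ek, ek, ejl, ejv] at e
    exact ⟨t, ht, by linear_combination -M i u * e + t * M j u * M i v * M k l * he⟩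
  · have hg := h i v hv hiv
    have he := mul_inverse (hM.1 i v) hiv
    have ej : ∀ w, rowPivot M i v j w = M j w := fun w => by
      rw [rowPivot_other _ hij.symm, hjv]; ring
    have ekl : rowPivot M i v k l = M k l := by rw [rowPivot_other _ hik.symm, hil]; ring
    have eku : rowPivot M i v k u = -(M k v * Ring.inverse (M i v) * M i u) := by
      rw [rowPivot_other _ hik.symm, hku]; ring
    obtain ⟨t, ht, e⟩ := hg.cross (i := k) (j := j) (u := u) (v := l)
      (by rwa [ekl]) (by rwa [ej])
    rw [ej, ej, ekl, eku] at e
    exact ⟨t, ht, by linear_combination M i v * e + M k v * M i u * M j l * he⟩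

end

end MatrixLift

/-! ### Normal forms at a basis, and pivots as basis exchanges. -/

namespace MatrixLift

open Matrix

section Form

variable {R : Type*} {X E : Type*}

theorem submatrix_update [DecidableEq X] (N : Matrix X E R) (c : X → E) (i : X) (e : E) :
    N.submatrix id (Function.update c i e) = (N.submatrix id c).updateCol i (fun k => N k e) := by
  ext a b
  by_cases hb : b = i
  · subst hb; simp
  · simp [hb]

variable [CommRing R] [Fintype X]

theorem mul_submatrix_id {E' : Type*} (U : Matrix X X R) (N : Matrix X E R) (c : E' → E) :
    (U * N).submatrix id c = U * N.submatrix id c := by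
  ext i j
  simp [mul_apply]

variable [DecidableEq X]

/-- The matrix obtained from `N` by the row operations that turn the columns `c` into the identity
matrix. -/
noncomputable def formAt (N : Matrix X E R) (c : X → E) : Matrix X E R :=
  (N.submatrix id c)⁻¹ * N

theorem formAt_submatrix {E' : Type*} (N : Matrix X E R) (σ : E' → E) (c : X → E') :
    formAt (N.submatrix id σ) c = (formAt N (σ ∘ c)).submatrix id σ := by
  unfold formAt
  rw [mul_submatrix_id, submatrix_submatrix]
  rfl

theorem formAt_mul {U : Matrix X X R} (hU : IsUnit U.det) (N : Matrix X E R) (c : X → E) :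
    formAt (U * N) c = formAt N c := by
  unfold formAt
  rw [mul_submatrix_id, Matrix.mul_inv_rev, Matrix.mul_assoc, nonsing_inv_mul_cancel_left _ _ hU]

theorem formAt_eq_self {N : Matrix X E R} {c : X → E} (h : N.submatrix id c = 1) :
    formAt N c = N := by
  unfold formAt
  rw [h, inv_one, Matrix.one_mul]

theorem formAt_submatrix_self {N : Matrix X E R} {c : X → E}
    (h : IsUnit (N.submatrix id c).det) : (formAt N c).submatrix id c = 1 := by
  unfold formAt
  rw [mul_submatrix_id, nonsing_inv_mul _ h]

theorem mul_formAt {N : Matrix X E R} {c : X → E} (h : IsUnit (N.submatrix id c).det) :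
    N.submatrix id c * formAt N c = N := by
  unfold formAt
  rw [mul_nonsing_inv_cancel_left _ _ h]

theorem formAt_formAt {N : Matrix X E R} {c : X → E} (h : IsUnit (N.submatrix id c).det)
    (c' : X → E) : formAt (formAt N c) c' = formAt N c' :=
  formAt_mul (by rw [det_nonsing_inv]; exact h.ringInverse) N c'

/-- Cramer's rule: entries of the normal form are quotients of maximal minors that differ in one
column. -/
theorem det_submatrix_update {N : Matrix X E R} {c : X → E}
    (h : IsUnit (N.submatrix id c).det) (i : X) (e : E) :
    (N.submatrix id (Function.update c i e)).det =
      (N.submatrix id c).det * formAt N c i e := by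
  conv_lhs => rw [← mul_formAt h, mul_submatrix_id, det_mul, submatrix_update,
    formAt_submatrix_self h, ← cramer_apply, cramer_one]
  rfl

/-- The matrix of the row operations of `rowPivot`. -/
theorem exists_rowPivot_eq_mul (M : Matrix X E R) (k : X) (l : E) :
    ∃ U : Matrix X X R, U.det = Ring.inverse (M k l) ∧ rowPivot M k l = U * M := by
  -- The identity with column k replaced; by Cramer's rule its determinant is the new diagonal
  -- entry.
  refine ⟨(1 : Matrix X X R).updateCol k
    (fun i => if i = k then Ring.inverse (M k l) else -(M i l * Ring.inverse (M k l))), ?_, ?_⟩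
  · rw [← cramer_apply, cramer_one]
    simp
  · ext i j
    rw [mul_apply, ← Finset.add_sum_erase _ _ (Finset.mem_univ k)]
    by_cases hi : i = k
    · subst hi
      rw [rowPivot_row, Finset.sum_eq_zero, updateCol_self]
      · simp
      · intro a ha
        have := Finset.ne_of_mem_erase ha
        rw [updateCol_ne this, one_apply_ne this.symm, zero_mul]
    · rw [rowPivot_other _ hi, Finset.sum_eq_single i]
      · rw [updateCol_self, updateCol_ne hi, one_apply_eq, if_neg hi]
        ring
      · intro a ha hai
        rw [updateCol_ne (Finset.ne_of_mem_erase ha), one_apply_ne hai.symm, zero_mul]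
      · intro h
        exact absurd (Finset.mem_erase.2 ⟨hi, Finset.mem_univ _⟩) h

/-- Normal forms are unchanged by invertible row operations, so it suffices that the row pivot turns
the new selected columns into the identity. -/
theorem formAt_update {N : Matrix X E R} {c : X → E} (h : IsUnit (N.submatrix id c).det)
    {i : X} {e : E} (hu : formAt N c i e * Ring.inverse (formAt N c i e) = 1) :
    formAt N (Function.update c i e) = rowPivot (formAt N c) i e := by
  obtain ⟨U, hU, hUM⟩ := exists_rowPivot_eq_mul (formAt N c) i e
  have hU' : IsUnit U.det := by
    rw [hU]
    exact IsUnit.of_mul_eq_one _ (by rw [mul_comm]; exact hu)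
  rw [← formAt_formAt h, ← formAt_mul hU', ← hUM]
  apply formAt_eq_self
  have h1 := formAt_submatrix_self h
  have h1' : ∀ a b, formAt N c a (c b) = (1 : Matrix X X R) a b := fun a b => by rw [← h1]; rfl
  ext a b
  rw [submatrix_apply, id]
  by_cases hb : b = i
  · subst hb
    rw [Function.update_self]
    by_cases ha : a = b
    · subst ha; rw [rowPivot_row, one_apply_eq, mul_comm]; exact hu
    · rw [rowPivot_other _ ha, one_apply_ne ha]
      linear_combination -formAt N c a e * hu
  · rw [Function.update_of_ne hb]
    by_cases ha : a = i
    · subst ha; rw [rowPivot_row, h1', one_apply_ne (Ne.symm hb), mul_zero]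
    · rw [rowPivot_other _ ha, h1', h1', one_apply_ne (Ne.symm hb)]
      ring

theorem formAt_map {R₁ : Type*} [CommRing R₁] (π : R →+* R₁) {N : Matrix X E R} {c : X → E}
    (h : IsUnit (N.submatrix id c).det) : (formAt N c).map π = formAt (N.map π) c := by
  have h1 : (N.map π).submatrix id c * (formAt N c).map π = N.map π := by
    conv_rhs => rw [← mul_formAt h]
    rw [Matrix.map_mul]
    rfl
  have h2 : IsUnit ((N.map π).submatrix id c).det := by
    have : (N.map π).submatrix id c = (N.submatrix id c).map π := rfl
    rw [this]
    have := h.map π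
    rwa [RingHom.map_det] at this
  conv_rhs => unfold formAt
  conv_rhs => enter [2]; rw [← h1]
  rw [nonsing_inv_mul_cancel_left _ _ h2]

end Form

section Pivot

variable {R : Type*} [CommRing R] {X Y : Type*} [DecidableEq X] {D : CrossSystem R}

theorem good2_fromCols (h0 : (0 : R) ∈ D.H) (h1 : (1 : R) ∈ D.H) {A : Matrix X Y R}
    (hA : Good2 D A) : Good2 D (fromCols (1 : Matrix X X R) A) := by
  refine ⟨?_, ?_⟩
  · rintro i (a | j)
    · by_cases h : i = a
      · subst h; simpa using one_mem_elems
      · simpa [one_apply_ne h] using zero_mem_elems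
    · exact hA.1 i j
  · intro i j u v hiv hju
    by_cases hij : i = j
    · subst hij; exact ⟨1, h1, by ring⟩
    rcases u with a | u
    · have : j = a := by by_contra h; exact hju (by simp [one_apply_ne h])
      subst this
      exact ⟨0, h0, by simp [one_apply_ne hij]⟩
    rcases v with b | v
    · have : i = b := by by_contra h; exact hiv (by simp [one_apply_ne h])
      subst this
      exact ⟨0, h0, by simp [one_apply_ne (Ne.symm hij)]⟩
    · exact hA.2 i j u v hiv hju

theorem rowPivot_fromCols [DecidableEq Y] (A : Matrix X Y R) {k : X} {l : Y}
    (h : A k l * Ring.inverse (A k l) = 1) :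
    rowPivot (fromCols (1 : Matrix X X R) A) k (Sum.inr l) =
      (fromCols (1 : Matrix X X R) (pivot A k l)).submatrix id
        (Equiv.swap (Sum.inl k) (Sum.inr l)) := by
  ext i e
  rw [submatrix_apply, id]
  rcases e with a | j
  · by_cases ha : a = k
    · subst ha
      rw [Equiv.swap_apply_left]
      by_cases hi : i = a
      · subst hi; simp [rowPivot_row, pivot_same]
      · simp [rowPivot_other _ hi, pivot_col _ _ hi, one_apply_ne hi]
    · rw [Equiv.swap_apply_of_ne_of_ne (by simpa using ha) (by simp)]
      by_cases hi : i = k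
      · subst hi; simp [rowPivot_row, one_apply_ne (Ne.symm ha)]
      · simp [rowPivot_other _ hi, one_apply_ne (Ne.symm ha)]
  · by_cases hj : j = l
    · subst hj
      rw [Equiv.swap_apply_right]
      by_cases hi : i = k
      · subst hi; simp [rowPivot_row, mul_comm, h]
      · simp only [rowPivot_other _ hi, fromCols_apply_inr, fromCols_apply_inl, one_apply_ne hi]
        linear_combination -A i j * h
    · rw [Equiv.swap_apply_of_ne_of_ne (by simp) (by simpa using hj)]
      by_cases hi : i = k
      · subst hi; simp [rowPivot_row, pivot_row _ _ hj]
      · simp [rowPivot_other _ hi, pivot_other _ hi hj]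

variable [Fintype X]

/-- The determinant of the columns `c` is in `G`, and the matrix normalised at `c` satisfies
`Good2`. -/
def GoodAt (D : CrossSystem R) {E : Type*} (N : Matrix X E R) (c : X → E) : Prop :=
  (∃ g ∈ D.G, (g : R) = (N.submatrix id c).det) ∧ Good2 D (formAt N c)

theorem goodAt_inl (h0 : (0 : R) ∈ D.H) (h1 : (1 : R) ∈ D.H) {A : Matrix X Y R}
    (hA : Good2 D A) (e : Equiv.Perm X) :
    GoodAt D (fromCols (1 : Matrix X X R) A) (fun i => Sum.inl (e i)) := by
  have hU : ((1 : Matrix X X R).submatrix id e).det = ((Equiv.Perm.sign e : ℤ) : R) := by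
    rw [det_permute', det_one, mul_one]
  constructor
  · have : (fromCols (1 : Matrix X X R) A).submatrix id (fun i => Sum.inl (e i)) =
        (1 : Matrix X X R).submatrix id e := rfl
    rw [this, hU]
    rcases Int.units_eq_one_or (Equiv.Perm.sign e) with h | h
    · exact ⟨1, D.G.one_mem, by simp [h]⟩
    · exact ⟨-1, D.neg_one_mem, by simp [h]⟩
  · have hN : fromCols (1 : Matrix X X R) A = (1 : Matrix X X R).submatrix id e *
        (fromCols (1 : Matrix X X R) A).submatrix e id := by
      ext i j
      rw [mul_apply, Finset.sum_eq_single (e.symm i)]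
      · change fromCols (1 : Matrix X X R) A i j = (1 : Matrix X X R) i (e (e.symm i)) *
          fromCols (1 : Matrix X X R) A (e (e.symm i)) j
        rw [Equiv.apply_symm_apply, one_apply_eq, one_mul]
      · intro b _ hb
        have : i ≠ e b := fun h => hb (by rw [h]; simp)
        change (1 : Matrix X X R) i (e b) * _ = 0
        rw [one_apply_ne this, zero_mul]
      · simp
    have hunit : IsUnit ((1 : Matrix X X R).submatrix id e).det := by
      rw [hU]
      rcases Int.units_eq_one_or (Equiv.Perm.sign e) with h | h <;> simp [h]
    rw [hN, formAt_mul hunit, formAt_eq_self]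
    · exact (good2_fromCols h0 h1 hA).submatrix _ _
    · ext i j
      simp [one_apply]

variable [DecidableEq Y]

/-- By `rowPivot_fromCols`, [I | A] and [I | pivot A] differ by a swap of two columns and a row
operation whose determinant, the inverse of the pivot entry, lies in G. -/
theorem goodAt_pivot {A : Matrix X Y R} {k : X} {l : Y} (hkl : A k l ∈ D.elems)
    (hkl0 : A k l ≠ 0) {c : X → X ⊕ Y} :
    GoodAt D (fromCols (1 : Matrix X X R) A) c ↔
      GoodAt D (fromCols (1 : Matrix X X R) (pivot A k l))
        (Equiv.swap (Sum.inl k) (Sum.inr l) ∘ c) := by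
  obtain ⟨U, hU, hUM⟩ := exists_rowPivot_eq_mul (fromCols (1 : Matrix X X R) A) k (Sum.inr l)
  have h := mul_inverse hkl hkl0
  rw [rowPivot_fromCols A h] at hUM
  rw [fromCols_apply_inr] at hU
  have hU' : IsUnit U.det := by
    rw [hU]
    exact IsUnit.of_mul_eq_one _ (by rw [mul_comm]; exact h)
  have e1 : ((fromCols (1 : Matrix X X R) (pivot A k l)).submatrix id
      (Equiv.swap (Sum.inl k) (Sum.inr l) ∘ c)).det =
      Ring.inverse (A k l) * ((fromCols (1 : Matrix X X R) A).submatrix id c).det := by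
    rw [← hU, ← det_mul, ← mul_submatrix_id, ← hUM]
    rfl
  have e2 : formAt (fromCols (1 : Matrix X X R) A) c =
      (formAt (fromCols (1 : Matrix X X R) (pivot A k l))
        (Equiv.swap (Sum.inl k) (Sum.inr l) ∘ c)).submatrix id
          (Equiv.swap (Sum.inl k) (Sum.inr l)) := by
    rw [← formAt_mul hU', ← hUM, formAt_submatrix]
  obtain ⟨a, ha, ea⟩ := exists_unit hkl hkl0
  rw [← ea, Ring.inverse_unit] at e1
  constructor
  · rintro ⟨⟨g, hg, eg⟩, h2⟩
    refine ⟨⟨a⁻¹ * g, D.G.mul_mem (D.G.inv_mem ha) hg, by rw [e1, ← eg, Units.val_mul]⟩, ?_⟩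
    rw [e2] at h2
    have := h2.submatrix id (Equiv.swap (Sum.inl k) (Sum.inr l))
    rw [submatrix_submatrix] at this
    convert this using 1
    ext i j
    simp
  · rintro ⟨⟨g, hg, eg⟩, h2⟩
    refine ⟨⟨a * g, D.G.mul_mem ha hg, by rw [Units.val_mul, eg, e1]; simp⟩, ?_⟩
    rw [e2]
    exact h2.submatrix _ _

/-- Every nonzero maximal minor of `[I | A]` can be reached by pivoting. -/
theorem goodAt_of_closed (h0 : (0 : R) ∈ D.H) (h1 : (1 : R) ∈ D.H) {S : Set (Matrix X Y R)}
    {W : Set Y} (h2 : ∀ B ∈ S, Good2 D B)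
    (hp : ∀ B ∈ S, ∀ k, ∀ l ∈ W, B k l ≠ 0 → pivot B k l ∈ S) {A : Matrix X Y R} (hA : A ∈ S)
    {c : X → X ⊕ Y} (hc : ∀ i l, c i = Sum.inr l → l ∈ W)
    (hdet : ((fromCols (1 : Matrix X X R) A).submatrix id c).det ≠ 0) :
    GoodAt D (fromCols (1 : Matrix X X R) A) c := by
  induction hn : (Finset.univ.filter fun i => (c i).isRight).card using Nat.strong_induction_on
    generalizing A c with
  | _ n ih =>
  by_cases hr : ∃ i l, c i = Sum.inr l
  · obtain ⟨i₀, l, hl⟩ := hr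
    -- A nonzero determinant has a nonzero term. It supplies the pivot entry (σ i₀, l), and it
    -- ensures that the unit column σ i₀ is not selected, so that the swap reduces the number of
    -- selected columns in Y.
    have : ∃ σ : Equiv.Perm X, ∀ i, fromCols (1 : Matrix X X R) A (σ i) (c i) ≠ 0 := by
      by_contra hno
      push Not at hno
      apply hdet
      rw [det_apply]
      refine Finset.sum_eq_zero fun σ _ => ?_
      obtain ⟨i, hi⟩ := hno σ
      rw [Finset.prod_eq_zero (Finset.mem_univ i) hi, smul_zero]
    obtain ⟨σ, hσ⟩ := this
    have hkl : A (σ i₀) l ≠ 0 := by simpa [hl] using hσ i₀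
    have hk : ∀ i, c i ≠ Sum.inl (σ i₀) := by
      intro i hi
      have h3 := hσ i
      rw [hi, fromCols_apply_inl] at h3
      have h4 : σ i = σ i₀ := by
        by_contra h
        exact h3 (one_apply_ne h)
      rw [σ.injective h4, hl] at hi
      cases hi
    have hmem := (h2 A hA).1 (σ i₀) l
    rw [goodAt_pivot hmem hkl]
    have hsw : ∀ i l', (Equiv.swap (Sum.inl (σ i₀)) (Sum.inr l) ∘ c) i = Sum.inr l' →
        c i = Sum.inr l' ∧ c i ≠ Sum.inr l := by
      intro i l' h
      have h' : Equiv.swap (Sum.inl (σ i₀)) (Sum.inr l) (c i) = Sum.inr l' := h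
      by_cases hi : c i = Sum.inr l
      · rw [hi, Equiv.swap_apply_right] at h'
        cases h'
      · rw [Equiv.swap_apply_of_ne_of_ne (hk i) hi] at h'
        exact ⟨h', hi⟩
    refine ih _ ?_ (hp A hA _ _ (hc i₀ l hl) hkl) (fun i l' h => hc i l' (hsw i l' h).1) ?_ rfl
    · rw [← hn]
      apply Finset.card_lt_card
      refine ⟨fun i hi => ?_, fun hsub => ?_⟩
      · simp only [Finset.mem_filter, Finset.mem_univ, true_and] at hi ⊢
        obtain ⟨l', hl'⟩ := Sum.isRight_iff.1 hi
        rw [(hsw i l' hl').1]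
        rfl
      · have := hsub (x := i₀) (by simp [hl])
        simp [hl] at this
    · intro hz
      apply hdet
      obtain ⟨U, hU, hUM⟩ := exists_rowPivot_eq_mul (fromCols (1 : Matrix X X R) A) (σ i₀)
        (Sum.inr l)
      rw [rowPivot_fromCols A (mul_inverse hmem hkl)] at hUM
      rw [fromCols_apply_inr] at hU
      have e1 : ((fromCols (1 : Matrix X X R) (pivot A (σ i₀) l)).submatrix id
          (Equiv.swap (Sum.inl (σ i₀)) (Sum.inr l) ∘ c)).det =
          Ring.inverse (A (σ i₀) l) * ((fromCols (1 : Matrix X X R) A).submatrix id c).det := by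
        rw [← hU, ← det_mul, ← mul_submatrix_id, ← hUM]
        rfl
      rw [hz] at e1
      exact cancel (inverse_mem_elems hmem) (inverse_ne hmem hkl) (by rw [← e1, mul_zero])
  · push Not at hr
    have hex : ∀ i, ∃ a, c i = Sum.inl a := fun i => by
      rcases h : c i with a | l
      · exact ⟨a, rfl⟩
      · exact absurd h (hr i l)
    choose τ hτ using hex
    have hinj : Function.Injective τ := by
      intro i j hij
      by_contra hne
      apply hdet
      exact det_zero_of_column_eq hne fun k => by simp [hτ, hij]
    have := goodAt_inl (D := D) h0 h1 (h2 A hA)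
      (Equiv.ofBijective τ (Finite.injective_iff_bijective.1 hinj))
    have hc' : c = fun i => Sum.inl (Equiv.ofBijective τ (Finite.injective_iff_bijective.1 hinj) i) :=
      funext hτ
    rw [hc']
    exact this

theorem Good.goodAt (h0 : (0 : R) ∈ D.H) (h1 : (1 : R) ∈ D.H) {A : Matrix X Y R} (hA : Good D A)
    {c : X → X ⊕ Y} (hdet : ((fromCols (1 : Matrix X X R) A).submatrix id c).det ≠ 0) :
    GoodAt D (fromCols (1 : Matrix X X R) A) c := by
  obtain ⟨S, hS, h2, hp⟩ := hA
  exact goodAt_of_closed h0 h1 (W := Set.univ) h2 (fun B hB k l _ => hp B hB k l) hS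
    (fun _ _ _ => Set.mem_univ _) hdet

/-- The converse of `Good.goodAt`: goodness can be tested basis by basis, with no reference to
sequences of pivots. -/
theorem good_of_goodAt [Nontrivial R] {A : Matrix X Y R}
    (h : ∀ c, ((fromCols (1 : Matrix X X R) A).submatrix id c).det ≠ 0 →
      GoodAt D (fromCols (1 : Matrix X X R) A) c) : Good D A := by
  have key : ∀ B : Matrix X Y R, (∀ c, ((fromCols (1 : Matrix X X R) B).submatrix id c).det ≠ 0 →
      GoodAt D (fromCols (1 : Matrix X X R) B) c) → Good2 D B := by
    intro B hB
    have h1 : (fromCols (1 : Matrix X X R) B).submatrix id Sum.inl = 1 := rfl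
    have h2 := (hB Sum.inl (by rw [h1, det_one]; exact one_ne_zero)).2
    rw [formAt_eq_self h1] at h2
    exact h2.submatrix id Sum.inr
  refine ⟨{B | ∀ c, ((fromCols (1 : Matrix X X R) B).submatrix id c).det ≠ 0 →
    GoodAt D (fromCols (1 : Matrix X X R) B) c}, h, key, fun B hB k l hkl c hc => ?_⟩
  have hmem := (key B hB).1 k l
  have hc2 : c = Equiv.swap (Sum.inl k) (Sum.inr l) ∘ (Equiv.swap (Sum.inl k) (Sum.inr l) ∘ c) := by
    ext i; simp
  rw [hc2, ← goodAt_pivot hmem hkl]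
  apply hB
  intro hz
  apply hc
  obtain ⟨U, hU, hUM⟩ := exists_rowPivot_eq_mul (fromCols (1 : Matrix X X R) B) k (Sum.inr l)
  rw [rowPivot_fromCols B (mul_inverse hmem hkl)] at hUM
  have e1 : ((fromCols (1 : Matrix X X R) (pivot B k l)).submatrix id c).det =
      U.det * ((fromCols (1 : Matrix X X R) B).submatrix id
        (Equiv.swap (Sum.inl k) (Sum.inr l) ∘ c)).det := by
    rw [← det_mul, ← mul_submatrix_id, ← hUM, submatrix_submatrix, Function.id_comp, ← hc2]
  rw [e1, hz, mul_zero]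

end Pivot

end MatrixLift

/-! ### Goodness from two column deletions. -/

namespace MatrixLift

open Matrix

section

variable {R R₁ : Type*} [CommRing R] [CommRing R₁] {X Y : Type*} [DecidableEq X]
  {D : CrossSystem R} {D₁ : CrossSystem R₁} {π : R →+* R₁}

theorem IsLiftSystem.nontrivial_ring (L : IsLiftSystem D D₁ π) : Nontrivial R :=
  ⟨1, 0, fun h => L.nontrivial (by rw [← map_one π, h, map_zero])⟩

theorem IsLiftSystem.zero_mem₁ (L : IsLiftSystem D D₁ π) : (0 : R₁) ∈ D₁.H := by
  simpa using L.map_H 0 L.zero_mem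

theorem IsLiftSystem.one_mem₁ (L : IsLiftSystem D D₁ π) : (1 : R₁) ∈ D₁.H := by
  simpa using L.map_H 1 L.one_mem

/-- The determinant is linear in column i, and that column is a combination of unit vectors. -/
theorem exists_update_inl_det_ne_zero [Fintype X] (N : Matrix X Y R) {c : X → X ⊕ Y}
    (h : ((fromCols (1 : Matrix X X R) N).submatrix id c).det ≠ 0) (i : X) :
    ∃ k, ((fromCols (1 : Matrix X X R) N).submatrix id
      (Function.update c i (Sum.inl k))).det ≠ 0 := by
  by_contra hno
  push Not at hno
  apply h
  set Z := (fromCols (1 : Matrix X X R) N).submatrix id c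
  have h1 : ∀ k, cramer Z (Pi.single k 1) i = 0 := fun k => by
    rw [cramer_apply, ← hno k, submatrix_update]
    congr 2
    ext a
    simp [one_apply, Pi.single_apply]
  have h2 : Z.det = cramer Z (fun k => Z k i) i := by rw [cramer_apply, updateCol_eq_self]
  rw [h2, pi_eq_sum_univ (fun k => Z k i)]
  rw [map_sum, Finset.sum_apply]
  refine Finset.sum_eq_zero fun k _ => ?_
  rw [map_smul, Pi.smul_apply]
  have h3 : (fun j => if k = j then (1 : R) else 0) = Pi.single k 1 := by
    ext j; simp [Pi.single_apply, eq_comm]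
  rw [h3, h1, smul_zero]

variable [DecidableEq Y]

theorem IsLiftSystem.map_pivot (L : IsLiftSystem D D₁ π) {B : Matrix X Y R} {k : X} {l : Y}
    (h : B k l ∈ D.elems) : (pivot B k l).map π = pivot (B.map π) k l := by
  ext i j
  simp only [map_apply, pivot, ← L.map_inverse h]
  split_ifs <;> simp

theorem good2_of_dropCol {A : Matrix X Y R} {x y : Y} (hxy : x ≠ y) (hx : Good2 D (dropCol A x))
    (hy : Good2 D (dropCol A y)) (h : ∀ i j, A i y ≠ 0 → A j x ≠ 0 → Cross D A i j x y) :
    Good2 D A := by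
  refine ⟨fun i j => ?_, fun i j u v hiv hju => ?_⟩
  · by_cases hj : j = x
    · subst hj; rw [← dropCol_of_ne A hxy i]; exact hy.1 _ _
    · rw [← dropCol_of_ne A hj i]; exact hx.1 _ _
  have kx : u ≠ x → v ≠ x → Cross D A i j u v := fun hu hv => by
    have := hx.2 i j u v (by rwa [dropCol_of_ne _ hv]) (by rwa [dropCol_of_ne _ hu])
    simp only [dropCol_of_ne _ hv, dropCol_of_ne _ hu] at this
    exact this
  have ky : u ≠ y → v ≠ y → Cross D A i j u v := fun hu hv => by
    have := hy.2 i j u v (by rwa [dropCol_of_ne _ hv]) (by rwa [dropCol_of_ne _ hu])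
    simp only [dropCol_of_ne _ hv, dropCol_of_ne _ hu] at this
    exact this
  by_cases hu : u = x
  · by_cases hv : v = y
    · subst hu hv; exact h i j hiv hju
    · exact ky (by rw [hu]; exact hxy) hv
  · by_cases hv : v = x
    · by_cases hu' : u = y
      · subst hv hu'; exact (h j i hju hiv).symm
      · exact ky hu' (by rw [hv]; exact hxy)
    · exact kx hu hv

variable [Fintype X]

/-- Exchanges a unit column of a good basis for x. Since two distinct columns other than x always
include one in W, exchanges into W supply the hexagon condition. -/
theorem IsLiftSystem.goodAt_update (L : IsLiftSystem D D₁ π) {A : Matrix X Y R}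
    (hp : Good D₁ (A.map π)) {c : X → X ⊕ Y} {i₀ k₀ : X} {x : Y} {W : Set (X ⊕ Y)}
    (hc : GoodAt D (fromCols (1 : Matrix X X R) A) c) (hk₀ : c i₀ = Sum.inl k₀)
    (hdet : ((fromCols (1 : Matrix X X R) A).submatrix id
      (Function.update c i₀ (Sum.inr x))).det ≠ 0)
    (hW : ∀ u v, u ≠ v → u ≠ Sum.inr x → v ≠ Sum.inr x → u ∈ W ∨ v ∈ W)
    (h : ∀ i, ∀ w ∈ W, ((fromCols (1 : Matrix X X R) A).submatrix id
      (Function.update c i w)).det ≠ 0 →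
        Good2 D (formAt (fromCols (1 : Matrix X X R) A) (Function.update c i w))) :
    GoodAt D (fromCols (1 : Matrix X X R) A) (Function.update c i₀ (Sum.inr x)) := by
  obtain ⟨⟨g, hg, eg⟩, h2⟩ := hc
  set N := fromCols (1 : Matrix X X R) A with hN
  have hu : IsUnit (N.submatrix id c).det := ⟨g, eg⟩
  have hne : ∀ i w, (N.submatrix id (Function.update c i w)).det ≠ 0 ↔ formAt N c i w ≠ 0 := by
    intro i w
    rw [det_submatrix_update hu, ← eg]
    simp
  have hentry := (hne i₀ _).1 hdet
  obtain ⟨a, ha, ea⟩ := exists_unit (h2.1 i₀ (Sum.inr x)) hentry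
  have hdet' : (N.submatrix id (Function.update c i₀ (Sum.inr x))).det = ((g * a : Rˣ) : R) := by
    rw [det_submatrix_update hu, ← eg, ← ea, Units.val_mul]
  refine ⟨⟨g * a, D.G.mul_mem hg ha, hdet'.symm⟩, ?_⟩
  have hsel := formAt_submatrix_self hu
  -- The leaving column is a unit vector of the normal form; it serves as l₀ in `good2_rowPivot`.
  have hsel' : ∀ i, formAt N c i (Sum.inl k₀) = (1 : Matrix X X R) i i₀ := fun i => by
    rw [← hsel, submatrix_apply, hk₀]; rfl
  have hform := formAt_update hu (mul_inverse (h2.1 i₀ (Sum.inr x)) hentry)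
  rw [hform]
  refine L.good2_rowPivot h2 hentry ?_ ?_ (l₀ := Sum.inl k₀) ?_ ?_
  · have hu' : IsUnit (N.submatrix id (Function.update c i₀ (Sum.inr x))).det := ⟨_, hdet'.symm⟩
    have hmap : N.map π = fromCols (1 : Matrix X X R₁) (A.map π) := by
      ext i (j | j)
      · by_cases hij : i = j
        · subst hij; simp [hN]
        · simp [hN, one_apply_ne hij]
      · rfl
    rw [← hform, formAt_map π hu', hmap]
    refine (hp.goodAt L.zero_mem₁ L.one_mem₁ ?_).2
    rw [← hmap]
    have e3 : ((N.map π).submatrix id (Function.update c i₀ (Sum.inr x))).det =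
        π (N.submatrix id (Function.update c i₀ (Sum.inr x))).det := by
      rw [RingHom.map_det]
      rfl
    rw [e3, hdet']
    exact L.map_ne_zero (unit_mem_elems (D.G.mul_mem hg ha))
      (fun h0 => hdet (hdet'.trans h0))
  · refine hexagon_of_good2_rowPivot h2 hentry hW fun i w hw hiw => ?_
    rw [← formAt_update hu (mul_inverse (h2.1 _ _) hiw)]
    exact h i w hw ((hne i w).2 hiw)
  · rw [hsel', one_apply_eq]
    have := L.nontrivial_ring
    exact one_ne_zero
  · intro i hi
    rw [hsel', one_apply_ne hi]

/-- If deleting `x` and deleting `y` gives good matrices, and all cross ratios of the columns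
`x`, `y` are admissible after pivoting in other columns, then the matrix is good. -/
theorem IsLiftSystem.good_of_dropCol (L : IsLiftSystem D D₁ π) {A : Matrix X Y R}
    (hp : Good D₁ (A.map π)) {x y : Y} (hxy : x ≠ y) (hx : Good D (dropCol A x))
    (hy : Good D (dropCol A y)) {S : Set (Matrix X Y R)} (hA : A ∈ S)
    (hS : ∀ B ∈ S, ∀ k l, l ≠ x → l ≠ y → B k l ≠ 0 → pivot B k l ∈ S)
    (h : ∀ B ∈ S, Good D₁ (B.map π) → Good D (dropCol B x) → Good D (dropCol B y) →
      ∀ i j, B i y ≠ 0 → B j x ≠ 0 → Cross D B i j x y) : Good D A := by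
  have := L.nontrivial_ring
  set T : Set (Matrix X Y R) :=
    {B | B ∈ S ∧ Good D₁ (B.map π) ∧ Good D (dropCol B x) ∧ Good D (dropCol B y)}
  have hT2 : ∀ B ∈ T, Good2 D B := fun B hB =>
    good2_of_dropCol hxy hB.2.2.1.good2 hB.2.2.2.good2 (h B hB.1 hB.2.1 hB.2.2.1 hB.2.2.2)
  have hTp : ∀ B ∈ T, ∀ k, ∀ l ∈ ({l | l ≠ x ∧ l ≠ y} : Set Y), B k l ≠ 0 → pivot B k l ∈ T := by
    rintro B hB k l ⟨hlx, hly⟩ hkl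
    have hm := (hT2 B hB).1 k l
    refine ⟨hS B hB.1 k l hlx hly hkl, ?_, ?_, ?_⟩
    · rw [L.map_pivot hm]
      exact hB.2.1.pivot (L.map_ne_zero hm hkl)
    · rw [← pivot_dropCol _ hlx]
      exact hB.2.2.1.pivot (by rwa [dropCol_of_ne _ hlx])
    · rw [← pivot_dropCol _ hly]
      exact hB.2.2.2.pivot (by rwa [dropCol_of_ne _ hly])
  apply good_of_goodAt
  intro c
  -- Induction on how many of the selected columns are x or y. With none, pivots outside x and y
  -- reach the basis. Otherwise one of them is replaced by a unit column and exchanged back; all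
  -- other bases used on the way contain fewer of x and y.
  induction hn : (Finset.univ.filter fun i => c i = Sum.inr x ∨ c i = Sum.inr y).card using
    Nat.strong_induction_on generalizing c with
  | _ n ih =>
  intro hdet
  by_cases hst : ∃ i, c i = Sum.inr x ∨ c i = Sum.inr y
  · obtain ⟨i₀, hi₀⟩ := hst
    obtain ⟨k₀, hk₀⟩ := exists_update_inl_det_ne_zero A hdet i₀
    have hlt : ∀ i w, w ≠ Sum.inr x → w ≠ Sum.inr y →
        (Finset.univ.filter fun j =>
          Function.update (Function.update c i₀ (Sum.inl k₀)) i w j = Sum.inr x ∨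
          Function.update (Function.update c i₀ (Sum.inl k₀)) i w j = Sum.inr y).card < n := by
      intro i w hwx hwy
      rw [← hn]
      apply Finset.card_lt_card
      refine ⟨fun j hj => ?_, fun hsub => ?_⟩
      · simp only [Finset.mem_filter, Finset.mem_univ, true_and] at hj ⊢
        by_cases hji : j = i
        · subst hji; simp [hwx, hwy] at hj
        · rw [Function.update_of_ne hji] at hj
          by_cases hj0 : j = i₀
          · subst hj0; simp at hj
          · rwa [Function.update_of_ne hj0] at hj
      · have := hsub (x := i₀) (by simpa using hi₀)
        simp only [Finset.mem_filter, Finset.mem_univ, true_and] at this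
        by_cases hji : i₀ = i
        · subst hji; simp [hwx, hwy] at this
        · rw [Function.update_of_ne hji] at this
          simp at this
    have hc' := ih _ (hlt i₀ (Sum.inl k₀) (by simp) (by simp)) _ rfl (by simpa using hk₀)
    rw [Function.update_idem] at hc'
    have hback : Function.update (Function.update c i₀ (Sum.inl k₀)) i₀ (c i₀) = c := by simp
    have hW : ∀ u v : X ⊕ Y, u ≠ v → u ≠ c i₀ → v ≠ c i₀ →
        u ∈ ({w | w ≠ Sum.inr x ∧ w ≠ Sum.inr y} : Set (X ⊕ Y)) ∨
        v ∈ ({w | w ≠ Sum.inr x ∧ w ≠ Sum.inr y} : Set (X ⊕ Y)) := by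
      intro u v huv hu hv
      simp only [Set.mem_ofPred_eq]
      rcases hi₀ with h0 | h0 <;> rw [h0] at hu hv
      · by_cases huy : u = Sum.inr y
        · exact Or.inr ⟨hv, fun hvy => huv (huy.trans hvy.symm)⟩
        · exact Or.inl ⟨hu, huy⟩
      · by_cases hux : u = Sum.inr x
        · exact Or.inr ⟨fun hvx => huv (hux.trans hvx.symm), hv⟩
        · exact Or.inl ⟨hux, hu⟩
    have step : ∀ z : Y, c i₀ = Sum.inr z → GoodAt D (fromCols (1 : Matrix X X R) A) c := by
      intro z hz
      rw [hz] at hW hback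
      rw [← hback]
      refine L.goodAt_update hp hc' (k₀ := k₀) (by simp) (by rwa [hback]) hW fun i w hw hd => ?_
      exact (ih _ (hlt i w hw.1 hw.2) _ rfl hd).2
    rcases hi₀ with h0 | h0
    · exact step x h0
    · exact step y h0
  · push Not at hst
    refine goodAt_of_closed L.zero_mem L.one_mem hT2 hTp ⟨hA, hp, hx, hy⟩ (fun i l hl => ?_) hdet
    exact ⟨fun e => (hst i).1 (by rw [hl, e]), fun e => (hst i).2 (by rw [hl, e])⟩

end

end MatrixLift

/-! ### Walks between rows, and components. -/

namespace MatrixLift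

open Matrix

section Path

variable {R : Type*} [CommRing R] {X Y : Type*}

/-- Two rows are adjacent if they share a nonzero column from `W`. -/
def RowAdj (W : Set Y) (A : Matrix X Y R) (a b : X) : Prop := ∃ l ∈ W, A a l ≠ 0 ∧ A b l ≠ 0

/-- There is a walk of length `n` from row `i` to row `j`. -/
def HasWalk (W : Set Y) (A : Matrix X Y R) (i j : X) (n : ℕ) : Prop :=
  ∃ p : ℕ → X, p 0 = i ∧ p n = j ∧ ∀ m < n, RowAdj W A (p m) (p (m + 1))

theorem HasWalk.succ {W : Set Y} {A : Matrix X Y R} {i j k : X} {n : ℕ} (h : HasWalk W A i j n)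
    (hjk : RowAdj W A j k) : HasWalk W A i k (n + 1) := by
  obtain ⟨p, h0, hn, hp⟩ := h
  refine ⟨fun m => if m ≤ n then p m else k, by simpa using h0, by simp, fun m hm => ?_⟩
  by_cases hmn : m < n
  · simpa [hmn.le, Nat.succ_le_of_lt hmn] using hp m hmn
  · obtain rfl : m = n := by omega
    simpa [hn] using hjk

/-- `(U, V)` splits the matrix `A`, restricted to the columns in `W`, into two blocks. -/
def Splits (W : Set Y) (A : Matrix X Y R) (U : Set X) (V : Set Y) : Prop :=
  ∀ a, ∀ l ∈ W, A a l ≠ 0 → (a ∈ U ↔ l ∈ V)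

/-- Rows `i` and `j` are in the same component of `A`, restricted to the columns in `W`. -/
def Linked (W : Set Y) (A : Matrix X Y R) (i j : X) : Prop :=
  ∀ U V, Splits W A U V → i ∈ U → j ∈ U

theorem Linked.symm {W : Set Y} {A : Matrix X Y R} {i j : X} (h : Linked W A i j) :
    Linked W A j i := by
  intro U V hUV hj
  by_contra hi
  exact h Uᶜ Vᶜ (fun a l hl hal => not_congr (hUV a l hl hal)) hi hj

/-- The rows reachable from i, with the columns meeting them, split the matrix. -/
theorem Linked.hasWalk {W : Set Y} {A : Matrix X Y R} {i j : X} (h : Linked W A i j) :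
    ∃ n, HasWalk W A i j n := by
  refine h {a | ∃ n, HasWalk W A i a n} {l | ∃ a n, HasWalk W A i a n ∧ A a l ≠ 0} ?_
    ⟨0, fun _ => i, rfl, rfl, fun m hm => absurd hm (Nat.not_lt_zero m)⟩
  intro a l hl hal
  constructor
  · rintro ⟨n, hn⟩
    exact ⟨a, n, hn, hal⟩
  · rintro ⟨b, n, hn, hbl⟩
    exact ⟨n + 1, hn.succ ⟨l, hl, hbl, hal⟩⟩

theorem Linked.trans {W : Set Y} {A : Matrix X Y R} {i j k : X} (h : Linked W A i j)
    (h' : Linked W A j k) : Linked W A i k := fun U V hUV hi => h' U V hUV (h U V hUV hi)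

theorem RowAdj.linked {W : Set Y} {A : Matrix X Y R} {i j : X} (h : RowAdj W A i j) :
    Linked W A i j := by
  obtain ⟨l, hl, h1, h2⟩ := h
  exact fun U V hUV hi => (hUV _ l hl h2).2 ((hUV _ l hl h1).1 hi)

variable [DecidableEq X] [DecidableEq Y] {D : CrossSystem R}

/-- Induction along a walk between two rows: pivots that do not change these two rows reduce the
length of a walk to at most two. -/
theorem walk_induction {σ : Type*} (mat : σ → Matrix X Y R) (W : Set Y) (i j : X)
    (S C : σ → Prop) (hmem : ∀ s, S s → ∀ k l, mat s k l ∈ D.elems)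
    (hpiv : ∀ s k l, S s → l ∈ W → mat s k l ≠ 0 → mat s i l = 0 → mat s j l = 0 →
      ∃ s', S s' ∧ mat s' = pivot (mat s) k l ∧ (C s' → C s))
    (hshort : ∀ s n, S s → n ≤ 2 → HasWalk W (mat s) i j n → C s)
    {s : σ} (hs : S s) (hij : Linked W (mat s) i j) : C s := by
  obtain ⟨n, hn⟩ := hij.hasWalk
  clear hij
  induction n using Nat.strong_induction_on generalizing s with
  | _ n ih =>
  by_cases hn2 : n ≤ 2
  · exact hshort s n hs hn2 hn
  by_cases hmin : ∃ m < n, HasWalk W (mat s) i j m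
  · obtain ⟨m, hm, hw⟩ := hmin
    exact ih m hm hs hw
  push Not at hmin
  obtain ⟨p, h0, hpn, hp⟩ := hn
  -- The walk is shortest: a column shared by rows at distance at least two would allow a shortcut.
  have hno : ∀ a b, a + 2 ≤ b → b ≤ n → ∀ l ∈ W, mat s (p a) l ≠ 0 → mat s (p b) l = 0 := by
    intro a b hab hbn l hl ha
    by_contra hb
    refine hmin (n - (b - a - 1)) (by omega)
      ⟨fun m => if m ≤ a then p m else p (m + (b - a - 1)), by simpa using h0, ?_, ?_⟩
    · have h1 : ¬ n - (b - a - 1) ≤ a := by omega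
      have h2 : n - (b - a - 1) + (b - a - 1) = n := by omega
      simp only [h1, if_false, h2, hpn]
    · intro m hm
      rcases lt_trichotomy m a with h | h | h
      · simpa [h.le, Nat.succ_le_of_lt h] using hp m (by omega)
      · subst h
        have h2 : m + 1 + (b - m - 1) = b := by omega
        have h3 : ¬ m + 1 ≤ m := by omega
        simp only [le_refl, if_true, h3, if_false, h2]
        exact ⟨l, hl, ha, hb⟩
      · have h1 : ¬ m ≤ a := by omega
        have h2 : ¬ m + 1 ≤ a := by omega
        have h3 : m + 1 + (b - a - 1) = m + (b - a - 1) + 1 := by omega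
        simp only [h1, h2, if_false, h3]
        exact hp _ (by omega)
  obtain ⟨l₁, hl₁, h01, h11⟩ := hp 0 (by omega)
  obtain ⟨l₂, hl₂, h12, h22⟩ := hp 1 (by omega)
  obtain ⟨l₃, hl₃, h23, h33⟩ := hp 2 (by omega)
  simp only [Nat.zero_add, Nat.reduceAdd] at h11 h22 h33
  have hz2 : ∀ m, m ≠ 1 → m ≠ 2 → m ≤ n → mat s (p m) l₂ = 0 := by
    intro m h1 h2 hm
    rcases Nat.eq_zero_or_pos m with h | h
    · by_contra hc
      rw [h] at hc
      exact h22 (hno 0 2 (by omega) (by omega) l₂ hl₂ hc)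
    · exact hno 1 m (by omega) hm l₂ hl₂ h12
  have hz1 : mat s (p 2) l₁ = 0 := hno 0 2 (by omega) (by omega) l₁ hl₁ h01
  have hz3 : mat s (p 1) l₃ = 0 := by
    by_contra hc
    exact h33 (hno 1 3 (by omega) (by omega) l₃ hl₃ hc)
  have hl12 : l₁ ≠ l₂ := fun h => h22 (by rw [← h]; exact hz1)
  have hl32 : l₃ ≠ l₂ := fun h => h12 (by rw [← h]; exact hz3)
  have hp12 : p 1 ≠ p 2 := fun h => h23 (by rw [← h]; exact hz3)
  -- This pivot changes, among the rows of the walk, only those numbered 1 and 2, so both ends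
  -- survive because n ≥ 3. It fills the entry of row 1 in column l₃, so row 1 becomes adjacent to
  -- row 3 and row 2 can be skipped.
  obtain ⟨s', hs', hmat, hC⟩ := hpiv s (p 2) l₂ hs hl₂ h22
    (by rw [← h0]; exact hz2 0 (by omega) (by omega) (by omega))
    (by rw [← hpn]; exact hz2 n (by omega) (by omega) le_rfl)
  apply hC
  have hun : ∀ m, m ≠ 1 → m ≠ 2 → m ≤ n → ∀ l, mat s' (p m) l = mat s (p m) l := by
    intro m h1 h2 hm l
    rw [hmat]
    exact pivot_row_of_zero _ (fun h => h22 (by rw [← h]; exact hz2 m h1 h2 hm))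
      (hz2 m h1 h2 hm) l
  have e1 : mat s' (p 1) l₁ ≠ 0 := by
    rw [hmat, pivot_other _ hp12 hl12, hz1]
    simpa using h11
  have e3 : mat s' (p 1) l₃ ≠ 0 := by
    rw [hmat, pivot_other _ hp12 hl32, hz3, zero_sub, neg_ne_zero]
    exact mul_ne (mul_mem_elems (hmem s hs _ _) (inverse_mem_elems (hmem s hs _ _)))
      (mul_ne (hmem s hs _ _) h12 (inverse_ne (hmem s hs _ _) h22)) h23
  refine ih (n - 1) (by omega) hs' ⟨fun m => if m ≤ 1 then p m else p (m + 1),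
    by simpa using h0, ?_, ?_⟩
  · have h1 : ¬ n - 1 ≤ 1 := by omega
    have h2 : n - 1 + 1 = n := by omega
    simp only [h1, if_false, h2, hpn]
  · intro m hm
    rcases m with _ | _ | m
    · refine ⟨l₁, hl₁, ?_, ?_⟩
      · simpa [hun 0 (by omega) (by omega) (by omega)] using h01
      · simpa using e1
    · refine ⟨l₃, hl₃, ?_, ?_⟩
      · simpa using e3
      · simpa [hun 3 (by omega) (by omega) (by omega)] using h33
    · obtain ⟨l, hl, h1, h2⟩ := hp (m + 3) (by omega)
      refine ⟨l, hl, ?_, ?_⟩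
      · simpa [hun (m + 3) (by omega) (by omega) (by omega)] using h1
      · simpa [hun (m + 4) (by omega) (by omega) (by omega)] using h2

/-- Pivoting in a column of `W` does not change the components. -/
theorem Splits.of_pivot {W : Set Y} {A : Matrix X Y R} {k : X} {l : Y} (hl : l ∈ W)
    (hkl : A k l * Ring.inverse (A k l) = 1) (h1 : (1 : R) ≠ 0) {U : Set X} {V : Set Y}
    (h : Splits W A U V) : Splits W (pivot A k l) U V := by
  have hkl0 : A k l ≠ 0 := fun h0 => h1 (by rw [← hkl, h0, zero_mul])
  have hs := h k l hl hkl0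
  intro a m hm ham
  by_cases hak : a = k
  · subst hak
    by_cases hml : m = l
    · subst hml; exact hs
    · rw [pivot_row _ _ hml] at ham
      exact h a m hm (right_ne_zero_of_mul ham)
  · by_cases hml : m = l
    · subst hml
      rw [pivot_col _ _ hak, neg_ne_zero] at ham
      exact h a m hm (left_ne_zero_of_mul ham)
    · rw [pivot_other _ hak hml] at ham
      by_cases h0 : A a m = 0
      · rw [h0, zero_sub, neg_ne_zero] at ham
        have h2 := h k m hm (right_ne_zero_of_mul ham)
        have h3 := h a l hl (left_ne_zero_of_mul (left_ne_zero_of_mul ham))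
        rw [h3, ← hs, h2]
      · exact h a m hm h0

theorem splits_pivot_iff {W : Set Y} {A : Matrix X Y R} {k : X} {l : Y} (hl : l ∈ W)
    (hkl : A k l * Ring.inverse (A k l) = 1) (h1 : (1 : R) ≠ 0) {U : Set X} {V : Set Y} :
    Splits W (pivot A k l) U V ↔ Splits W A U V := by
  refine ⟨fun h => ?_, fun h => h.of_pivot hl hkl h1⟩
  have hkl' : pivot A k l k l * Ring.inverse (pivot A k l k l) = 1 := by
    have h2 := eq_inverse (a := Ring.inverse (A k l)) (by rw [mul_comm]; exact hkl)
    rw [pivot_same, ← h2, mul_comm]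
    exact hkl
  have := h.of_pivot hl hkl' h1
  rwa [pivot_pivot _ hkl] at this

end Path

end MatrixLift

/-! ### Cross ratios and lifts compared along linked rows. -/

namespace MatrixLift

open Matrix

section

variable {R R₁ : Type*} [CommRing R] [CommRing R₁] {X Y : Type*} [DecidableEq X] [DecidableEq Y]
  {D : CrossSystem R} {D₁ : CrossSystem R₁} {π : R →+* R₁}

/-- `B` is good downstairs, and it is good upstairs after deleting column `x` or column `y`. -/
structure TwoCol (D : CrossSystem R) (D₁ : CrossSystem R₁) (π : R →+* R₁) (x y : Y)
    (B : Matrix X Y R) : Prop where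
  ne : x ≠ y
  left : Good D (dropCol B x)
  right : Good D (dropCol B y)
  map : Good D₁ (B.map π)

theorem TwoCol.symm {x y : Y} {B : Matrix X Y R} (h : TwoCol D D₁ π x y B) :
    TwoCol D D₁ π y x B := ⟨h.ne.symm, h.right, h.left, h.map⟩

theorem TwoCol.mem {x y : Y} {B : Matrix X Y R} (h : TwoCol D D₁ π x y B) (i : X) (j : Y) :
    B i j ∈ D.elems := by
  by_cases hj : j = x
  · subst hj; rw [← dropCol_of_ne B h.ne i]; exact h.right.mem _ _
  · rw [← dropCol_of_ne B hj i]; exact h.left.mem _ _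

theorem TwoCol.cross {x y : Y} {B : Matrix X Y R} (h : TwoCol D D₁ π x y B) {i j : X} {u v : Y}
    (hu : u ≠ x) (hv : v ≠ x) (hiv : B i v ≠ 0) (hju : B j u ≠ 0) : Cross D B i j u v := by
  have := h.left.good2.2 i j u v (by rwa [dropCol_of_ne _ hv]) (by rwa [dropCol_of_ne _ hu])
  simp only [dropCol_of_ne _ hv, dropCol_of_ne _ hu] at this
  exact this

theorem TwoCol.pivot (L : IsLiftSystem D D₁ π) {x y : Y} {B : Matrix X Y R}
    (h : TwoCol D D₁ π x y B) {k : X} {l : Y} (hlx : l ≠ x) (hly : l ≠ y) (hkl : B k l ≠ 0) :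
    TwoCol D D₁ π x y (pivot B k l) := by
  refine ⟨h.ne, ?_, ?_, ?_⟩
  · rw [← pivot_dropCol _ hlx]
    exact h.left.pivot (by rwa [dropCol_of_ne _ hlx])
  · rw [← pivot_dropCol _ hly]
    exact h.right.pivot (by rwa [dropCol_of_ne _ hly])
  · rw [L.map_pivot (h.mem k l)]
    exact h.map.pivot (L.map_ne_zero (h.mem k l) hkl)

/-- The ratio of x, y factors through l; each factor involves only one of x and y, so it is known
from a deletion. -/
theorem TwoCol.cross_of_common (L : IsLiftSystem D D₁ π) {x y : Y} {B : Matrix X Y R}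
    (h : TwoCol D D₁ π x y B) {i j : X} {l : Y} (hlx : l ≠ x) (hly : l ≠ y) (hil : B i l ≠ 0)
    (hjl : B j l ≠ 0) (hiy : B i y ≠ 0) (hjx : B j x ≠ 0) : Cross D B i j x y :=
  L.cross_trans_col h.mem h.map.good2 hil hjl hiy hjx
    (h.symm.cross h.ne hly hil hjx) (h.cross hlx h.ne.symm hiy hjl)

/-- The case of a walk of length two in which the middle row has a nonzero entry in exactly one of
the columns `x`, `y`, and pivoting does not kill the entry of row `i`. -/
theorem TwoCol.cross_of_middle (L : IsLiftSystem D D₁ π) {x y : Y} {B : Matrix X Y R}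
    (h : TwoCol D D₁ π x y B) {i j k : X} {l₁ l₂ : Y} (hl₁x : l₁ ≠ x) (hl₁y : l₁ ≠ y)
    (hl₂x : l₂ ≠ x) (hl₂y : l₂ ≠ y) (hil₁ : B i l₁ ≠ 0) (hkl₁ : B k l₁ ≠ 0) (hkl₂ : B k l₂ ≠ 0)
    (hjl₂ : B j l₂ ≠ 0) (hil₂ : B i l₂ = 0) (hjl₁ : B j l₁ = 0) (hky : B k y = 0)
    (hix : B i x ≠ 0) (hiy : B i y ≠ 0) (hjx : B j x ≠ 0)
    (hne : B i x * B k l₁ ≠ B i l₁ * B k x) : Cross D B i j x y := by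
  have hik : i ≠ k := fun e => hkl₂ (by rw [← e]; exact hil₂)
  have hjk : j ≠ k := fun e => hkl₁ (by rw [← e]; exact hjl₁)
  have hl12 : l₂ ≠ l₁ := fun e => hkl₂ (by rw [e] at hil₂; exact absurd hil₂ hil₁)
  have he := mul_inverse (h.mem k l₁) hkl₁
  have hT := h.pivot L hl₁x hl₁y hkl₁
  have ej : ∀ m, MatrixLift.pivot B k l₁ j m = B j m := pivot_row_of_zero _ hjk hjl₁
  have eiy : MatrixLift.pivot B k l₁ i y = B i y := pivot_col_of_zero _ hl₁y.symm hky i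
  have eix : MatrixLift.pivot B k l₁ i x = B i x - B i l₁ * Ring.inverse (B k l₁) * B k x :=
    pivot_other _ hik hl₁x.symm
  have eil₂ : MatrixLift.pivot B k l₁ i l₂ ≠ 0 := by
    rw [pivot_other _ hik hl12, hil₂, zero_sub, neg_ne_zero]
    exact mul_ne (mul_mem_elems (h.mem _ _) (inverse_mem_elems (h.mem _ _)))
      (mul_ne (h.mem _ _) hil₁ (inverse_ne (h.mem _ _) hkl₁)) hkl₂
  -- After the pivot, rows i and j share column l₂. The only entry of the wanted ratio that changed
  -- is that of row i in column x, by the factor 1 - p, so the ratio is t / (1 - p).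
  obtain ⟨t, ht, et⟩ := hT.cross_of_common L hl₂x hl₂y eil₂ (by rwa [ej]) (by rwa [eiy])
    (by rwa [ej])
  obtain ⟨p, hp, ep⟩ := h.symm.cross (i := i) (j := k) (u := l₁) (v := x) hl₁y h.ne hix hkl₁
  rw [ej, ej, eiy, eix] at et
  have e2 : B i x - B i l₁ * Ring.inverse (B k l₁) * B k x = (1 - p) * B i x := by
    linear_combination -Ring.inverse (B k l₁) * ep - p * B i x * he
  have hp1 := L.one_sub_mem p hp
  have hp0 : 1 - p ≠ 0 := fun h0 => hne (by
    rw [ep]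
    linear_combination (B i x * B k l₁) * h0)
  have e3 := mul_inverse (L.H_subset hp1) hp0
  refine L.mul_cross ht (L.inverse_mem _ hp1 hp0) (mul_mem_elems (h.mem i y) (h.mem j x))
    (mul_ne (h.mem _ _) hiy hjx) ?_ ?_
  · rw [e2] at et
    linear_combination Ring.inverse (1 - p) * et - B i x * B j y * e3
  · simpa using h.map.good2.2 i j x y (L.map_ne_zero (h.mem _ _) hiy) (L.map_ne_zero (h.mem _ _) hjx)

theorem TwoCol.cross_of_walk_two_left (L : IsLiftSystem D D₁ π) {x y : Y} {B : Matrix X Y R}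
    (h : TwoCol D D₁ π x y B) {i j k : X} {l₁ l₂ : Y} (hl₁x : l₁ ≠ x) (hl₁y : l₁ ≠ y)
    (hl₂x : l₂ ≠ x) (hl₂y : l₂ ≠ y) (hil₁ : B i l₁ ≠ 0) (hkl₁ : B k l₁ ≠ 0) (hkl₂ : B k l₂ ≠ 0)
    (hjl₂ : B j l₂ ≠ 0) (hil₂ : B i l₂ = 0) (hjl₁ : B j l₁ = 0) (hky : B k y = 0)
    (hix : B i x ≠ 0) (hiy : B i y ≠ 0) (hjx : B j x ≠ 0) (hjy : B j y ≠ 0) :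
    Cross D B i j x y := by
  by_cases h1 : B i x * B k l₁ = B i l₁ * B k x
  swap
  · exact h.cross_of_middle L hl₁x hl₁y hl₂x hl₂y hil₁ hkl₁ hkl₂ hjl₂ hil₂ hjl₁ hky hix hiy hjx h1
  by_cases h2 : B j x * B k l₂ = B j l₂ * B k x
  swap
  · exact L.cross_swap h.mem hjx hiy
      (h.cross_of_middle L hl₂x hl₂y hl₁x hl₁y hjl₂ hkl₂ hkl₁ hil₁ hjl₁ hil₂ hky hjx hjy hix h2)
  have hik : i ≠ k := fun e => hkl₂ (by rw [← e]; exact hil₂)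
  have hjk : j ≠ k := fun e => hkl₁ (by rw [← e]; exact hjl₁)
  have hl12 : l₂ ≠ l₁ := fun e => hkl₂ (by rw [e] at hil₂; exact absurd hil₂ hil₁)
  have he := mul_inverse (h.mem k l₁) hkl₁
  have hT := h.pivot L hl₁x hl₁y hkl₁
  have ej : ∀ m, MatrixLift.pivot B k l₁ j m = B j m := pivot_row_of_zero _ hjk hjl₁
  have eiy : MatrixLift.pivot B k l₁ i y = B i y := pivot_col_of_zero _ hl₁y.symm hky i
  have eil₂ : MatrixLift.pivot B k l₁ i l₂ = -(B i l₁ * Ring.inverse (B k l₁) * B k l₂) := by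
    rw [pivot_other _ hik hl12, hil₂, zero_sub]
  obtain ⟨t, ht, et⟩ := hT.cross (i := i) (j := j) (u := l₂) (v := y) hl₂x h.ne.symm
    (by rwa [eiy]) (by rwa [ej])
  rw [eil₂, ej, ej, eiy] at et
  -- Both pivots kill an entry of x, so x is proportional to l₁ in rows i, k and to l₂ in rows j, k.
  -- After the pivot l₂ replaces x up to sign. This is the one use of closure under negation.
  refine L.neg_cross ht (mul_mem_elems (h.mem i y) (h.mem j x)) (mul_ne (h.mem _ _) hiy hjx) ?_ ?_
  · apply cancel (h.mem k l₂) hkl₂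
    linear_combination (-B i x * B j y * B k l₂) * he +
      B j y * B k l₂ * Ring.inverse (B k l₁) * h1 - B k x * et + t * B i y * h2
  · simpa using h.map.good2.2 i j x y (L.map_ne_zero (h.mem _ _) hiy) (L.map_ne_zero (h.mem _ _) hjx)

theorem TwoCol.cross_of_walk_two (L : IsLiftSystem D D₁ π) {x y : Y} {B : Matrix X Y R}
    (h : TwoCol D D₁ π x y B) {i j k : X} {l₁ l₂ : Y} (hl₁x : l₁ ≠ x) (hl₁y : l₁ ≠ y)
    (hl₂x : l₂ ≠ x) (hl₂y : l₂ ≠ y) (hil₁ : B i l₁ ≠ 0) (hkl₁ : B k l₁ ≠ 0) (hkl₂ : B k l₂ ≠ 0)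
    (hjl₂ : B j l₂ ≠ 0) (hix : B i x ≠ 0) (hiy : B i y ≠ 0) (hjx : B j x ≠ 0) (hjy : B j y ≠ 0) :
    Cross D B i j x y := by
  by_cases hjl₁ : B j l₁ = 0
  swap
  · exact h.cross_of_common L hl₁x hl₁y hil₁ hjl₁ hiy hjx
  by_cases hil₂ : B i l₂ = 0
  swap
  · exact h.cross_of_common L hl₂x hl₂y hil₂ hjl₂ hiy hjx
  by_cases hky : B k y = 0
  · exact h.cross_of_walk_two_left L hl₁x hl₁y hl₂x hl₂y hil₁ hkl₁ hkl₂ hjl₂ hil₂ hjl₁ hky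
      hix hiy hjx hjy
  by_cases hkx : B k x = 0
  · exact L.cross_swap h.mem hjx hiy (h.symm.cross_of_walk_two_left L hl₁y hl₁x hl₂y hl₂x hil₁
      hkl₁ hkl₂ hjl₂ hil₂ hjl₁ hkx hiy hix hjy hjx).symm
  · exact L.cross_trans_row h.mem h.map.good2 hkx hky hiy hjx
      (h.cross_of_common L hl₁x hl₁y hil₁ hkl₁ hiy hkx)
      (h.cross_of_common L hl₂x hl₂y hkl₂ hjl₂ hky hjx)

/-- If two rows are linked by the columns other than `x` and `y`, then their cross ratio in the
columns `x` and `y` is admissible. -/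
theorem TwoCol.cross_of_linked (L : IsLiftSystem D D₁ π) {x y : Y} {B : Matrix X Y R}
    (h : TwoCol D D₁ π x y B) {i j : X} (hix : B i x ≠ 0) (hiy : B i y ≠ 0) (hjx : B j x ≠ 0)
    (hjy : B j y ≠ 0) (hij : Linked {l | l ≠ x ∧ l ≠ y} B i j) : Cross D B i j x y := by
  refine walk_induction (D := D) (fun B : Matrix X Y R => B) {l | l ≠ x ∧ l ≠ y} i j
    (fun B => TwoCol D D₁ π x y B ∧ B i x ≠ 0 ∧ B i y ≠ 0 ∧ B j x ≠ 0 ∧ B j y ≠ 0)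
    (fun B => Cross D B i j x y) (fun s hs => hs.1.mem) ?_ ?_ ⟨h, hix, hiy, hjx, hjy⟩ hij
  · rintro B k l ⟨hB, h1, h2, h3, h4⟩ ⟨hlx, hly⟩ hkl hil hjl
    have ei : ∀ m, MatrixLift.pivot B k l i m = B i m :=
      pivot_row_of_zero _ (fun e => hkl (by rw [← e]; exact hil)) hil
    have ej : ∀ m, MatrixLift.pivot B k l j m = B j m :=
      pivot_row_of_zero _ (fun e => hkl (by rw [← e]; exact hjl)) hjl
    refine ⟨MatrixLift.pivot B k l, ⟨hB.pivot L hlx hly hkl, by rwa [ei], by rwa [ei],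
      by rwa [ej], by rwa [ej]⟩, rfl, fun hc => ?_⟩
    unfold Cross at hc ⊢
    simpa only [ei, ej] using hc
  · rintro B n ⟨hB, h1, h2, h3, h4⟩ hn ⟨p, h0, hpn, hp⟩
    interval_cases n
    · have : i = j := h0.symm.trans hpn
      subst this
      exact ⟨1, L.one_mem, by ring⟩
    · obtain ⟨l, ⟨hlx, hly⟩, ha, hb⟩ := hp 0 (by omega)
      rw [h0] at ha
      rw [hpn] at hb
      exact hB.cross_of_common L hlx hly ha hb h2 h3
    · obtain ⟨l₁, ⟨hl₁x, hl₁y⟩, ha, hb⟩ := hp 0 (by omega)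
      obtain ⟨l₂, ⟨hl₂x, hl₂y⟩, hc, hd⟩ := hp 1 (by omega)
      rw [h0] at ha
      rw [hpn] at hd
      exact hB.cross_of_walk_two L hl₁x hl₁y hl₂x hl₂y ha hb hc hd h1 h2 h3 h4

/-- `B` and `B'` are good matrices with the same image that differ in column `y` only. -/
structure SameOff (D : CrossSystem R) (π : R →+* R₁) (y : Y) (B B' : Matrix X Y R) : Prop where
  left : Good D B
  right : Good D B'
  map : B.map π = B'.map π
  eq : ∀ i j, j ≠ y → B i j = B' i j

theorem SameOff.pivot (L : IsLiftSystem D D₁ π) {y : Y} {B B' : Matrix X Y R}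
    (h : SameOff D π y B B') {k : X} {l : Y} (hl : l ≠ y) (hkl : B k l ≠ 0) :
    SameOff D π y (pivot B k l) (pivot B' k l) := by
  have e := h.eq k l hl
  refine ⟨h.left.pivot hkl, h.right.pivot (by rwa [← e]), ?_, fun i j hj => ?_⟩
  · rw [L.map_pivot (h.left.mem _ _), L.map_pivot (h.right.mem _ _), h.map]
  · simp only [MatrixLift.pivot, h.eq _ _ hl, h.eq _ _ hj]

theorem SameOff.map_eq {y : Y} {B B' : Matrix X Y R} (h : SameOff D π y B B') (i : X) (j : Y) :
    π (B i j) = π (B' i j) := congrFun (congrFun h.map i) j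

/-- The cross ratios of columns l and y in the two lifts have the same image, hence are equal,
because `π` is injective on admissible elements. -/
theorem SameOff.ratio_of_common (L : IsLiftSystem D D₁ π) {y : Y} {B B' : Matrix X Y R}
    (h : SameOff D π y B B') {i j : X} {l : Y} (hl : l ≠ y) (hil : B i l ≠ 0) (hjl : B j l ≠ 0)
    (hiy : B i y ≠ 0) : B' i y * B j y = B' j y * B i y := by
  have hiy' : B' i y ≠ 0 := by
    intro h0
    rw [← L.map_eq_zero (h.right.mem _ _), ← h.map_eq, L.map_eq_zero (h.left.mem _ _)] at h0
    exact hiy h0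
  obtain ⟨t, ht, et⟩ := h.left.good2.cross (i := i) (j := j) (u := l) (v := y) hiy hjl
  obtain ⟨s, hs, es⟩ := h.right.good2.cross (i := i) (j := j) (u := l) (v := y) hiy'
    (by rwa [← h.eq _ _ hl])
  have hts : t = s := by
    apply L.inj t ht s hs
    have e1 := congrArg π et
    have e2 := congrArg π es
    simp only [map_mul, ← h.map_eq] at e1 e2
    apply cancel (L.map_mem (h.left.mem i y)) (L.map_ne_zero (h.left.mem _ _) hiy)
    apply cancel (L.map_mem (h.left.mem j l)) (L.map_ne_zero (h.left.mem _ _) hjl)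
    linear_combination e2 - e1
  rw [← h.eq _ _ hl, ← h.eq _ _ hl, ← hts] at es
  apply cancel (h.left.mem i l) hil
  linear_combination B' i y * et - B i y * es

theorem SameOff.ratio_of_linked (L : IsLiftSystem D D₁ π) {y : Y} {B B' : Matrix X Y R}
    (h : SameOff D π y B B') {i j : X} (hiy : B i y ≠ 0) (hjy : B j y ≠ 0)
    (hij : Linked {l | l ≠ y} B i j) : B' i y * B j y = B' j y * B i y := by
  refine walk_induction (D := D) (fun s : Matrix X Y R × Matrix X Y R => s.1) {l | l ≠ y} i j
    (fun s => SameOff D π y s.1 s.2 ∧ s.1 i y ≠ 0 ∧ s.1 j y ≠ 0)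
    (fun s => s.2 i y * s.1 j y = s.2 j y * s.1 i y) (fun s hs => hs.1.left.mem) ?_ ?_
    (s := (B, B')) ⟨h, hiy, hjy⟩ hij
  · rintro ⟨B, B'⟩ k l ⟨hB, h1, h2⟩ hl hkl hil hjl
    simp only at hB h1 h2 hkl hil hjl
    have hik : i ≠ k := fun e => hkl (by rw [← e]; exact hil)
    have hjk : j ≠ k := fun e => hkl (by rw [← e]; exact hjl)
    have ei : ∀ m, MatrixLift.pivot B k l i m = B i m := pivot_row_of_zero _ hik hil
    have ej : ∀ m, MatrixLift.pivot B k l j m = B j m := pivot_row_of_zero _ hjk hjl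
    have ei' : ∀ m, MatrixLift.pivot B' k l i m = B' i m :=
      pivot_row_of_zero _ hik (by rw [← hB.eq _ _ hl]; exact hil)
    have ej' : ∀ m, MatrixLift.pivot B' k l j m = B' j m :=
      pivot_row_of_zero _ hjk (by rw [← hB.eq _ _ hl]; exact hjl)
    refine ⟨(MatrixLift.pivot B k l, MatrixLift.pivot B' k l), ⟨hB.pivot L hl hkl,
      by simpa only [ei] using h1, by simpa only [ej] using h2⟩, rfl, fun hc => ?_⟩
    simpa only [ei, ej, ei', ej'] using hc
  · rintro ⟨B, B'⟩ n ⟨hB, h1, h2⟩ hn ⟨p, h0, hpn, hp⟩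
    simp only at hB h1 h2 hp ⊢
    interval_cases n
    · have : i = j := h0.symm.trans hpn
      subst this
      ring
    · obtain ⟨l, hl, ha, hb⟩ := hp 0 (by omega)
      rw [h0] at ha
      rw [hpn] at hb
      exact hB.ratio_of_common L hl ha hb h1
    · obtain ⟨l₁, hl₁, ha, hb⟩ := hp 0 (by omega)
      obtain ⟨l₂, hl₂, hc, hd⟩ := hp 1 (by omega)
      simp only [Nat.zero_add, Nat.reduceAdd] at hb hc hd
      rw [h0] at ha
      rw [hpn] at hd
      by_cases hky : B (p 1) y = 0
      · by_cases hil₂ : B i l₂ = 0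
        swap
        · exact hB.ratio_of_common L hl₂ hil₂ hd h1
        by_cases hjl₁ : B j l₁ = 0
        swap
        · exact hB.ratio_of_common L hl₁ ha hjl₁ h1
        have hky' : B' (p 1) y = 0 := by
          rw [← L.map_eq_zero (hB.right.mem _ _), ← hB.map_eq, hky, map_zero]
        have hik : i ≠ p 1 := fun e => hc (by rw [← e]; exact hil₂)
        have hjk : j ≠ p 1 := fun e => hb (by rw [← e]; exact hjl₁)
        have hl12 : l₂ ≠ l₁ := fun e => ha (by rw [← e]; exact hil₂)
        have hP := hB.pivot L hl₁ hb
        have ej : ∀ m, MatrixLift.pivot B (p 1) l₁ j m = B j m := pivot_row_of_zero _ hjk hjl₁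
        have ej' : ∀ m, MatrixLift.pivot B' (p 1) l₁ j m = B' j m :=
          pivot_row_of_zero _ hjk (by rw [← hB.eq _ _ hl₁]; exact hjl₁)
        have ei : MatrixLift.pivot B (p 1) l₁ i y = B i y :=
          pivot_col_of_zero _ (Ne.symm hl₁) hky i
        have ei' : MatrixLift.pivot B' (p 1) l₁ i y = B' i y :=
          pivot_col_of_zero _ (Ne.symm hl₁) hky' i
        have := hP.ratio_of_common L (i := i) (j := j) hl₂ (by
          rw [pivot_other _ hik hl12, hil₂, zero_sub, neg_ne_zero]
          exact mul_ne (mul_mem_elems (hB.left.mem _ _) (inverse_mem_elems (hB.left.mem _ _)))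
            (mul_ne (hB.left.mem _ _) ha (inverse_ne (hB.left.mem _ _) hb)) hc)
          (by rwa [ej]) (by rwa [ei])
        rwa [ei, ei', ej, ej'] at this
      · have e1 := hB.ratio_of_common L hl₁ ha hb h1
        have e2 := hB.ratio_of_common L hl₂ hc hd hky
        apply cancel (hB.left.mem (p 1) y) hky
        linear_combination B j y * e1 + B i y * e2

end

end MatrixLift

/-! ### Uniqueness of lifts up to scaling, and gluing. -/

namespace MatrixLift

open Matrix

section

variable {R R₁ : Type*} [CommRing R] [CommRing R₁] {X Y : Type*} [DecidableEq X] [DecidableEq Y]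
  {D : CrossSystem R} {D₁ : CrossSystem R₁} {π : R →+* R₁}

/-- The elements of `G` that `π` maps to `1`. -/
def kernelUnits (D : CrossSystem R) (π : R →+* R₁) : Subgroup Rˣ :=
  D.G ⊓ (Units.map (π : R →* R₁)).ker

theorem map_kernelUnits {g : Rˣ} (hg : g ∈ kernelUnits D π) : π g = 1 :=
  congrArg Units.val (MonoidHom.mem_ker.1 hg.2)

theorem map_scale_kernelUnits {X Y : Type*} {A : Matrix X Y R} {r : X → Rˣ} {c : Y → Rˣ}
    (hr : ∀ i, r i ∈ kernelUnits D π) (hc : ∀ j, c j ∈ kernelUnits D π) :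
    (scale r c A).map π = A.map π := by
  ext i j
  simp [scale, map_kernelUnits (hr i), map_kernelUnits (hc j)]

/-- By `ratio_of_linked` the two versions of column y differ by a constant on each component of the
remaining columns. The rows of the component are multiplied by it, its other columns by the inverse.
-/
theorem SameOff.exists_scale (L : IsLiftSystem D D₁ π) {y : Y} {B B' : Matrix X Y R}
    (h : SameOff D π y B B') : ∃ (r : X → Rˣ) (c : Y → Rˣ), (∀ i, r i ∈ kernelUnits D π) ∧
      (∀ j, c j ∈ kernelUnits D π) ∧ B' = scale r c B := by
  classical
  let W : Set Y := {l | l ≠ y}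
  have hratio : ∀ i, B i y ≠ 0 → ∃ t ∈ kernelUnits D π, B' i y = t * B i y := by
    intro i hi
    have hi' : B' i y ≠ 0 := by
      intro h0
      rw [← L.map_eq_zero (h.right.mem _ _), ← h.map_eq, L.map_eq_zero (h.left.mem _ _)] at h0
      exact hi h0
    obtain ⟨g, hg, eg⟩ := exists_unit (h.left.mem i y) hi
    obtain ⟨g', hg', eg'⟩ := exists_unit (h.right.mem i y) hi'
    have hm := h.map_eq i y
    refine ⟨g' * g⁻¹, ⟨D.G.mul_mem hg' (D.G.inv_mem hg), ?_⟩, by simp [← eg, ← eg']⟩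
    have e1 : Units.map (π : R →* R₁) g = Units.map (π : R →* R₁) g' := by
      ext
      simpa [eg, eg'] using hm
    exact MonoidHom.mem_ker.2 (by rw [map_mul, map_inv, e1, mul_inv_cancel])
  have hrow : ∀ i, ∃ ρ ∈ kernelUnits D π, ∀ j, Linked W B i j → B j y ≠ 0 →
      B' j y = ρ * B j y := by
    intro i
    by_cases hex : ∃ j, Linked W B i j ∧ B j y ≠ 0
    · obtain ⟨j, hj, hjy⟩ := hex
      obtain ⟨t, ht, et⟩ := hratio j hjy
      refine ⟨t, ht, fun j' hj' hjy' => ?_⟩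
      have := h.ratio_of_linked L hjy hjy' (hj.symm.trans hj')
      apply cancel (h.left.mem j y) hjy
      rw [et] at this
      linear_combination -this
    · push Not at hex
      exact ⟨1, Subgroup.one_mem _, fun j hj hjy => absurd (hex j hj) hjy⟩
  choose ρ hρ hρ' using hrow
  -- Chosen representatives make the factor constant on components: where column y vanishes on a
  -- whole component, the choice of ρ is otherwise arbitrary.
  let st : Setoid X := ⟨Linked W B, ⟨fun _ _ _ _ h => h, Linked.symm, Linked.trans⟩⟩
  let rep : X → X := fun i => (Quotient.mk st i).out
  have hrep : ∀ i, Linked W B (rep i) i := fun i => Quotient.mk_out (s := st) i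
  have hrep' : ∀ i j, Linked W B i j → rep i = rep j := fun i j hij =>
    congrArg Quotient.out (Quotient.sound (s := st) hij)
  have hcol : ∀ l, ∃ γ ∈ kernelUnits D π, l ≠ y → ∀ i, B i l ≠ 0 → γ = (ρ (rep i))⁻¹ := by
    intro l
    by_cases hex : ∃ i, B i l ≠ 0
    · obtain ⟨i, hi⟩ := hex
      refine ⟨(ρ (rep i))⁻¹, Subgroup.inv_mem _ (hρ _), fun hl j hj => ?_⟩
      rw [hrep' i j (RowAdj.linked ⟨l, hl, hi, hj⟩)]
    · push Not at hex
      exact ⟨1, Subgroup.one_mem _, fun _ i hi => absurd (hex i) hi⟩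
  choose γ hγ hγ' using hcol
  refine ⟨fun i => ρ (rep i), Function.update γ y 1, fun i => hρ _, fun j => ?_, ?_⟩
  · by_cases hj : j = y
    · subst hj; simp
    · rw [Function.update_of_ne hj]; exact hγ j
  · ext i j
    by_cases hj : j = y
    · subst hj
      simp only [scale, Function.update_self, Units.val_one, mul_one]
      by_cases hi : B i j = 0
      · rw [hi, mul_zero, ← L.map_eq_zero (h.right.mem _ _), ← h.map_eq, hi, map_zero]
      · exact hρ' _ _ (hrep i) hi
    · simp only [scale, Function.update_of_ne hj]
      by_cases hi : B i j = 0
      · rw [← h.eq i j hj, hi]; ring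
      · rw [hγ' j hj i hi, ← h.eq i j hj, mul_right_comm, Units.mul_inv, one_mul]

theorem IsLiftSystem.exists_scale_of_support (L : IsLiftSystem D D₁ π) (T : Finset Y)
    {A A' : Matrix X Y R} (hA : Good D A) (hA' : Good D A') (he : A.map π = A'.map π)
    (hT : ∀ i, ∀ j ∉ T, A i j = 0) : ∃ (r : X → Rˣ) (c : Y → Rˣ),
      (∀ i, r i ∈ kernelUnits D π) ∧ (∀ j, c j ∈ kernelUnits D π) ∧ A' = scale r c A := by
  induction T using Finset.induction_on generalizing A A' with
  | empty =>
    refine ⟨1, 1, fun _ => Subgroup.one_mem _, fun _ => Subgroup.one_mem _, ?_⟩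
    rw [scale_one]
    ext i j
    have h0 := hT i j (by simp)
    have h1 : π (A i j) = π (A' i j) := congrFun (congrFun he i) j
    rw [h0, ← L.map_eq_zero (hA'.mem i j), ← h1, h0, map_zero]
  | insert y T _ ih =>
    obtain ⟨r, c, hr, hc, e⟩ := ih (hA.dropCol y) (hA'.dropCol y) (by
        ext i j
        by_cases hj : j = y
        · subst hj; simp
        · simpa [dropCol_of_ne _ hj] using congrFun (congrFun he i) j) (by
        intro i j hj
        by_cases hjy : j = y
        · subst hjy; simp
        · rw [dropCol_of_ne _ hjy]
          exact hT i j (by simp [hjy, hj]))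
    have hS : SameOff D π y (scale r c A) A' := by
      refine ⟨hA.scale (fun i => (hr i).1) (fun j => (hc j).1), hA', ?_, fun i j hj => ?_⟩
      · rw [map_scale_kernelUnits hr hc, he]
      · have := congrFun (congrFun e i) j
        rw [dropCol_of_ne _ hj] at this
        rw [this]
        simp [scale, dropCol_of_ne _ hj]
    obtain ⟨r', c', hr', hc', e'⟩ := hS.exists_scale L
    exact ⟨r' * r, c' * c, fun i => Subgroup.mul_mem _ (hr' i) (hr i),
      fun j => Subgroup.mul_mem _ (hc' j) (hc j), by rw [e', scale_scale]⟩

/-- Lifts are unique up to scaling. -/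
theorem IsLiftSystem.exists_scale [Finite Y] (L : IsLiftSystem D D₁ π)
    {A A' : Matrix X Y R} (hA : Good D A) (hA' : Good D A') (he : A.map π = A'.map π) :
    ∃ (r : X → Rˣ) (c : Y → Rˣ),
      (∀ i, r i ∈ kernelUnits D π) ∧ (∀ j, c j ∈ kernelUnits D π) ∧ A' = scale r c A := by
  have := Fintype.ofFinite Y
  exact L.exists_scale_of_support Finset.univ hA hA' he (by simp)

/-- The matrix `A` has a good lift. -/
def Liftable (D : CrossSystem R) (π : R →+* R₁) (A : Matrix X Y R₁) : Prop :=
  ∃ B, Good D B ∧ B.map π = A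

theorem Liftable.transpose {A : Matrix X Y R₁} (h : Liftable D π A) : Liftable D π Aᵀ := by
  obtain ⟨B, hB, rfl⟩ := h
  exact ⟨Bᵀ, hB.transpose, rfl⟩

theorem Liftable.of_pivot (L : IsLiftSystem D D₁ π) {A : Matrix X Y R₁} {k : X} {l : Y}
    (hm : A k l ∈ D₁.elems) (hkl : A k l ≠ 0) (h : Liftable D π (pivot A k l)) :
    Liftable D π A := by
  obtain ⟨B, hB, e⟩ := h
  have h1 : π (B k l) = Ring.inverse (A k l) := by
    rw [← pivot_same A k l, ← e]; rfl
  have h2 : B k l ≠ 0 := fun h0 => inverse_ne hm hkl (by rw [← h1, h0, map_zero])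
  refine ⟨pivot B k l, hB.pivot h2, ?_⟩
  rw [L.map_pivot (hB.mem k l), e, pivot_pivot _ (mul_inverse hm hkl)]

/-- Gluing lifts of `A` with column `x` deleted and of `A` with column `y` deleted. -/
theorem IsLiftSystem.liftable_of_dropCol [Finite X] [Finite Y] (L : IsLiftSystem D D₁ π)
    {A : Matrix X Y R₁}
    (hA : Good D₁ A) {x y : Y} (hxy : x ≠ y) (hx : Liftable D π (dropCol A x))
    (hy : Liftable D π (dropCol A y)) {S : Set (Matrix X Y R₁)} (hAS : A ∈ S)
    (hS : ∀ B ∈ S, ∀ k l, l ≠ x → l ≠ y → B k l * Ring.inverse (B k l) = 1 → pivot B k l ∈ S)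
    (hlink : ∀ B ∈ S, ∀ i j, B i x ≠ 0 → B i y ≠ 0 → B j x ≠ 0 → B j y ≠ 0 →
      Linked {l | l ≠ x ∧ l ≠ y} B i j) : Liftable D π A := by
  have := Fintype.ofFinite X
  obtain ⟨Ax, hAx, ex⟩ := hx
  obtain ⟨Ay, hAy, ey⟩ := hy
  obtain ⟨r, c, hr, hc, e⟩ := L.exists_scale (hAx.dropCol y) (hAy.dropCol x) (by
    ext i j
    have e1 : π (Ax i j) = dropCol A x i j := congrFun (congrFun ex i) j
    have e2 : π (Ay i j) = dropCol A y i j := congrFun (congrFun ey i) j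
    by_cases hjx : j = x
    · subst hjx
      simpa [dropCol_of_ne _ hxy] using e1
    · by_cases hjy : j = y
      · subst hjy
        simpa [dropCol_of_ne _ hxy.symm] using e2.symm
      · simp [dropCol_of_ne _ hjx, dropCol_of_ne _ hjy] at e1 e2 ⊢
        rw [e1, e2])
  -- After rescaling, the lift without x agrees with the lift without y off these two columns; it
  -- contributes column y.
  let At : Matrix X Y R := fun i j => if j = y then scale r c Ax i y else Ay i j
  have hdx : dropCol At x = scale r c Ax := by
    ext i j
    by_cases hjx : j = x
    · subst hjx
      have e1 : π (Ax i j) = dropCol A j i j := congrFun (congrFun ex i) j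
      rw [dropCol_same, L.map_eq_zero (hAx.mem i j)] at e1
      simp [scale, e1]
    · rw [dropCol_of_ne _ hjx]
      by_cases hjy : j = y
      · subst hjy; simp [At]
      · have e1 := congrFun (congrFun e i) j
        rw [dropCol_of_ne _ hjx] at e1
        simp only [scale, dropCol_of_ne _ hjy] at e1
        simp only [At, hjy, if_false, e1, scale]
  have hdy : dropCol At y = Ay := by
    ext i j
    by_cases hjy : j = y
    · subst hjy
      have e1 : π (Ay i j) = dropCol A j i j := congrFun (congrFun ey i) j
      rw [dropCol_same, L.map_eq_zero (hAy.mem i j)] at e1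
      rw [dropCol_same, e1]
    · rw [dropCol_of_ne _ hjy]
      simp [At, hjy]
  have hπ : At.map π = A := by
    ext i j
    by_cases hjy : j = y
    · subst hjy
      have e1 := congrFun (congrFun (map_scale_kernelUnits (A := Ax) hr hc) i) j
      rw [ex, dropCol_of_ne _ hxy.symm] at e1
      rw [map_apply] at e1 ⊢
      simpa only [At, if_true] using e1
    · have e2 : π (Ay i j) = dropCol A y i j := congrFun (congrFun ey i) j
      rw [dropCol_of_ne _ hjy] at e2
      rw [map_apply]
      simpa only [At, hjy, if_false] using e2
  have hAx' := hAx.scale (fun i => (hr i).1) (fun j => (hc j).1)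
  refine ⟨At, ?_, hπ⟩
  refine L.good_of_dropCol (S := {B | TwoCol D D₁ π x y B ∧ B.map π ∈ S}) (by rwa [hπ]) hxy
    (by rwa [hdx]) (by rwa [hdy]) ⟨⟨hxy, by rwa [hdx], by rwa [hdy], by rwa [hπ]⟩, by rwa [hπ]⟩
    ?_ ?_
  · rintro B ⟨hB, hBS⟩ k l hlx hly hkl
    refine ⟨hB.pivot L hlx hly hkl, ?_⟩
    rw [L.map_pivot (hB.mem k l)]
    refine hS _ hBS k l hlx hly ?_
    exact mul_inverse (L.map_mem (hB.mem k l)) (L.map_ne_zero (hB.mem k l) hkl)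
  · rintro B ⟨hB, hBS⟩ _ _ _ i j hiy hjx
    by_cases hix : B i x = 0
    · exact L.cross_of_mul_eq_zero (by rw [hix, zero_mul])
    by_cases hjy : B j y = 0
    · exact L.cross_of_mul_eq_zero (by rw [hjy, mul_zero])
    have hne : ∀ k l, (B.map π) k l ≠ 0 ↔ B k l ≠ 0 := fun k l =>
      (L.map_eq_zero (hB.mem k l)).not
    refine hB.cross_of_linked L hix hiy hjx hjy fun U V hUV hi => ?_
    refine hlink _ hBS i j ((hne _ _).2 hix) ((hne _ _).2 hiy) ((hne _ _).2 hjx)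
      ((hne _ _).2 hjy) U V (fun a l hl hal => hUV a l hl ((hne _ _).1 hal)) hi

end

end MatrixLift

/-! ### Base cases, and connected cores. -/

namespace MatrixLift

open Matrix

section SingleCol

variable {R R₁ : Type*} [CommRing R] [CommRing R₁] {X Y : Type*}
  {D : CrossSystem R} {D₁ : CrossSystem R₁} {π : R →+* R₁}

/-- All nonzero entries are in the same column. -/
def SingleCol (A : Matrix X Y R) : Prop := ∀ i j i' j', A i j ≠ 0 → A i' j' ≠ 0 → j = j'

theorem IsLiftSystem.exists_lift_matrix (L : IsLiftSystem D D₁ π) {A : Matrix X Y R₁}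
    (hA : ∀ i j, A i j ∈ D₁.elems) : ∃ B : Matrix X Y R, (∀ i j, B i j ∈ D.elems) ∧
      B.map π = A := by
  have := fun i j => L.exists_lift (hA i j)
  choose B hB hπ using this
  exact ⟨B, hB, by ext i j; exact hπ i j⟩

variable [DecidableEq X] [DecidableEq Y]

theorem exists_ne_zero_row_of_pivot {A : Matrix X Y R} {k i : X} {l m : Y}
    (h : pivot A k l i m ≠ 0) (hkl : A k l ≠ 0) : ∃ m, A i m ≠ 0 := by
  by_contra hno
  push Not at hno
  have hi : i ≠ k := fun e => hkl (by rw [← e]; exact hno l)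
  exact h (by rw [pivot_row_of_zero _ hi (hno l), hno])

theorem exists_ne_zero_col_of_pivot {A : Matrix X Y R} {k i : X} {l m : Y}
    (h : pivot A k l i m ≠ 0) (hkl : A k l ≠ 0) : ∃ i, A i m ≠ 0 := by
  by_contra hno
  push Not at hno
  have hm : m ≠ l := fun e => hkl (by rw [← e]; exact hno k)
  exact h (by rw [pivot_col_of_zero _ hm (hno k), hno])

/-- Pivots preserve this support, and the only cross ratio with nonzero denominator is 1. -/
theorem IsLiftSystem.good_of_singleCol (L : IsLiftSystem D D₁ π) {A : Matrix X Y R}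
    (hA : ∀ i j, A i j ∈ D.elems) (h : SingleCol A) : Good D A := by
  refine ⟨{B | (∀ i j, B i j ∈ D.elems) ∧ SingleCol B}, ⟨hA, h⟩, ?_, ?_⟩
  · rintro B ⟨hB, hs⟩
    refine ⟨hB, fun i j u v hiv hju => ?_⟩
    obtain rfl := hs _ _ _ _ hiv hju
    exact ⟨1, L.one_mem, by ring⟩
  · rintro B ⟨hB, hs⟩ k l hkl
    refine ⟨fun i j => ?_, fun i j i' j' h1 h2 => ?_⟩
    · by_cases hj : j = l
      · subst hj
        by_cases hi : i = k
        · subst hi; rw [pivot_same]; exact inverse_mem_elems (hB _ _)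
        · rw [pivot_col _ _ hi]
          exact neg_mem_elems (mul_mem_elems (hB _ _) (inverse_mem_elems (hB _ _)))
      · have h0 : B k j = 0 := by
          by_contra h0
          exact hj (hs _ _ _ _ h0 hkl)
        rw [pivot_col_of_zero _ hj h0]
        exact hB _ _
    · obtain ⟨a, ha⟩ := exists_ne_zero_col_of_pivot h1 hkl
      obtain ⟨b, hb⟩ := exists_ne_zero_col_of_pivot h2 hkl
      exact hs _ _ _ _ ha hb

theorem IsLiftSystem.liftable_of_singleCol (L : IsLiftSystem D D₁ π) {A : Matrix X Y R₁}
    (hA : ∀ i j, A i j ∈ D₁.elems) (h : SingleCol A) : Liftable D π A := by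
  obtain ⟨B, hB, rfl⟩ := L.exists_lift_matrix hA
  refine ⟨B, L.good_of_singleCol hB fun i j i' j' h1 h2 => ?_, rfl⟩
  exact h i j i' j' (L.map_ne_zero (hB _ _) h1) (L.map_ne_zero (hB _ _) h2)

/-- Matrices supported on two rows and two columns. -/
theorem IsLiftSystem.liftable_of_two_by_two [Finite X] (L : IsLiftSystem D D₁ π)
    {A : Matrix X Y R₁} (hA : Good D₁ A) {i k : X} {x y : Y} (hxy : x ≠ y)
    (hsupp : ∀ a l, A a l ≠ 0 → (a = i ∨ a = k) ∧ (l = x ∨ l = y)) : Liftable D π A := by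
  have := Fintype.ofFinite X
  suffices hB : ∃ B : Matrix X Y R, (∀ a l, B a l ∈ D.elems) ∧ B.map π = A ∧
      (B i y ≠ 0 → B k x ≠ 0 → Cross D B i k x y) ∧
      (B k y ≠ 0 → B i x ≠ 0 → Cross D B k i x y) by
    obtain ⟨B, hB, rfl, h1, h2⟩ := hB
    have hs : ∀ a l, B a l ≠ 0 → (a = i ∨ a = k) ∧ (l = x ∨ l = y) := fun a l h =>
      hsupp a l (L.map_ne_zero (hB _ _) h)
    have hdrop : ∀ z w, (∀ l, l = x ∨ l = y → l ≠ z → l = w) → Good D (dropCol B z) := by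
      intro z w hzw
      refine L.good_of_singleCol (fun a l => ?_) ?_
      · by_cases hl : l = z
        · subst hl; rw [dropCol_same]; exact zero_mem_elems
        · rw [dropCol_of_ne _ hl]; exact hB _ _
      · have key : ∀ a l, dropCol B z a l ≠ 0 → l = w := by
          intro a l hal
          have hl : l ≠ z := fun e => hal (by rw [e, dropCol_same])
          rw [dropCol_of_ne _ hl] at hal
          exact hzw l (hs a l hal).2 hl
        exact fun a l a' l' h h' => (key a l h).trans (key a' l' h').symm
    -- No pivot outside x and y is possible, so only the matrix itself has to be checked.
    refine ⟨B, L.good_of_dropCol hA hxy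
      (hdrop x y fun l hl hne => hl.resolve_left hne)
      (hdrop y x fun l hl hne => hl.resolve_right hne) (S := {B}) rfl ?_ ?_, rfl⟩
    · rintro _ rfl a l hlx hly hal
      exact absurd (hs a l hal).2 (by simp [hlx, hly])
    · rintro _ rfl _ _ _ a b hay hbx
      rcases (hs a y hay).1 with rfl | rfl <;> rcases (hs b x hbx).1 with rfl | rfl
      · exact ⟨1, L.one_mem, by ring⟩
      · exact h1 hay hbx
      · exact h2 hay hbx
      · exact ⟨1, L.one_mem, by ring⟩
  obtain ⟨B, hB, rfl⟩ := L.exists_lift_matrix hA.mem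
  by_cases hz : B k y = 0 ∨ B i y = 0 ∨ B k x = 0
  · refine ⟨B, hB, rfl, fun h1 h2 => ?_, fun h1 h2 => ?_⟩
    · rcases hz with hz | hz | hz
      · exact L.cross_of_mul_eq_zero (by rw [hz, mul_zero])
      · exact absurd hz h1
      · exact absurd hz h2
    · rcases hz with hz | hz | hz
      · exact absurd hz h1
      · exact L.cross_of_mul_eq_zero (by rw [hz, mul_zero])
      · exact L.cross_of_mul_eq_zero (by rw [hz, zero_mul])
  push Not at hz
  obtain ⟨hky, hiy, hkx⟩ := hz
  by_cases hik : i = k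
  · subst hik
    exact ⟨B, hB, rfl, fun _ _ => ⟨1, L.one_mem, by ring⟩, fun _ _ => ⟨1, L.one_mem, by ring⟩⟩
  obtain ⟨p, hp, ep⟩ := hA.good2.cross (i := i) (j := k) (u := x) (v := y)
    (L.map_ne_zero (hB i y) hiy) (L.map_ne_zero (hB k x) hkx)
  obtain ⟨h, hh, rfl⟩ := L.surj_H p hp
  simp only [map_apply] at ep
  have hyx : y ≠ x := hxy.symm
  have hki : k ≠ i := Ne.symm hik
  have hinv := mul_inverse (hB k y) hky
  -- One entry of an arbitrary lift is corrected so that the cross ratio becomes the admissible lift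
  -- h of the one downstairs.
  set b := h * (B i y * B k x) * Ring.inverse (B k y) with hb
  have hbm : b ∈ D.elems := mul_mem_elems (mul_mem_elems (L.H_subset hh)
    (mul_mem_elems (hB _ _) (hB _ _))) (inverse_mem_elems (hB _ _))
  have hbk : b * B k y = h * (B i y * B k x) := by
    rw [hb]
    linear_combination h * (B i y * B k x) * hinv
  let C : Matrix X Y R := fun a l => if a = i ∧ l = x then b else B a l
  have c1 : C i x = b := by simp [C]
  have c2 : C i y = B i y := by simp [C, hyx]
  have c3 : C k x = B k x := by simp [C, hki]
  have c4 : C k y = B k y := by simp [C, hki]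
  have hcross : Cross D C i k x y := ⟨h, hh, by rw [c1, c2, c3, c4, hbk]⟩
  have hC : ∀ a l, C a l ∈ D.elems := fun a l => by
    simp only [C]
    split_ifs
    · exact hbm
    · exact hB a l
  refine ⟨C, hC, ?_, fun _ _ => hcross, fun h1 h2 => L.cross_swap hC h2 h1 hcross⟩
  ext a l
  by_cases hal : a = i ∧ l = x
  · obtain ⟨rfl, rfl⟩ := hal
    rw [map_apply, map_apply, c1]
    apply cancel (L.map_mem (hB k y)) (L.map_ne_zero (hB k y) hky)
    rw [← map_mul, mul_comm, hbk]
    simp only [map_mul]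
    linear_combination -ep
  · rw [map_apply, map_apply]
    simp only [C, if_neg hal]

end SingleCol

section Core

variable {R R₁ : Type*} [CommRing R] [CommRing R₁] {X Y : Type*}
  {D : CrossSystem R} {D₁ : CrossSystem R₁} {π : R →+* R₁}

/-- In a finite graph with a vertex of degree at least three, there is a connected set `S` of
vertices with at least three neighbours, such that no vertex has distance two from `S`. -/
theorem exists_connected_dominating {V : Type*} [Finite V] (r : V → V → Prop)
    {v a b c : V} (hab : a ≠ b) (hac : a ≠ c) (hbc : b ≠ c)
    (ha : a ≠ v) (hb : b ≠ v) (hc : c ≠ v) (hva : r v a) (hvb : r v b) (hvc : r v c) :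
    ∃ S : Set V, v ∈ S ∧
      (∀ χ : V → Prop, (∀ s ∈ S, ∀ t ∈ S, r s t → (χ s ↔ χ t)) → ∀ s ∈ S, χ s ↔ χ v) ∧
      (∃ a b c, a ≠ b ∧ a ≠ c ∧ b ≠ c ∧ a ∉ S ∧ b ∉ S ∧ c ∉ S ∧ (∃ s ∈ S, r s a) ∧
        (∃ s ∈ S, r s b) ∧ ∃ s ∈ S, r s c) ∧
      ∀ u w, (u ∈ S ∨ ∃ s ∈ S, r s u) → r u w → w ∈ S ∨ ∃ s ∈ S, r s w := by
  let Q : Set (Set V) := {S | v ∈ S ∧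
      (∀ χ : V → Prop, (∀ s ∈ S, ∀ t ∈ S, r s t → (χ s ↔ χ t)) → ∀ s ∈ S, χ s ↔ χ v) ∧
      (∃ a b c, a ≠ b ∧ a ≠ c ∧ b ≠ c ∧ a ∉ S ∧ b ∉ S ∧ c ∉ S ∧ (∃ s ∈ S, r s a) ∧
        (∃ s ∈ S, r s b) ∧ ∃ s ∈ S, r s c)}
  have hQ : ({v} : Set V) ∈ Q :=
    ⟨rfl, fun χ _ s hs => by rw [Set.mem_singleton_iff.1 hs],
      a, b, c, hab, hac, hbc, ha, hb, hc, ⟨v, rfl, hva⟩, ⟨v, rfl, hvb⟩, ⟨v, rfl, hvc⟩⟩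
  -- For a maximal S, suppose some w outside S and its neighbours is adjacent to a neighbour u of S.
  -- Adding u to S costs at most the neighbour u and gains w, contradicting maximality.
  obtain ⟨S, hS⟩ := (Set.toFinite Q).exists_maximal ⟨_, hQ⟩
  obtain ⟨⟨hvS, hχ, a, b, c, hab, hac, hbc, ha, hb, hc, ha', hb', hc'⟩, hmax⟩ := hS
  refine ⟨S, hvS, hχ, ⟨a, b, c, hab, hac, hbc, ha, hb, hc, ha', hb', hc'⟩, ?_⟩
  intro u w hu huw
  by_contra hw
  push Not at hw
  obtain ⟨hwS, hwN⟩ := hw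
  have huS : u ∉ S := fun h => hwN u h huw
  obtain ⟨s, hs, hsu⟩ := hu.resolve_left huS
  have hwu : w ≠ u := fun e => hwN s hs (by rw [e]; exact hsu)
  have hout : ∀ t, t ∉ S → t ≠ u → t ∉ insert u S := fun t ht htu h =>
    (Set.mem_insert_iff.1 h).elim htu ht
  have hnb : ∀ t, (∃ s ∈ S, r s t) → ∃ s ∈ insert u S, r s t := fun t ⟨s, hs, h⟩ =>
    ⟨s, Set.mem_insert_of_mem _ hs, h⟩
  have hw' : ∃ s ∈ insert u S, r s w := ⟨u, Set.mem_insert _ _, huw⟩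
  have hwne : ∀ t, (∃ s ∈ S, r s t) → w ≠ t := fun t ⟨s, hs, h⟩ e => hwN s hs (by rw [e]; exact h)
  have hins : insert u S ∈ Q := by
    refine ⟨Set.mem_insert_of_mem _ hvS, fun χ h t ht => ?_, ?_⟩
    · have h1 := hχ χ fun s hs t ht =>
        h s (Set.mem_insert_of_mem _ hs) t (Set.mem_insert_of_mem _ ht)
      rcases Set.mem_insert_iff.1 ht with rfl | ht
      · rw [← h s (Set.mem_insert_of_mem _ hs) t (Set.mem_insert _ _) hsu]
        exact h1 s hs
      · exact h1 t ht
    · by_cases hau : a = u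
      · exact ⟨w, b, c, hwne b hb', hwne c hc', hbc, hout w hwS hwu,
          hout b hb fun e => hab (hau.trans e.symm), hout c hc fun e => hac (hau.trans e.symm),
          hw', hnb b hb', hnb c hc'⟩
      by_cases hbu : b = u
      · exact ⟨a, w, c, (hwne a ha').symm, hac, hwne c hc', hout a ha hau, hout w hwS hwu,
          hout c hc fun e => hbc (hbu.trans e.symm), hnb a ha', hw', hnb c hc'⟩
      by_cases hcu : c = u
      · exact ⟨a, b, w, hab, (hwne a ha').symm, (hwne b hb').symm, hout a ha hau, hout b hb hbu,
          hout w hwS hwu, hnb a ha', hnb b hb', hw'⟩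
      · exact ⟨a, b, c, hab, hac, hbc, hout a ha hau, hout b hb hbu, hout c hc hcu, hnb a ha',
          hnb b hb', hnb c hc'⟩
  exact huS (hmax hins (Set.subset_insert _ _) (Set.mem_insert _ _))

/-- All nonzero rows are in the same component. -/
def ConnectedMatrix (A : Matrix X Y R) : Prop :=
  ∀ U V, Splits Set.univ A U V → ∀ i j, (∃ m, A i m ≠ 0) → (∃ m, A j m ≠ 0) → i ∈ U → j ∈ U

/-- The rows in `SX` and columns in `SY` form a connected part of `A`, and every other nonzero row
or column meets it. -/
structure Core (A : Matrix X Y R) (SX : Set X) (SY : Set Y) : Prop where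
  linked : ∀ (U : Set X) (V : Set Y), (∀ i ∈ SX, ∀ j ∈ SY, A i j ≠ 0 → (i ∈ U ↔ j ∈ V)) →
    ∃ p : Prop, (∀ i ∈ SX, i ∈ U ↔ p) ∧ ∀ j ∈ SY, j ∈ V ↔ p
  rows : ∀ i, (∃ j, A i j ≠ 0) → i ∈ SX ∨ ∃ j ∈ SY, A i j ≠ 0
  cols : ∀ j, (∃ i, A i j ≠ 0) → j ∈ SY ∨ ∃ i ∈ SX, A i j ≠ 0

theorem Core.transpose {A : Matrix X Y R} {SX : Set X} {SY : Set Y} (h : Core A SX SY) :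
    Core Aᵀ SY SX where
  linked V U hUV := by
    obtain ⟨p, h1, h2⟩ := h.linked U V fun i hi j hj hij => (hUV j hj i hi hij).symm
    exact ⟨p, h2, h1⟩
  rows := h.cols
  cols := h.rows

/-- Adjacency in the bipartite graph of a matrix. -/
def BipAdj (A : Matrix X Y R) : X ⊕ Y → X ⊕ Y → Prop
  | .inl i, .inr j => A i j ≠ 0
  | .inr j, .inl i => A i j ≠ 0
  | _, _ => False

theorem BipAdj.ne {A : Matrix X Y R} {u w : X ⊕ Y} (h : BipAdj A u w) : w ≠ u := by
  rintro rfl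
  rcases w with i | j <;> exact h

theorem exists_core [Finite X] [Finite Y] {A : Matrix X Y R} (hA : ConnectedMatrix A)
    {v a b c : X ⊕ Y} (hab : a ≠ b) (hac : a ≠ c) (hbc : b ≠ c) (hva : BipAdj A v a)
    (hvb : BipAdj A v b) (hvc : BipAdj A v c) : ∃ SX SY, Core A SX SY ∧
      ((∃ x y, x ≠ y ∧ x ∉ SY ∧ y ∉ SY ∧ (∃ i, A i x ≠ 0) ∧ ∃ i, A i y ≠ 0) ∨
        ∃ x y, x ≠ y ∧ x ∉ SX ∧ y ∉ SX ∧ (∃ j, A x j ≠ 0) ∧ ∃ j, A y j ≠ 0) := by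
  obtain ⟨S, hvS, hχ, ⟨a', b', c', hab', hac', hbc', ha, hb, hc, ha', hb', hc'⟩, hcl⟩ :=
    exists_connected_dominating (BipAdj A) hab hac hbc hva.ne hvb.ne hvc.ne
      hva hvb hvc
  have hT : ∀ i j, A i j ≠ 0 → ((Sum.inl i ∈ S ∨ ∃ s ∈ S, BipAdj A s (Sum.inl i)) ↔
      (Sum.inr j ∈ S ∨ ∃ s ∈ S, BipAdj A s (Sum.inr j))) := fun i j hij =>
    ⟨fun h => hcl (Sum.inl i) (Sum.inr j) h hij, fun h => hcl (Sum.inr j) (Sum.inl i) h hij⟩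
  have hvT : ∃ i m, A i m ≠ 0 ∧ (Sum.inl i ∈ S ∨ ∃ s ∈ S, BipAdj A s (Sum.inl i)) := by
    rcases v with i | j
    · rcases a with i' | j'
      · exact hva.elim
      · exact ⟨i, j', hva, Or.inl hvS⟩
    · rcases a with i' | j'
      · exact ⟨i', j, hva, Or.inr ⟨_, hvS, hva⟩⟩
      · exact hva.elim
  obtain ⟨i₀, m₀, h₀, hi₀⟩ := hvT
  -- S and its neighbours are closed under adjacency, hence split the matrix and contain every
  -- nonzero row by connectedness.
  have hrows : ∀ i, (∃ j, A i j ≠ 0) → Sum.inl i ∈ S ∨ ∃ s ∈ S, BipAdj A s (Sum.inl i) :=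
    fun i hi => hA {i | Sum.inl i ∈ S ∨ ∃ s ∈ S, BipAdj A s (Sum.inl i)}
      {j | Sum.inr j ∈ S ∨ ∃ s ∈ S, BipAdj A s (Sum.inr j)} (fun i j _ hij => hT i j hij)
      i₀ i ⟨m₀, h₀⟩ hi hi₀
  refine ⟨{i | Sum.inl i ∈ S}, {j | Sum.inr j ∈ S}, ⟨?_, ?_, ?_⟩, ?_⟩
  · intro U V hUV
    have := hχ (Sum.elim (· ∈ U) (· ∈ V)) (by
      rintro (i | j) hs (i' | j') ht hst
      · exact hst.elim
      · exact hUV i hs j' ht hst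
      · exact (hUV i' ht j hs hst).symm
      · exact hst.elim)
    exact ⟨_, fun i hi => this _ hi, fun j hj => this _ hj⟩
  · intro i hi
    refine (hrows i hi).imp id ?_
    rintro ⟨(i' | j), hs, h⟩
    · exact h.elim
    · exact ⟨j, hs, h⟩
  · rintro j ⟨i, hij⟩
    refine ((hT i j hij).1 (hrows i ⟨j, hij⟩)).imp id ?_
    rintro ⟨(i' | j), hs, h⟩
    · exact ⟨i', hs, h⟩
    · exact h.elim
  · have hr : ∀ i, (∃ s ∈ S, BipAdj A s (Sum.inl i)) → ∃ j, A i j ≠ 0 := by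
      rintro i ⟨(i' | j), hs, h⟩
      · exact h.elim
      · exact ⟨j, h⟩
    have hc2 : ∀ j, (∃ s ∈ S, BipAdj A s (Sum.inr j)) → ∃ i, A i j ≠ 0 := by
      rintro j ⟨(i | j'), hs, h⟩
      · exact ⟨i, h⟩
      · exact h.elim
    have kr : ∀ i i', Sum.inl i ≠ (Sum.inl i' : X ⊕ Y) → i ≠ i' := fun i i' h e => h (by rw [e])
    have kc : ∀ j j', Sum.inr j ≠ (Sum.inr j' : X ⊕ Y) → j ≠ j' := fun j j' h e => h (by rw [e])
    -- Of three neighbours of S, two are rows or two are columns.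
    rcases a' with i | j <;> rcases b' with i' | j' <;> rcases c' with i'' | j''
    · exact Or.inr ⟨i, i', kr _ _ hab', ha, hb, hr _ ha', hr _ hb'⟩
    · exact Or.inr ⟨i, i', kr _ _ hab', ha, hb, hr _ ha', hr _ hb'⟩
    · exact Or.inr ⟨i, i'', kr _ _ hac', ha, hc, hr _ ha', hr _ hc'⟩
    · exact Or.inl ⟨j', j'', kc _ _ hbc', hb, hc, hc2 _ hb', hc2 _ hc'⟩
    · exact Or.inr ⟨i', i'', kr _ _ hbc', hb, hc, hr _ hb', hr _ hc'⟩
    · exact Or.inl ⟨j, j'', kc _ _ hac', ha, hc, hc2 _ ha', hc2 _ hc'⟩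
    · exact Or.inl ⟨j, j', kc _ _ hab', ha, hb, hc2 _ ha', hc2 _ hb'⟩
    · exact Or.inl ⟨j, j', kc _ _ hab', ha, hb, hc2 _ ha', hc2 _ hb'⟩

variable [DecidableEq X] [DecidableEq Y] [Finite X] [Finite Y]

/-- The core avoids x and y and meets every nonzero row, so all nonzero rows are linked by the other
columns. Pivots in those columns preserve this. -/
theorem Core.liftable (L : IsLiftSystem D D₁ π) {A : Matrix X Y R₁} (hA : Good D₁ A) {SX : Set X}
    {SY : Set Y} (h : Core A SX SY) {x y : Y} (hxy : x ≠ y) (hx : x ∉ SY) (hy : y ∉ SY)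
    (hdx : Liftable D π (dropCol A x)) (hdy : Liftable D π (dropCol A y)) : Liftable D π A := by
  refine L.liftable_of_dropCol hA hxy hdx hdy (S := {B | ∀ i j, (∃ m, B i m ≠ 0) →
    (∃ m, B j m ≠ 0) → Linked {l | l ≠ x ∧ l ≠ y} B i j}) ?_ ?_ ?_
  · intro i j hi hj U V hUV hiU
    have hW : ∀ j ∈ SY, j ∈ ({l | l ≠ x ∧ l ≠ y} : Set Y) := fun j hj =>
      ⟨fun e => hx (by rw [← e]; exact hj), fun e => hy (by rw [← e]; exact hj)⟩
    obtain ⟨p, h1, h2⟩ := h.linked U V fun i _ j hj hij => hUV i j (hW j hj) hij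
    have key : ∀ i, (∃ m, A i m ≠ 0) → (i ∈ U ↔ p) := by
      intro i hi
      rcases h.rows i hi with hi | ⟨j, hj, hij⟩
      · exact h1 i hi
      · rw [hUV i j (hW j hj) hij]
        exact h2 j hj
    exact (key j hj).2 ((key i hi).1 hiU)
  · intro B hB k l hlx hly hkl i j ⟨m, hi⟩ ⟨m', hj⟩ U V hUV
    have hkl0 : B k l ≠ 0 := fun h0 => L.nontrivial (by rw [← hkl, h0, zero_mul])
    exact hB i j (exists_ne_zero_row_of_pivot hi hkl0) (exists_ne_zero_row_of_pivot hj hkl0) U V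
      ((splits_pivot_iff (W := {l | l ≠ x ∧ l ≠ y}) (show l ∈ {l | l ≠ x ∧ l ≠ y} from ⟨hlx, hly⟩)
        hkl L.nontrivial).1 hUV)
  · intro B hB i j hix _ hjx _
    exact hB i j ⟨x, hix⟩ ⟨x, hjx⟩

/-- With x and y taken from different blocks, no row is nonzero in both, and the linking condition
for gluing is vacuous. -/
theorem liftable_of_not_connected (L : IsLiftSystem D D₁ π) {A : Matrix X Y R₁} (hA : Good D₁ A)
    (hc : ¬ ConnectedMatrix A)
    (hd : ∀ x, (∃ i, A i x ≠ 0) → Liftable D π (dropCol A x)) : Liftable D π A := by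
  unfold ConnectedMatrix at hc
  push Not at hc
  obtain ⟨U, V, hUV, i, j, ⟨x, hix⟩, ⟨y, hjy⟩, hi, hj⟩ := hc
  have hx : x ∈ V := (hUV i x (Set.mem_univ _) hix).1 hi
  have hy : y ∉ V := fun h => hj ((hUV j y (Set.mem_univ _) hjy).2 h)
  refine L.liftable_of_dropCol hA (fun e => hy (by rw [← e]; exact hx)) (hd x ⟨i, hix⟩)
    (hd y ⟨j, hjy⟩) (S := {B | Splits Set.univ B U V}) hUV ?_ ?_
  · intro B hB k l _ _ hkl
    exact hB.of_pivot (Set.mem_univ _) hkl L.nontrivial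
  · intro B hB a b hax hay
    exact absurd ((hB a y (Set.mem_univ _) hay).1 ((hB a x (Set.mem_univ _) hax).2 hx)) hy

end Core

end MatrixLift

/-! ### Branch vertices, and the induction for the lift theorem. -/

namespace MatrixLift

open Matrix

section Branch

variable {R R₁ : Type*} [CommRing R] [CommRing R₁] {X Y : Type*}
  {D : CrossSystem R} {D₁ : CrossSystem R₁} {π : R →+* R₁}

/-- The number of nonzero rows and columns. -/
noncomputable def nonzeroLines (A : Matrix X Y R) : ℕ :=
  Set.ncard {i | ∃ j, A i j ≠ 0} + Set.ncard {j | ∃ i, A i j ≠ 0}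

theorem nonzeroLines_transpose (A : Matrix X Y R) : nonzeroLines Aᵀ = nonzeroLines A :=
  add_comm _ _

/-- Some row or column has three nonzero entries. -/
def HasBranch (A : Matrix X Y R) : Prop :=
  ∃ v a b c, a ≠ b ∧ a ≠ c ∧ b ≠ c ∧ BipAdj A v a ∧ BipAdj A v b ∧ BipAdj A v c

theorem hasBranch_of_row {A : Matrix X Y R} {k : X} {x y z : Y} (hxy : x ≠ y) (hxz : x ≠ z)
    (hyz : y ≠ z) (hx : A k x ≠ 0) (hy : A k y ≠ 0) (hz : A k z ≠ 0) : HasBranch A :=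
  ⟨.inl k, .inr x, .inr y, .inr z, by simpa, by simpa, by simpa, hx, hy, hz⟩

theorem hasBranch_of_col {A : Matrix X Y R} {x : Y} {i j k : X} (hij : i ≠ j) (hik : i ≠ k)
    (hjk : j ≠ k) (hi : A i x ≠ 0) (hj : A j x ≠ 0) (hk : A k x ≠ 0) : HasBranch A :=
  ⟨.inr x, .inl i, .inl j, .inl k, by simpa, by simpa, by simpa, hi, hj, hk⟩

theorem nonzeroLines_dropCol_lt [Finite X] [Finite Y] [DecidableEq Y] {A : Matrix X Y R} {x : Y}
    (hx : ∃ i, A i x ≠ 0) : nonzeroLines (dropCol A x) < nonzeroLines A := by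
  have key : ∀ i j, dropCol A x i j ≠ 0 → j ≠ x ∧ A i j ≠ 0 := by
    intro i j h
    have hj : j ≠ x := fun e => h (by rw [e, dropCol_same])
    exact ⟨hj, by rwa [dropCol_of_ne _ hj] at h⟩
  refine add_lt_add_of_le_of_lt
    (Set.ncard_le_ncard (fun i ⟨j, h⟩ => ⟨j, (key i j h).2⟩) (Set.toFinite _))
    (Set.ncard_lt_ncard ⟨fun j ⟨i, h⟩ => ⟨i, (key i j h).2⟩, fun h => ?_⟩ (Set.toFinite _))
  obtain ⟨i, hi⟩ := h hx
  exact (key i x hi).1 rfl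

variable [DecidableEq X] [DecidableEq Y]

theorem ConnectedMatrix.pivot {A : Matrix X Y R} (h : ConnectedMatrix A) {k : X} {l : Y}
    (hkl : A k l * Ring.inverse (A k l) = 1) (h1 : (1 : R) ≠ 0) :
    ConnectedMatrix (pivot A k l) := by
  rintro U V hUV i j ⟨m, hi⟩ ⟨m', hj⟩
  have hkl0 : A k l ≠ 0 := fun h0 => h1 (by rw [← hkl, h0, zero_mul])
  exact h U V ((splits_pivot_iff (Set.mem_univ _) hkl h1).1 hUV) i j
    (exists_ne_zero_row_of_pivot hi hkl0) (exists_ne_zero_row_of_pivot hj hkl0)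

theorem nonzeroLines_pivot_le [Finite X] [Finite Y] {A : Matrix X Y R} {k : X} {l : Y}
    (hkl : A k l ≠ 0) : nonzeroLines (pivot A k l) ≤ nonzeroLines A :=
  add_le_add
    (Set.ncard_le_ncard (fun _ ⟨_, h⟩ => exists_ne_zero_row_of_pivot h hkl) (Set.toFinite _))
    (Set.ncard_le_ncard (fun _ ⟨_, h⟩ => exists_ne_zero_col_of_pivot h hkl) (Set.toFinite _))

/-- A connected matrix without three nonzero entries in one line, even after a pivot, is supported
on two rows and two columns. -/
theorem exists_two_by_two {A : Matrix X Y R} (hA : ∀ i j, A i j ∈ D.elems)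
    (hc : ConnectedMatrix A) (hs : ¬ SingleCol A) (hst : ¬ SingleCol Aᵀ) (hb : ¬ HasBranch A)
    (hbp : ∀ k l, A k l ≠ 0 → ¬ HasBranch (pivot A k l)) :
    ∃ i k x y, x ≠ y ∧ ∀ a l, A a l ≠ 0 → (a = i ∨ a = k) ∧ (l = x ∨ l = y) := by
  have hrow : ∀ {k x y}, x ≠ y → A k x ≠ 0 → A k y ≠ 0 → ∀ z, A k z ≠ 0 → z = x ∨ z = y := by
    intro k x y hxy hx hy z hz
    by_contra h
    push Not at h
    exact hb (hasBranch_of_row hxy h.1.symm h.2.symm hx hy hz)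
  have hcol : ∀ {x i j}, i ≠ j → A i x ≠ 0 → A j x ≠ 0 → ∀ k, A k x ≠ 0 → k = i ∨ k = j := by
    intro x i j hij hi hj k hk
    by_contra h
    push Not at h
    exact hb (hasBranch_of_col hij h.1.symm h.2.symm hi hj hk)
  have h1 : ∃ k x y, x ≠ y ∧ A k x ≠ 0 ∧ A k y ≠ 0 := by
    by_contra hno
    push Not at hno
    apply hs
    intro i j i' j' hij hij'
    by_contra hne
    -- If no row had two nonzero entries, each column would split off with the rows meeting it.
    refine hij' (hno i' j j' hne (hc {a | A a j ≠ 0} {j} (fun a l _ hal => ?_) i i' ⟨j, hij⟩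
      ⟨j', hij'⟩ hij))
    refine ⟨fun h => ?_, fun h => ?_⟩
    · by_contra hl
      exact h (hno a l j hl hal)
    · rw [Set.mem_singleton_iff.1 h] at hal
      exact hal
  have h2 : ∃ i k x y, x ≠ y ∧ i ≠ k ∧ A k x ≠ 0 ∧ A k y ≠ 0 ∧ A i x ≠ 0 := by
    obtain ⟨k, x, y, hxy, hx, hy⟩ := h1
    by_contra hno
    push Not at hno
    apply hst
    have hkey : ∀ a l, A a l ≠ 0 → a = k := fun a l hal => by
      refine hc {k} {x, y} (fun a l _ hal => ?_) k a ⟨x, hx⟩ ⟨l, hal⟩ rfl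
      refine ⟨fun h => ?_, fun h => ?_⟩
      · rw [Set.mem_singleton_iff.1 h] at hal
        exact hrow hxy hx hy l hal
      · by_contra ha
        rcases h with rfl | rfl
        · exact hal (hno a k _ y hxy ha hx hy)
        · exact hal (hno a k _ x hxy.symm ha hy hx)
    exact fun l a l' a' h h' => (hkey a l h).trans (hkey a' l' h').symm
  obtain ⟨i, k, x, y, hxy, hik, hkx, hky, hix⟩ := h2
  refine ⟨i, k, x, y, hxy, ?_⟩
  suffices hsp : Splits Set.univ A {i, k} {x, y} by
    intro a l hal
    have ha : a ∈ ({i, k} : Set X) := hc _ _ hsp i a ⟨x, hix⟩ ⟨l, hal⟩ (Or.inl rfl)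
    exact ⟨ha, (hsp a l (Set.mem_univ _) hal).1 ha⟩
  -- The path i, x, k, y is either closed up by the entry (i, y) to a four-cycle, which is a whole
  -- component as all degrees are at most two, or it is open. An open path cannot be continued at
  -- either end: a suitable pivot would then fill an entry and create a vertex of degree three.
  by_cases hiy : A i y = 0
  · have hjy : ∀ j, A j y ≠ 0 → j = k := by
      intro j hj
      by_contra hjk
      have hji : j ≠ i := fun e => hj (by rw [e, hiy])
      have hjx : A j x = 0 := by
        by_contra h
        exact (hcol hik hix hkx j h).elim hji hjk
      refine hbp k x hkx (hasBranch_of_col (x := y) (i := k) (j := i) (k := j) hik.symm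
        (Ne.symm hjk) hji.symm ?_ ?_ ?_)
      · rw [pivot_row _ _ hxy.symm]
        exact mul_ne (inverse_mem_elems (hA _ _)) (inverse_ne (hA _ _) hkx) hky
      · rw [pivot_other _ hik hxy.symm, hiy, zero_sub, neg_ne_zero]
        exact mul_ne (mul_mem_elems (hA _ _) (inverse_mem_elems (hA _ _)))
          (mul_ne (hA _ _) hix (inverse_ne (hA _ _) hkx)) hky
      · rwa [pivot_row_of_zero _ hjk hjx]
    have hiz : ∀ z, A i z ≠ 0 → z = x := by
      intro z hz
      by_contra hzx
      have hzy : z ≠ y := fun e => hz (by rw [e, hiy])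
      have hkz : A k z = 0 := by
        by_contra h
        exact (hrow hxy hkx hky z h).elim hzx hzy
      refine hbp i x hix (hasBranch_of_row (k := k) (x := x) (y := y) (z := z) hxy
        (Ne.symm hzx) hzy.symm ?_ ?_ ?_)
      · rw [pivot_col _ _ hik.symm, neg_ne_zero]
        exact mul_ne (hA _ _) hkx (inverse_ne (hA _ _) hix)
      · rwa [pivot_col_of_zero _ hxy.symm hiy]
      · rw [pivot_other _ hik.symm hzx, hkz, zero_sub, neg_ne_zero]
        exact mul_ne (mul_mem_elems (hA _ _) (inverse_mem_elems (hA _ _)))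
          (mul_ne (hA _ _) hkx (inverse_ne (hA _ _) hix)) hz
    intro a l _ hal
    constructor
    · rintro (rfl | rfl)
      · exact Or.inl (hiz l hal)
      · exact hrow hxy hkx hky l hal
    · rintro (rfl | rfl)
      · exact hcol hik hix hkx a hal
      · exact Or.inr (hjy a hal)
  · intro a l _ hal
    constructor
    · rintro (rfl | rfl)
      · exact hrow hxy hix hiy l hal
      · exact hrow hxy hkx hky l hal
    · rintro (rfl | rfl)
      · exact hcol hik hix hkx a hal
      · exact hcol hik hiy hky a hal

end Branch

section Main

variable {R R₁ : Type*} [CommRing R] [CommRing R₁] {X Y : Type*} [Finite X] [Finite Y]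
  [DecidableEq X] [DecidableEq Y] {D : CrossSystem R} {D₁ : CrossSystem R₁} {π : R →+* R₁}

theorem liftable_of_hasBranch (L : IsLiftSystem D D₁ π) {A : Matrix X Y R₁} (hA : Good D₁ A)
    (hc : ConnectedMatrix A) (hb : HasBranch A)
    (ih : ∀ B : Matrix X Y R₁, Good D₁ B → nonzeroLines B < nonzeroLines A → Liftable D π B) :
    Liftable D π A := by
  obtain ⟨v, a, b, c, hab, hac, hbc, hva, hvb, hvc⟩ := hb
  obtain ⟨SX, SY, h, ⟨x, y, hxy, hx, hy, hx0, hy0⟩ | ⟨x, y, hxy, hx, hy, hx0, hy0⟩⟩ :=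
    exists_core hc hab hac hbc hva hvb hvc
  · exact h.liftable L hA hxy hx hy (ih _ (hA.dropCol x) (nonzeroLines_dropCol_lt hx0))
      (ih _ (hA.dropCol y) (nonzeroLines_dropCol_lt hy0))
  · have key : ∀ x, (∃ j, A x j ≠ 0) → Liftable D π (dropCol Aᵀ x) := fun x hx => by
      refine Liftable.transpose (A := (dropCol Aᵀ x)ᵀ) (ih _ (hA.transpose.dropCol x).transpose ?_)
      rw [nonzeroLines_transpose, ← nonzeroLines_transpose A]
      exact nonzeroLines_dropCol_lt hx
    exact (h.transpose.liftable L hA.transpose hxy hx hy (key x hx0) (key y hy0)).transpose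

/-- **Lift theorem**: every good matrix has a good lift. -/
theorem IsLiftSystem.liftable (L : IsLiftSystem D D₁ π) {A : Matrix X Y R₁} (hA : Good D₁ A) :
    Liftable D π A := by
  induction hn : nonzeroLines A using Nat.strong_induction_on generalizing A with
  | _ n ih =>
  subst hn
  have ih' : ∀ B : Matrix X Y R₁, Good D₁ B → nonzeroLines B < nonzeroLines A →
      Liftable D π B := fun B hB h => ih _ h hB rfl
  by_cases hc : ConnectedMatrix A
  swap
  · exact liftable_of_not_connected L hA hc fun x hx =>
      ih' _ (hA.dropCol x) (nonzeroLines_dropCol_lt hx)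
  by_cases hs : SingleCol A
  · exact L.liftable_of_singleCol hA.mem hs
  by_cases hst : SingleCol Aᵀ
  · exact (L.liftable_of_singleCol hA.transpose.mem hst).transpose
  by_cases hb : HasBranch A
  · exact liftable_of_hasBranch L hA hc hb ih'
  by_cases hbp : ∀ k l, A k l ≠ 0 → ¬ HasBranch (pivot A k l)
  · obtain ⟨i, k, x, y, hxy, hsupp⟩ := exists_two_by_two hA.mem hc hs hst hb hbp
    exact L.liftable_of_two_by_two hA hxy hsupp
  · push Not at hbp
    obtain ⟨k, l, hkl, hbp⟩ := hbp
    exact Liftable.of_pivot L (hA.mem k l) hkl (liftable_of_hasBranch L (hA.pivot hkl)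
      (hc.pivot (mul_inverse (hA.mem k l) hkl) L.nontrivial) hbp fun B hB h =>
        ih' B hB (h.trans_le (nonzeroLines_pivot_le hkl)))

end Main

end MatrixLift

/-! ### The lift system of a lifting function. -/

namespace MatrixLift

open Matrix PartialField

section Concrete

variable {P Q : Type*} [PartialField P] [PartialField Q]

theorem mem_fundamentals {p : P} :
    p ∈ fundamentals P ↔ ∃ q : P, (iota p + iota q : UnivRing P) = 1 := by
  refine exists_congr fun q => ?_
  rw [padd_iff, iota_neg, map_one]
  constructor <;> intro h <;> linear_combination -h

theorem iota_eq_zero {p : P} : (iota p : UnivRing P) = 0 ↔ p = 0 :=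
  ⟨fun h => iota_injective (by rw [h, map_zero]), fun h => by rw [h, map_zero]⟩

theorem iota_mul_inv {p : P} (hp : p ≠ 0) : (iota p * iota p⁻¹ : UnivRing P) = 1 := by
  rw [← map_mul, mul_inv_cancel₀ hp, map_one]

theorem inv_mem_fundamentals {p : P} (hp : p ∈ fundamentals P) (h0 : p ≠ 0) :
    p⁻¹ ∈ fundamentals P := by
  obtain ⟨q, hq⟩ := mem_fundamentals.1 hp
  refine mem_fundamentals.2 ⟨-(q * p⁻¹), ?_⟩
  rw [iota_neg, map_mul]
  linear_combination -(iota p⁻¹ : UnivRing P) * hq + iota_mul_inv h0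

theorem zero_mem_fundamentals : (0 : P) ∈ fundamentals P :=
  mem_fundamentals.2 ⟨1, by simp⟩

theorem one_mem_fundamentals : (1 : P) ∈ fundamentals P :=
  mem_fundamentals.2 ⟨0, by simp⟩

theorem exists_one_sub {p : P} (hp : p ∈ fundamentals P) :
    ∃ q ∈ fundamentals P, (iota p + iota q : UnivRing P) = 1 := by
  obtain ⟨q, hq⟩ := mem_fundamentals.1 hp
  exact ⟨q, mem_fundamentals.2 ⟨p, by rw [add_comm, hq]⟩, hq⟩

/-- The partial addition of `P` on the fundamental elements is reflected by `u : P → Q`, as far as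
it is needed to lift matrices. -/
structure IsCrossLift (u : P → Q) : Prop where
  one_sub : ∀ p ∈ fundamentals P, ∀ q ∈ fundamentals P, padd p q = some 1 →
    padd (u p) (u q) = some 1
  inv : ∀ p ∈ fundamentals P, ∀ q ∈ fundamentals P, p * q = 1 → u p * u q = 1
  triple : ∀ p ∈ fundamentals P, ∀ q ∈ fundamentals P, ∀ r ∈ fundamentals P, p * q * r = 1 →
    u p * u q * u r = 1
  two_zero : padd (1 : P) 1 = some 0 → padd (1 : Q) 1 = some 0

namespace IsCrossLift

variable {u : P → Q}


theorem iota_one_sub (h : IsCrossLift u) {p q : P} (hp : p ∈ fundamentals P) (hq : q ∈ fundamentals P)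
    (e : (iota p + iota q : UnivRing P) = 1) : (iota (u p) + iota (u q) : UnivRing Q) = 1 := by
  rw [← map_one iota] at e
  have := padd_iff.1 (h.one_sub p hp q hq (padd_iff.2 e))
  rwa [map_one] at this

/-- The square and the cube of this value are both 1. -/
theorem map_one (h : IsCrossLift u) : u 1 = 1 := by
  have h1 := h.inv 1 one_mem_fundamentals 1 one_mem_fundamentals (one_mul 1)
  have h2 := h.triple 1 one_mem_fundamentals 1 one_mem_fundamentals 1 one_mem_fundamentals
    (by simp)
  rwa [h1, one_mul] at h2

theorem map_zero (h : IsCrossLift u) : u 0 = 0 := by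
  have h1 := h.iota_one_sub zero_mem_fundamentals one_mem_fundamentals (by simp)
  rw [h.map_one] at h1
  exact iota_eq_zero.1 (by simpa using h1)

theorem ne_zero (h : IsCrossLift u) {p : P} (hp : p ∈ fundamentals P) (h0 : p ≠ 0) : u p ≠ 0 := by
  have := h.inv p hp p⁻¹ (inv_mem_fundamentals hp h0) (mul_inv_cancel₀ h0)
  exact left_ne_zero_of_mul_eq_one this

/-- The triple condition for p, q and the inverse of pq is compared with the inverse condition for
pq. -/
theorem map_mul (h : IsCrossLift u) {p q : P} (hp : p ∈ fundamentals P) (hq : q ∈ fundamentals P)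
    (hpq : p * q ∈ fundamentals P) : u (p * q) = u p * u q := by
  by_cases h0 : p * q = 0
  · rw [h0, h.map_zero]
    rcases mul_eq_zero.1 h0 with rfl | rfl <;> simp [h.map_zero]
  · have hr := inv_mem_fundamentals hpq h0
    have h1 := h.inv _ hpq _ hr (mul_inv_cancel₀ h0)
    have h2 := h.triple _ hp _ hq _ hr (mul_inv_cancel₀ h0)
    exact mul_right_cancel₀ (right_ne_zero_of_mul_eq_one h1) (h1.trans h2.symm)

theorem map_neg (h : IsCrossLift u) {p : P} (hp : p ∈ fundamentals P) (hn : -p ∈ fundamentals P) :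
    u (-p) = -u p := by
  have hsq : -p * -p = p * p := by rw [mul_neg_eq, mul_comm, mul_neg_eq, neg_neg_eq]
  apply iota_injective
  rw [iota_neg]
  obtain ⟨q', hq', e'⟩ := exists_one_sub hn
  have u' := h.iota_one_sub hn hq' e'
  rw [iota_neg] at e'
  -- For p = 1 the factor 1 - p cannot be cancelled. If 1 + 1 = 0, the claim is `two_zero`.
  -- Otherwise u(-1)² = 1 and 1 - u(-1) = u(q') is invertible, which forces u(-1) = -1.
  by_cases hp1 : p = 1
  · subst hp1
    rw [h.map_one]
    rw [_root_.map_one] at e' ⊢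
    by_cases hq0 : q' = 0
    · rw [hq0, _root_.map_zero] at e'
      have h1 : padd (1 : P) 1 = some 0 :=
        padd_iff.2 (by rw [_root_.map_one, _root_.map_zero]; linear_combination -e')
      have h2 := padd_iff.1 (h.two_zero h1)
      rw [_root_.map_one, _root_.map_zero] at h2
      rw [← neg_unique _ _ h1, h.map_one, _root_.map_one]
      linear_combination h2
    · have h1 := h.inv _ hn _ hn (by rw [hsq, mul_one])
      have h2 : (iota (u (-1)) * iota (u (-1)) : UnivRing Q) = 1 := by
        rw [← _root_.map_mul, h1, _root_.map_one]
      have h3 := iota_mul_inv (h.ne_zero hq' hq0)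
      linear_combination (iota (u (-1)) + 1) * (-h3 + (iota (u q')⁻¹) * u') -
        (iota (u q')⁻¹) * h2
  · obtain ⟨q, hq, e⟩ := exists_one_sub hp
    have hu := h.iota_one_sub hp hq e
    have hq0 : q ≠ 0 := by
      rintro rfl
      exact hp1 (iota_injective (by simpa using e))
    -- Here q = 1 - p and q' = 1 + p. The identity shows that p² and qq' are fundamental, so it can
    -- be transported by u.
    have e2 : (iota (p * p) + iota (q * q') : UnivRing P) = 1 := by
      rw [_root_.map_mul, _root_.map_mul]
      linear_combination iota q' * e + e' - iota p * e'
    have hpp : p * p ∈ fundamentals P := mem_fundamentals.2 ⟨_, e2⟩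
    have hqq : q * q' ∈ fundamentals P := mem_fundamentals.2 ⟨p * p, by rw [add_comm, e2]⟩
    have u2 := h.iota_one_sub hpp hqq e2
    rw [h.map_mul hp hp hpp, h.map_mul hq hq' hqq, _root_.map_mul, _root_.map_mul] at u2
    have h3 := iota_mul_inv (h.ne_zero hq hq0)
    have key : (iota (u q) : UnivRing Q) * (iota (u (-p)) + iota (u p)) = 0 := by
      linear_combination -u2 + iota (u q) * u' + (1 + iota (u p)) * hu
    linear_combination (iota (u q)⁻¹) * key - (iota (u (-p)) + iota (u p)) * h3

end IsCrossLift

variable (P) in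
/-- The group `P \ {0}` and the fundamental elements, inside the universal ring. -/
noncomputable def ringSystem : CrossSystem (UnivRing P) where
  G := (Units.map (iota : P →*₀ UnivRing P).toMonoidHom).range
  H := {x | ∃ p ∈ fundamentals P, iota p = x}
  neg_one_mem := by
    have h : (-1 : P) ≠ 0 := fun h => by
      have := iota_neg (1 : P)
      rw [h] at this
      simp at this
    refine ⟨Units.mk0 (-1) h, Units.ext ?_⟩
    exact (iota_neg (1 : P)).trans (by simp)

theorem mem_ringSystem_elems {x : UnivRing P} : x ∈ (ringSystem P).elems ↔ ∃ p, iota p = x := by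
  constructor
  · rintro (rfl | ⟨_, ⟨p, rfl⟩, rfl⟩)
    · exact ⟨0, map_zero _⟩
    · exact ⟨p, rfl⟩
  · rintro ⟨p, rfl⟩
    by_cases h : p = 0
    · exact Or.inl (by rw [h, map_zero])
    · exact Or.inr ⟨_, ⟨Units.mk0 p h, rfl⟩, rfl⟩

/-- The pairs of nonzero elements, and the graph of `u`, inside the product of the universal
rings. -/
noncomputable def pairSystem (u : P → Q) : CrossSystem (UnivRing P × UnivRing Q) where
  G := (ringSystem P).G.comap (Units.map (RingHom.fst (UnivRing P) (UnivRing Q)).toMonoidHom) ⊓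
    (ringSystem Q).G.comap (Units.map (RingHom.snd (UnivRing P) (UnivRing Q)).toMonoidHom)
  H := {x | ∃ p ∈ fundamentals P, ((iota p, iota (u p)) : UnivRing P × UnivRing Q) = x}
  neg_one_mem := by
    have h1 : Units.map (RingHom.fst (UnivRing P) (UnivRing Q)).toMonoidHom (-1) = -1 :=
      Units.ext (by simp)
    have h2 : Units.map (RingHom.snd (UnivRing P) (UnivRing Q)).toMonoidHom (-1) = -1 :=
      Units.ext (by simp)
    rw [Subgroup.mem_inf, Subgroup.mem_comap, Subgroup.mem_comap, h1, h2]
    exact ⟨(ringSystem P).neg_one_mem, (ringSystem Q).neg_one_mem⟩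

theorem pair_mem_elems {u : P → Q} {p : P} {q : Q} (hp : p ≠ 0) (hq : q ≠ 0) :
    ((iota p, iota q) : UnivRing P × UnivRing Q) ∈ (pairSystem u).elems := by
  refine Or.inr ⟨⟨(iota p, iota q), (iota p⁻¹, iota q⁻¹), ?_, ?_⟩, ⟨⟨Units.mk0 p hp, ?_⟩,
    ⟨Units.mk0 q hq, ?_⟩⟩, rfl⟩
  · rw [Prod.mk_mul_mk, iota_mul_inv hp, iota_mul_inv hq]; rfl
  · rw [Prod.mk_mul_mk, mul_comm, iota_mul_inv hp, mul_comm, iota_mul_inv hq]; rfl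
  · exact Units.ext rfl
  · exact Units.ext rfl

/-- Members of G have both coordinates nonzero; this transfers the vanishing of minors between P and
Q. -/
theorem exists_of_mem_pairSystem {u : P → Q} {x : UnivRing P × UnivRing Q}
    (hx : x ∈ (pairSystem u).elems) : ∃ q : Q, iota q = x.2 ∧ (q = 0 ↔ x = 0) := by
  rcases hx with rfl | ⟨g, ⟨-, ⟨q, hq⟩⟩, rfl⟩
  · exact ⟨0, map_zero _, by simp⟩
  · exact ⟨q, congrArg Units.val hq, by simp⟩

theorem isLiftSystem {u : P → Q} (h : IsCrossLift u) :
    IsLiftSystem (pairSystem u) (ringSystem P) (RingHom.fst (UnivRing P) (UnivRing Q)) where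
  nontrivial := one_ne_zero
  map_G g hg := hg.1
  surj_G := by
    rintro _ ⟨p, rfl⟩
    -- Units carry no constraint between the coordinates, so the second one may be 1.
    rcases pair_mem_elems (u := u) p.ne_zero (one_ne_zero (α := Q)) with h0 | ⟨g, hg, e⟩
    · exact absurd (iota_eq_zero.1 (congrArg Prod.fst h0)) p.ne_zero
    · exact ⟨g, hg, Units.ext (congrArg Prod.fst e)⟩
  H_subset := by
    rintro _ ⟨p, hp, rfl⟩
    by_cases h0 : p = 0
    · subst h0
      rw [h.map_zero]
      exact Or.inl (by simp)
    · exact pair_mem_elems h0 (h.ne_zero hp h0)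
  map_H := by
    rintro _ ⟨p, hp, rfl⟩
    exact ⟨p, hp, rfl⟩
  zero_mem := ⟨0, zero_mem_fundamentals, by rw [h.map_zero]; simp⟩
  one_mem := ⟨1, one_mem_fundamentals, by rw [h.map_one]; simp⟩
  one_sub_mem := by
    rintro _ ⟨p, hp, rfl⟩
    obtain ⟨q, hq, e⟩ := exists_one_sub hp
    have e' := h.iota_one_sub hp hq e
    refine ⟨q, hq, Prod.ext ?_ ?_⟩
    · exact eq_sub_of_add_eq' e
    · exact eq_sub_of_add_eq' e'
  inverse_mem := by
    rintro _ ⟨p, hp, rfl⟩ h0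
    have hp0 : p ≠ 0 := fun e => h0 (by rw [e, h.map_zero]; simp)
    refine ⟨p⁻¹, inv_mem_fundamentals hp hp0, eq_inverse ?_⟩
    rw [Prod.mk_mul_mk, iota_mul_inv hp0, ← map_mul,
      h.inv _ hp _ (inv_mem_fundamentals hp hp0) (mul_inv_cancel₀ hp0), map_one]
    rfl
  mul_mem := by
    rintro _ ⟨p, hp, rfl⟩ _ ⟨q, hq, rfl⟩ ⟨r, hr, e⟩
    have : r = p * q := iota_injective (by rw [map_mul]; exact e)
    subst this
    exact ⟨_, hr, by rw [h.map_mul hp hq hr, map_mul, map_mul]; rfl⟩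
  neg_mem := by
    rintro _ ⟨p, hp, rfl⟩ ⟨r, hr, e⟩
    have : r = -p := iota_injective (by rw [iota_neg]; exact e)
    subst this
    exact ⟨_, hr, by rw [h.map_neg hp hr, iota_neg, iota_neg]; rfl⟩
  inj := by
    rintro _ ⟨p, hp, rfl⟩ _ ⟨q, hq, rfl⟩ e
    obtain rfl : p = q := iota_injective e
    rfl
  surj_H := by
    rintro _ ⟨p, hp, rfl⟩
    exact ⟨_, ⟨p, hp, rfl⟩, rfl⟩

end Concrete

end MatrixLift

/-! ### Minors, goodness and representability. -/

namespace MatrixLift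

open Matrix PartialField

section Dets

variable {P : Type*} [PartialField P] {X Y : Type*} [DecidableEq X]

/-- An entry after a pivot on (i, v) is a nonzero multiple of 1 minus the cross ratio; if it comes
from P, the cross ratio is fundamental. -/
theorem good2_of_pivot_mem [DecidableEq Y] {A : Matrix X Y (UnivRing P)}
    (hA : ∀ i j, A i j ∈ (ringSystem P).elems)
    (hp : ∀ k l, A k l ≠ 0 → ∀ i j, pivot A k l i j ∈ (ringSystem P).elems) :
    Good2 (ringSystem P) A := by
  refine ⟨hA, fun i j u v hiv hju => ?_⟩
  have h1 : (1 : UnivRing P) ∈ (ringSystem P).H := ⟨1, one_mem_fundamentals, map_one _⟩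
  by_cases hij : i = j
  · exact ⟨1, h1, by subst hij; ring⟩
  by_cases huv : u = v
  · exact ⟨1, h1, by subst huv; ring⟩
  have h2 := hp i v hiv j u
  rw [pivot_other _ (Ne.symm hij) huv] at h2
  obtain ⟨t, ht⟩ := mem_ringSystem_elems.1 h2
  obtain ⟨a, ha⟩ := mem_ringSystem_elems.1 (hA i u)
  obtain ⟨b, hb⟩ := mem_ringSystem_elems.1 (hA j v)
  obtain ⟨c, hc⟩ := mem_ringSystem_elems.1 (hA i v)
  obtain ⟨d, hd⟩ := mem_ringSystem_elems.1 (hA j u)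
  have hc0 := iota_mul_inv (p := c) fun h => hiv (by rw [← hc, h, map_zero])
  have hd0 := iota_mul_inv (p := d) fun h => hju (by rw [← hd, h, map_zero])
  rw [← ha, ← hb, ← hc, ← hd, ← eq_inverse hc0] at ht
  rw [← ha, ← hb, ← hc, ← hd]
  refine ⟨_, ⟨a * b * c⁻¹ * d⁻¹, mem_fundamentals.2 ⟨t * d⁻¹, ?_⟩, rfl⟩, ?_⟩
  · simp only [map_mul]
    rw [ht]
    linear_combination hd0
  · simp only [map_mul]
    linear_combination -(iota a * iota b * (iota c * iota c⁻¹)) * hd0 - iota a * iota b * hc0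

variable [Fintype X]

theorem good_of_det_mem [DecidableEq Y] {A : Matrix X Y (UnivRing P)}
    (h : ∀ c, ((fromCols (1 : Matrix X X (UnivRing P)) A).submatrix id c).det ∈
      (ringSystem P).elems) : Good (ringSystem P) A := by
  let S : Set (Matrix X Y (UnivRing P)) := {B | ∀ c,
    ((fromCols (1 : Matrix X X (UnivRing P)) B).submatrix id c).det ∈ (ringSystem P).elems}
  have hmem : ∀ B ∈ S, ∀ i j, B i j ∈ (ringSystem P).elems := by
    intro B hB i j
    have h1 : (fromCols (1 : Matrix X X (UnivRing P)) B).submatrix id Sum.inl = 1 := rfl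
    have h2 := hB (Function.update Sum.inl i (Sum.inr j))
    rwa [det_submatrix_update (by rw [h1, det_one]; exact isUnit_one), formAt_eq_self h1, h1,
      det_one, one_mul] at h2
  have hpiv : ∀ B ∈ S, ∀ k l, B k l ≠ 0 → pivot B k l ∈ S := by
    intro B hB k l hkl c
    have hc2 : c = Equiv.swap (Sum.inl k) (Sum.inr l) ∘
        (Equiv.swap (Sum.inl k) (Sum.inr l) ∘ c) := by
      ext i; simp
    obtain ⟨U, hU, hUM⟩ :=
      exists_rowPivot_eq_mul (fromCols (1 : Matrix X X (UnivRing P)) B) k (Sum.inr l)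
    rw [rowPivot_fromCols B (mul_inverse (hmem B hB k l) hkl)] at hUM
    have e1 : ((fromCols (1 : Matrix X X (UnivRing P)) (pivot B k l)).submatrix id c).det =
        U.det * ((fromCols (1 : Matrix X X (UnivRing P)) B).submatrix id
          (Equiv.swap (Sum.inl k) (Sum.inr l) ∘ c)).det := by
      rw [← det_mul, ← mul_submatrix_id, ← hUM, submatrix_submatrix, Function.id_comp, ← hc2]
    rw [e1, hU]
    exact mul_mem_elems (inverse_mem_elems (hmem B hB k l)) (hB _)
  exact ⟨S, h, fun B hB => good2_of_pivot_mem (hmem B hB) fun k l hkl =>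
    hmem _ (hpiv B hB k l hkl), hpiv⟩

/-- Every minor of `B` is a maximal minor of `[I | B]`. -/
theorem exists_det_fromCols_eq {R : Type*} [CommRing R] (B : Matrix X Y R) {k : ℕ} (f : Fin k ↪ X)
    (g : Fin k → Y) : ∃ c : X → X ⊕ Y,
      ((fromCols (1 : Matrix X X R) B).submatrix id c).det = (B.submatrix f g).det := by
  classical
  -- Rows outside the minor select their own unit columns, which makes the matrix block triangular
  -- with an identity block.
  let c : X → X ⊕ Y := fun x => if h : ∃ t, f t = x then .inr (g h.choose) else .inl x
  have c1 : ∀ t, c (f t) = .inr (g t) := fun t => by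
    have h : ∃ s, f s = f t := ⟨t, rfl⟩
    simp only [c, dif_pos h]
    rw [f.injective h.choose_spec]
  have c2 : ∀ x, (¬ ∃ t, f t = x) → c x = .inl x := fun x h => dif_neg h
  refine ⟨c, ?_⟩
  rw [twoBlockTriangular_det' _ (fun x => ∃ t, f t = x)]
  · have h2 : toSquareBlockProp ((fromCols (1 : Matrix X X R) B).submatrix id c)
        (fun x => ¬ ∃ t, f t = x) = 1 := by
      ext ⟨i, hi⟩ ⟨j, hj⟩
      simp [toSquareBlockProp, c2 j hj, one_apply]
    rw [h2, det_one, mul_one]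
    let e : Fin k ≃ {x // ∃ t, f t = x} := Equiv.ofInjective f f.injective
    rw [← det_submatrix_equiv_self e]
    congr 1
    ext s t
    change fromCols 1 B (f s) (c (f t)) = B (f s) (g t)
    rw [c1]
    rfl
  · rintro i ⟨s, rfl⟩ j hj
    rw [submatrix_apply, c2 j hj]
    exact one_apply_ne fun h => hj ⟨s, h⟩

end Dets

section Representable

variable {P Q : Type*} [PartialField P] [PartialField Q]

theorem isPMatrix_iff {X Y : Type*} {A : Matrix X Y P} : IsPMatrix A ↔
    ∀ (k : ℕ) (f : Fin k ↪ X) (g : Fin k ↪ Y),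
      ((A.map iota).submatrix f g).det ∈ (ringSystem P).elems := by
  refine forall_congr' fun k => forall_congr' fun f => forall_congr' fun g => ?_
  rw [mem_ringSystem_elems]
  refine exists_congr fun d => ?_
  rw [hasDet_iff, submatrix_map]
  exact eq_comm

theorem exists_hasDet_iff {n : ℕ} {A : Matrix (Fin n) (Fin n) P}
    (h : (A.map iota).det ∈ (ringSystem P).elems) :
    (∃ d, HasDet A d ∧ d ≠ 0) ↔ (A.map iota).det ≠ 0 := by
  obtain ⟨d, hd⟩ := mem_ringSystem_elems.1 h
  constructor
  · rintro ⟨d', h1, h2⟩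
    rw [hasDet_iff.1 h1]
    exact fun h => h2 (iota_eq_zero.1 h)
  · intro h0
    exact ⟨d, hasDet_iff.2 hd.symm, fun e => h0 (by rw [← hd, e, map_zero])⟩

theorem exists_hasDet_submatrix_iff {r : ℕ} {Y : Type*} {A : Matrix (Fin r) Y P}
    (hA : IsPMatrix A) (g : Fin r ↪ Y) : (∃ d, HasDet (A.submatrix id g) d ∧ d ≠ 0) ↔
      ((A.map iota).submatrix id g).det ≠ 0 := by
  rw [submatrix_map]
  apply exists_hasDet_iff
  rw [← submatrix_map]
  exact isPMatrix_iff.1 hA r (Function.Embedding.refl _) g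

/-- With r rows no larger square submatrix exists, and permuting the rows changes a maximal minor by
a sign only. -/
theorem hasRank_iff {r : ℕ} {Y : Type*} {A : Matrix (Fin r) Y P} (hA : IsPMatrix A) :
    HasRank A r ↔ ∃ g : Fin r ↪ Y, ((A.map iota).submatrix id g).det ≠ 0 := by
  constructor
  · rintro ⟨⟨f, g, d, hd, hd0⟩, -⟩
    refine ⟨g, fun h0 => hd0 (iota_eq_zero.1 ?_)⟩
    let σ : Equiv.Perm (Fin r) :=
      Equiv.ofBijective f (Finite.injective_iff_bijective.1 f.injective)
    have : (A.submatrix f g).map iota = ((A.map iota).submatrix id g).submatrix σ id := rfl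
    rw [← hasDet_iff.1 hd, this, det_permute, h0, mul_zero]
  · rintro ⟨g, hg⟩
    refine ⟨⟨Function.Embedding.refl _, g, (exists_hasDet_submatrix_iff hA g).2 hg⟩, ?_⟩
    rintro k ⟨f, -⟩
    simpa using Fintype.card_le_of_embedding f

theorem isRepresentable_iff {α : Type*} {M : Matroid α} : IsRepresentable P M ↔
    ∃ (r : ℕ) (A : Matrix (Fin r) M.E P), IsPMatrix A ∧
      (∃ g : Fin r ↪ M.E, ((A.map iota).submatrix id g).det ≠ 0) ∧
      ∀ B : Set M.E, M.IsBase (Subtype.val '' B) ↔ ∃ g : Fin r ↪ M.E, Set.range g = B ∧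
        ((A.map iota).submatrix id g).det ≠ 0 := by
  refine exists_congr fun r => exists_congr fun A => and_congr_right fun hA => ?_
  rw [hasRank_iff hA]
  refine and_congr_right fun _ => forall_congr' fun B => iff_congr Iff.rfl ?_
  refine exists_congr fun g => and_congr_right fun _ => ?_
  exact exists_hasDet_submatrix_iff hA g

/-- It suffices to find a `Q`-matrix with the same nonzero maximal minors. -/
theorem isRepresentable_transfer {α : Type*} {M : Matroid α} (hM : IsRepresentable P M)
    (h : ∀ (r : ℕ) (A : Matrix (Fin r) M.E P), IsPMatrix A →
      (∃ g : Fin r ↪ M.E, ((A.map iota).submatrix id g).det ≠ 0) →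
      ∃ B : Matrix (Fin r) M.E Q, IsPMatrix B ∧ ∀ g : Fin r ↪ M.E,
        ((B.map iota).submatrix id g).det ≠ 0 ↔ ((A.map iota).submatrix id g).det ≠ 0) :
    IsRepresentable Q M := by
  rw [isRepresentable_iff] at hM ⊢
  obtain ⟨r, A, hA, hr, hB⟩ := hM
  obtain ⟨B, hBP, e⟩ := h r A hA hr
  refine ⟨r, B, hBP, hr.imp fun g => (e g).2, fun C => (hB C).trans ?_⟩
  exact exists_congr fun g => and_congr_right fun _ => (e g).symm

/-- Homomorphisms of partial fields preserve representability. -/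
theorem isRepresentable_of_hom (φ : Hom Q P) (h1 : φ.toFun 1 = 1) {α : Type*} {M : Matroid α}
    (hM : IsRepresentable Q M) : IsRepresentable P M := by
  have h0 : φ.toFun 0 = 0 := by
    have := padd_iff.1 (φ.map_padd 0 0 0 (padd_zero 0))
    exact iota_eq_zero.1 (by simpa using this)
  have hne : ∀ x, φ.toFun x = 0 ↔ x = 0 := fun x => by
    refine ⟨fun h => by_contra fun hx => ?_, fun h => by rw [h, h0]⟩
    have := φ.map_mul x x⁻¹
    rw [mul_inv_cancel₀ hx, h1, h, zero_mul] at this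
    exact one_ne_zero this
  have hneg : ∀ x, φ.toFun (-x) = -φ.toFun x := fun x =>
    neg_unique _ _ ((φ.map_padd _ _ _ (padd_neg x)).trans (by rw [h0]))
  have hassoc : ∀ {S : Multiset Q} {r : Q}, Association padd S r →
      Association padd (S.map φ.toFun) (φ.toFun r) := by
    intro S r h
    induction h with
    | leaf p => exact .leaf _
    | node _ _ h ih1 ih2 =>
      rw [Multiset.map_add]
      exact .node ih1 ih2 (φ.map_padd _ _ _ h)
  have hdet : ∀ {n : ℕ} {A : Matrix (Fin n) (Fin n) Q} {d : Q}, HasDet A d →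
      HasDet (A.map φ.toFun) (φ.toFun d) := by
    rintro n A d ⟨Z, hZ⟩
    refine ⟨Z.map φ.toFun, ?_⟩
    have := hassoc hZ
    rw [Multiset.map_add, Multiset.map_add, Multiset.map_map] at this
    convert this using 2
    · unfold detTerms
      rw [Multiset.map_map]
      refine Multiset.map_congr rfl fun σ _ => ?_
      let ψ : Q →* P := ⟨⟨φ.toFun, h1⟩, φ.map_mul⟩
      have hp : φ.toFun (∏ i, A i (σ i)) = ∏ i, φ.toFun (A i (σ i)) := map_prod ψ _ _
      simp only [Function.comp_apply, map_apply, ← hp]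
      split_ifs
      · rfl
      · exact (hneg _).symm
    · rw [Multiset.map_map]
      simp [hneg]
  refine isRepresentable_transfer hM fun r A hA _ => ⟨A.map φ.toFun, fun k f g => ?_, fun g => ?_⟩
  · obtain ⟨d, hd⟩ := hA k f g
    exact ⟨_, hdet hd⟩
  · obtain ⟨d, hd⟩ := hA r (Function.Embedding.refl _) g
    have e1 := hasDet_iff.1 hd
    have e2 := hasDet_iff.1 (hdet hd)
    rw [← submatrix_map] at e1
    rw [← submatrix_map, ← submatrix_map] at e2
    have e1' : ((A.map iota).submatrix id g).det = iota d := e1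
    have e2' : (((A.map φ.toFun).map iota).submatrix id g).det = iota (φ.toFun d) := e2
    rw [e1', e2', not_iff_not, iota_eq_zero, iota_eq_zero, hne]

/-- Lifting along the partial map `u` preserves representability. -/
theorem isRepresentable_of_isCrossLift {u : P → Q} (hu : IsCrossLift u) {α : Type*}
    {M : Matroid α} [M.Finite] (hM : IsRepresentable P M) : IsRepresentable Q M := by
  classical
  refine isRepresentable_transfer hM fun r A hA hr => ?_
  have := M.ground_finite.to_subtype
  obtain ⟨g, hg⟩ := hr
  set N := A.map iota
  have hN : ∀ c : Fin r → M.E, (N.submatrix id c).det ∈ (ringSystem P).elems := by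
    intro c
    by_cases hc : Function.Injective c
    · exact isPMatrix_iff.1 hA r (Function.Embedding.refl _) ⟨c, hc⟩
    · obtain ⟨i, j, hij, hne⟩ := Function.not_injective_iff.1 hc
      rw [det_zero_of_column_eq hne fun k => by simp [hij]]
      exact zero_mem_elems
  obtain ⟨γ, -, hγ⟩ := exists_unit (hN g) hg
  have hunit : IsUnit (N.submatrix id g).det := ⟨γ, hγ⟩
  have hdet : ∀ c : Fin r → M.E, ((formAt N g).submatrix id c).det =
      Ring.inverse (N.submatrix id g).det * (N.submatrix id c).det := by
    intro c
    unfold formAt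
    rw [mul_submatrix_id, det_mul, det_nonsing_inv]
  -- The identity block repeats the columns g, so every maximal minor of [I | formAt N g] is one of
  -- N divided by the minor at g.
  have hcols : fromCols (1 : Matrix (Fin r) (Fin r) (UnivRing P)) (formAt N g) =
      (formAt N g).submatrix id (Sum.elim g id) := by
    ext i (j | j)
    · rw [← formAt_submatrix_self hunit]; rfl
    · rfl
  have hgood : Good (ringSystem P) (formAt N g) := by
    refine good_of_det_mem fun c => ?_
    rw [hcols, submatrix_submatrix, Function.id_comp, hdet]
    exact mul_mem_elems (inverse_mem_elems (hN g)) (hN _)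
  have L := isLiftSystem hu
  obtain ⟨B, hB, e⟩ := L.liftable hgood
  have hBdet : ∀ c : Fin r → Fin r ⊕ M.E,
      ((fromCols (1 : Matrix (Fin r) (Fin r) (UnivRing P × UnivRing Q)) B).submatrix id c).det ∈
        (pairSystem u).elems := by
    intro c
    by_cases h0 : ((fromCols (1 : Matrix (Fin r) (Fin r) (UnivRing P × UnivRing Q)) B).submatrix
        id c).det = 0
    · exact Or.inl h0
    · obtain ⟨γ, hγ, e⟩ := (hB.goodAt L.zero_mem L.one_mem h0).1
      exact Or.inr ⟨γ, hγ, e⟩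
  have hBdet' : ∀ (k : ℕ) (f : Fin k ↪ Fin r) (g : Fin k → M.E),
      (B.submatrix f g).det ∈ (pairSystem u).elems := by
    intro k f g
    obtain ⟨c, hc⟩ := exists_det_fromCols_eq B f g
    rw [← hc]
    exact hBdet c
  -- C is the second coordinate of the lift, read in Q; the first coordinate is the normalised
  -- matrix.
  choose C hC using fun i j => exists_of_mem_pairSystem (hB.mem i j)
  have hCB : (Matrix.of C).map iota = B.map (RingHom.snd (UnivRing P) (UnivRing Q)) := by
    ext i j
    exact (hC i j).1
  have hsnd : ∀ {k : ℕ} (f : Fin k → Fin r) (g : Fin k → M.E),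
      (((Matrix.of C).map iota).submatrix f g).det = (B.submatrix f g).det.2 := by
    intro k f g
    rw [hCB]
    exact (RingHom.map_det (RingHom.snd (UnivRing P) (UnivRing Q)) (B.submatrix f g)).symm
  refine ⟨Matrix.of C, isPMatrix_iff.2 fun k f g => ?_, fun g' => ?_⟩
  · obtain ⟨q, hq, -⟩ := exists_of_mem_pairSystem (hBdet' k f g)
    rw [hsnd, ← hq]
    exact mem_ringSystem_elems.2 ⟨q, rfl⟩
  · have hm := hBdet' r (Function.Embedding.refl _) g'
    obtain ⟨q, hq, hq0⟩ := exists_of_mem_pairSystem hm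
    have h1 : (B.submatrix id g').det.1 = ((formAt N g).submatrix id g').det := by
      rw [← e]
      exact RingHom.map_det (RingHom.fst (UnivRing P) (UnivRing Q)) (B.submatrix id g')
    rw [hsnd, ← not_iff_not, not_not, not_not]
    have hq' : iota q = (B.submatrix id g').det.2 := hq
    rw [← hq', iota_eq_zero, hq0]
    refine (L.map_eq_zero hm).symm.trans ?_
    change (B.submatrix id g').det.1 = 0 ↔ _
    rw [h1, hdet]
    refine ⟨fun h => ?_, fun h => by rw [h, mul_zero]⟩
    by_contra h0
    exact mul_ne (inverse_mem_elems (hN g)) (inverse_ne (hN g) hg) h0 h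

end Representable

end MatrixLift

theorem mainTheorem2 {P : Type*} {Q : Type*} [PartialField P] [PartialField Q]
    (φ : PartialField.Hom Q P) (up : PartialField.fundamentals P → Q)
    (hup : PartialField.IsLiftingFunction φ up)
    (h_two_zero : PartialField.padd (1 : P) 1 = some 0 → PartialField.padd (1 : Q) 1 = some 0)
    (h_two_ne_zero : ∀ s : P, PartialField.padd (1 : P) 1 = some s → s ≠ 0 →
      ∃ t : Q, PartialField.padd (1 : Q) 1 = some t ∧ t ≠ 0)
    (h_triple : ∀ p q r : PartialField.fundamentals P, (p : P) * (q : P) * (r : P) = 1 →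
      up p * up q * up r = 1)
    {α : Type*} (M : Matroid α) [M.Finite] :
    PartialField.IsRepresentable P M ↔ PartialField.IsRepresentable Q M := by
  classical
  constructor
  -- The value 0 outside the fundamental elements is a default that is never consulted.
  · let u : P → Q := fun p => if h : p ∈ PartialField.fundamentals P then up ⟨p, h⟩ else 0
    have hu : ∀ p (h : p ∈ PartialField.fundamentals P), u p = up ⟨p, h⟩ := fun p h => dif_pos h
    refine MatrixLift.isRepresentable_of_isCrossLift (u := u) ⟨?_, ?_, ?_, h_two_zero⟩
    · intro p hp q hq h
      rw [hu p hp, hu q hq]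
      exact hup.map_add_one ⟨p, hp⟩ ⟨q, hq⟩ h
    · intro p hp q hq h
      rw [hu p hp, hu q hq]
      exact hup.map_mul_one ⟨p, hp⟩ ⟨q, hq⟩ h
    · intro p hp q hq r hr h
      rw [hu p hp, hu q hq, hu r hr]
      exact h_triple ⟨p, hp⟩ ⟨q, hq⟩ ⟨r, hr⟩ h
  · refine MatrixLift.isRepresentable_of_hom φ ?_
    -- A homomorphism is not required to preserve 1. Here it does, since the lift of 1 is mapped to
    -- 1 and multiplicativity applies to the product of 1 with it.
    have h1 := hup.section_eq ⟨1, MatrixLift.one_mem_fundamentals⟩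
    have h2 := φ.map_mul 1 (up ⟨1, MatrixLift.one_mem_fundamentals⟩)
    rw [one_mul, h1] at h2
    simpa using h2.symm
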